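/- Let $p$ be a prime, $\mathbb F_q$ a finite field of characteristic $p$ with $q$ elements, $R_T=\mathbb F_q[T]$ and $k=\mathbb F_q(T)$. Let $P\in R_T$ be monic irreducible of degree $d$, let $\mathfrak p_\infty$ be the infinite prime (the pole divisor of $T$) of $k$, and let $n\ge 2$, $\alpha\ge 0$ be integers. All extensions of $k$ are taken inside a fixed algebraic closure of $k$. The conductor $\mathfrak F_K$ of a finite abelian extension $K/k$ is the divisor $\prod_{\mathfrak p}\mathfrak p^{f_{\mathfrak p}}$ of $k$, where $f_{\mathfrak p}$ is the least integer $m\ge 0$ for which the ramification group $G^m$ in upper numbering at $\mathfrak p$ is trivial (this is the conductor of class field theory). Fix an extension $K_{n-1}/k$ of degree $p^{n-1}$. Then the number of cyclic extensions $K_n/k$ of degree $p^n$ such that $K_{n-1}\subseteq K_n$, $P$ is the only prime divisor of $k$ ramified in $K_n$, $P$ is fully ramified in $K_n/k$, $\mathfrak p_\infty$ is fully decomposed in $K_n/k$, and $\mathfrak F_{K_n}\mid P^\alpha$, is finite and at most $$\frac{1+w(\alpha)}{p}=\frac1p\,q^{d\left(\alpha-\lceil \alpha/p\rceil\right)},$$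 where $$w(\alpha)=\sum_{\substack{1\le\lambda\le\alpha-1\\ \gcd(\lambda,p)=1}}\Phi\!\left(P^{\lambda-\lfloor\lambda/p\rfloor}\right),\qquad \Phi(N)=\left|\left(R_T/(N)\right)^{*}\right| .$$ -/

import Mathlib

open Polynomial IsDedekindDomain
open scoped Pointwise

noncomputable section

namespace FunctionFieldCount

/-! ### Places, ramification and decomposition

A prime divisor (place) of a field `K` is represented by its valuation ring, a `ValuationSubring K`
different from `⊤ = K`.  For a finite extension of `F(T)` with `F` finite, every valuation ring
contains the (finite) constant field, so these are exactly the usual prime divisors, the infinite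
one included. -/

section Places

variable {k : Type*} (L : Type*) [Field k] [Field L] [Algebra k L]

/-- The prime divisors `𝔓` of `L` dividing the prime divisor `𝔭` of `k`. -/
def placesAbove (𝔭 : ValuationSubring k) : Set (ValuationSubring L) :=
  {𝔓 | 𝔓.comap (algebraMap k L) = 𝔭}

variable (k) {L} in
/-- The ramification index of `𝔓` over `k`: the index of the value group of `k` in the value
group of `L`, with respect to the valuation of `𝔓`. -/
def ramificationIndex (𝔓 : ValuationSubring L) : ℕ :=
  ((Units.map (𝔓.valuation : L →* 𝔓.ValueGroup)).comp
    (Units.map (algebraMap k L : k →* L))).range.index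

/-- `𝔭` is ramified in `L/k`: some prime divisor of `L` above it has ramification index `≠ 1`.
(Residue field extensions are separable for the finite residue fields considered here.) -/
def IsRamified (𝔭 : ValuationSubring k) : Prop :=
  ∃ 𝔓 ∈ placesAbove L 𝔭, ramificationIndex k 𝔓 ≠ 1

/-- `𝔭` is fully ramified in `L/k`. -/
def IsFullyRamified (𝔭 : ValuationSubring k) : Prop :=
  ∀ 𝔓 ∈ placesAbove L 𝔭, ramificationIndex k 𝔓 = Module.finrank k L

/-- `𝔭` is fully decomposed in `L/k`: there are `[L : k]` prime divisors above it. -/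
def IsFullyDecomposed (𝔭 : ValuationSubring k) : Prop :=
  (placesAbove L 𝔭).ncard = Module.finrank k L

end Places

/-! ### Ramification groups and the conductor -/

section Conductor

variable (k : Type*) {L : Type*} [Field k] [Field L] [Algebra k L]

/-- The ramification group `G_i` (`i ≥ 0`) in lower numbering: the elements `σ` of the
decomposition group of `𝔓` with `σ x ≡ x mod 𝔓^(i+1)` for all `x` in the valuation ring. -/
def lowerRamificationGroup (𝔓 : ValuationSubring L) (i : ℕ) :
    Subgroup (𝔓.decompositionSubgroup k) :=
  (Submodule.toAddSubgroup (IsLocalRing.maximalIdeal 𝔓 ^ (i + 1))).inertia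
    (𝔓.decompositionSubgroup k)

/-- Herbrand's function at the integers `u ≥ 0`:
`φ(u) = ∫₀ᵘ dt / [G_0 : G_t] = (|G_1| + ⋯ + |G_u|) / |G_0|`. -/
def herbrand (𝔓 : ValuationSubring L) (u : ℕ) : ℚ :=
  (∑ i ∈ Finset.Icc 1 u, (Nat.card (lowerRamificationGroup k 𝔓 i) : ℚ)) /
    Nat.card (lowerRamificationGroup k 𝔓 0)

/-- The ramification group `G^v = G_{ψ(v)}` (`v ≥ 0`) in upper numbering, `ψ` being the inverse of
Herbrand's function `φ`.  As `G_t = G_⌈t⌉`, it is `G_u` for the least integer `u` with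
`v ≤ φ(u)`. -/
def upperRamificationGroup (𝔓 : ValuationSubring L) (v : ℚ) :
    Subgroup (𝔓.decompositionSubgroup k) :=
  lowerRamificationGroup k 𝔓 (sInf {u : ℕ | v ≤ herbrand k 𝔓 u})

variable {k}

/-- The conductor `𝔉` of an abelian extension `L/k`, as a divisor of `k`: its exponent at a prime
divisor `𝔭` is the least integer `m ≥ 0` such that the `m`-th ramification group in upper
numbering is trivial at the prime divisors above `𝔭`. -/
def conductor (L : Type*) [Field L] [Algebra k L] (𝔭 : ValuationSubring k) : ℕ :=
  sInf {m : ℕ | ∀ 𝔓 ∈ placesAbove L 𝔭, upperRamificationGroup k 𝔓 m = ⊥}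

open Classical in
/-- The conductor of `L/k` divides `𝔭 ^ α`. -/
def ConductorDvdPow (L : Type*) [Field L] [Algebra k L] (𝔭 : ValuationSubring k) (α : ℕ) : Prop :=
  ∀ 𝔮 : ValuationSubring k, 𝔮 ≠ ⊤ → conductor L 𝔮 ≤ if 𝔮 = 𝔭 then α else 0

end Conductor

/-! ### The rational function field -/

section Rational

variable (F : Type*) [Field F]

/-- The prime divisor of `F(T)` given by an irreducible polynomial `P`. -/
def finitePlace {F : Type*} [Field F] {P : F[X]} (hP : Irreducible P) :
    ValuationSubring (RatFunc F) :=
  ((HeightOneSpectrum.ofPrime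
    (Ideal.prime_span_singleton_iff.mpr hP.prime)).valuation (RatFunc F)).valuationSubring

open Classical in
/-- The infinite prime of `F(T)`, the pole divisor of `T`. -/
def infinitePlace : ValuationSubring (RatFunc F) :=
  (RatFunc.inftyValuation F).valuationSubring

/-- `K/F(T)` is a cyclic extension of degree `p ^ n` such that `P` is the only ramified prime
divisor, `P` is fully ramified, the infinite prime is fully decomposed, and the conductor of `K`
divides `P ^ α`. -/
structure IsAdmissible {F : Type*} [Field F] {P : F[X]} (hP : Irreducible P) (p n α : ℕ)
    (K : Type*) [Field K] [Algebra (RatFunc F) K] : Prop where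
  isGalois : IsGalois (RatFunc F) K
  isCyclic : IsCyclic (K ≃ₐ[RatFunc F] K)
  finrank_eq : Module.finrank (RatFunc F) K = p ^ n
  ramified_iff : ∀ 𝔮 : ValuationSubring (RatFunc F), 𝔮 ≠ ⊤ →
    (IsRamified K 𝔮 ↔ 𝔮 = finitePlace hP)
  fullyRamified : IsFullyRamified K (finitePlace hP)
  fullyDecomposed : IsFullyDecomposed K (infinitePlace F)
  conductor_dvd : ConductorDvdPow K (finitePlace hP) α

/-- `Φ(N)`, the order of the unit group of `F[T] / (N)`. -/
def polyTotient {F : Type*} [Field F] (N : F[X]) : ℕ :=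
  Nat.card (F[X] ⧸ Ideal.span {N})ˣ

/-- `w(α) = ∑ Φ(P ^ (λ - [λ / p]))` over the integers `1 ≤ λ ≤ α - 1` coprime to `p`. -/
def wSum {F : Type*} [Field F] (P : F[X]) (p α : ℕ) : ℕ :=
  ∑ l ∈ Finset.Ico 1 α with l.Coprime p, polyTotient (P ^ (l - l / p))

end Rational

end FunctionFieldCount

end

noncomputable section

namespace FunctionFieldCount

/-! ### Discrete additive valuations -/

section ValBasics

variable {K : Type*} [Field K] (w : AddValuation K (WithTop ℤ))

/-! Write k = F(T), ℘(x) = x ^ p - x, d = deg P and q = |F|. If some admissible `K₀` exists, extend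
a generator of its Galois group to an automorphism φ of Ω. As n ≥ 2, generating a cyclic p-group can
be tested on its nontrivial quotient Gal(K'/k), so φ restricts to a generator for every admissible
`K` (`restrictNormal_generates`). Fix z₀ in `K₀` with φ ^ p ^ (n-1) z₀ = z₀ + 1. Additive Hilbert 90
in K' yields z in `K` with the same property and with φ z - z = φ z₀ - z₀. Then y = z - z₀ is fixed
by φ, and a = ℘(y) lies in K' and is fixed by φ, hence lies in k (`exists_artinSchreier_sub_eq`).
Since `K` is generated over K' by z₀ + y, it is encoded by a, and a may be changed by ℘(k).

The local hypotheses normalize a (`IsAdmissible.exists_sub_artinSchreier_mem_polarParts`). At a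
prime Q ≠ P both extensions are unramified, so a is integral modulo ℘(k). At infinity both are fully
decomposed, so z and z₀ are approximated by elements of k, and a vanishes there modulo ℘(k). At P
the reduced pole order of a is smaller than α. Principal parts glue these local corrections, and a
becomes g / P ^ (α-1) with deg g < deg P ^ (α-1).

The bound at P is the deep point (`pole_lt_of_totallyRamified`). A totally ramified cyclic extension
is a tower of Artin–Schreier layers with reduced generators and increasing lower breaks t_0 < t_1 <
⋯. An element of k of reduced pole order λ has, after the j-th layer is adjoined, reduced pole order
L_(j+1) = p L_j - (p-1) t_j with L_0 = λ, as long as L_j > t_j. This recursion is Herbrand's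
function in disguise: if λ ≥ α ≥ conductor, then L_(n-1) > t_(n-1). So if a had reduced pole order
at least α, it would have in K' a larger reduced pole than both ℘(z) and ℘(z₀), although it is their
difference; this is impossible, because a pole of ℘ has order divisible by p.

For the count let s = ⌊(α-1)/p⌋, and let a₁ = ℘(y₁) be the normalized constant of the first layer of
K'. The map sending (K, j, u) to a_K + j a₁ + ℘(u), with j in Fin p and u a polar part of order at
most s, is injective into the polar parts of order at most α-1 (`finite_and_ncard_mul_le`). Hence
the number of `K`, times p q ^ (d s), is at most q ^ (d (α-1)). Finally 1 + w(α) = q ^ (d (α-1-s)),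
because the sum defining w telescopes (`one_add_wSum`). -/

lemma exists_val_eq {x : K} (hx : x ≠ 0) : ∃ r : ℤ, w x = r := by
  obtain ⟨r, hr⟩ := WithTop.ne_top_iff_exists.mp ((AddValuation.ne_top_iff w).mpr hx)
  exact ⟨r, hr.symm⟩

variable {w}

lemma ne_zero_of_val {x : K} {r : ℤ} (h : w x = r) : x ≠ 0 := by
  rintro rfl
  simp at h

lemma val_lt_iff {x : K} {r : ℤ} : (r : WithTop ℤ) < w x ↔ ((r + 1 : ℤ) : WithTop ℤ) ≤ w x := by
  cases h : w x with
  | top => simp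
  | coe a => norm_cast

lemma val_add_eq {x y : K} {r : ℤ} (hx : w x = r) (hy : (r : WithTop ℤ) < w y) :
    w (x + y) = r := by
  rw [AddValuation.map_add_eq_of_lt_left w (hx ▸ hy), hx]

lemma val_sub_eq {x y : K} {r : ℤ} (hx : w x = r) (hy : (r : WithTop ℤ) < w y) :
    w (x - y) = r := by
  rw [AddValuation.map_sub_eq_of_lt_left w (hx ▸ hy), hx]

lemma val_mul_eq {x y : K} {r s : ℤ} (hx : w x = r) (hy : w y = s) :
    w (x * y) = (r + s : ℤ) := by
  rw [AddValuation.map_mul, hx, hy]; norm_cast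

lemma val_mul_le {x y : K} {r s : ℤ} (hx : (r : WithTop ℤ) ≤ w x) (hy : (s : WithTop ℤ) ≤ w y) :
    ((r + s : ℤ) : WithTop ℤ) ≤ w (x * y) := by
  rw [AddValuation.map_mul]; push_cast; exact add_le_add hx hy

lemma val_pow_eq {x : K} {r : ℤ} (hx : w x = r) (n : ℕ) : w (x ^ n) = (n * r : ℤ) := by
  rw [AddValuation.map_pow, hx]
  induction n with
  | zero => simp
  | succ n ih => rw [succ_nsmul, ih]; norm_cast; push_cast; ring

lemma val_inv_eq {x : K} {r : ℤ} (hx : w x = r) : w x⁻¹ = (-r : ℤ) := by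
  have h0 := ne_zero_of_val hx
  obtain ⟨s, hs⟩ := exists_val_eq w (inv_ne_zero h0)
  have := val_mul_eq hx hs
  rw [mul_inv_cancel₀ h0, AddValuation.map_one] at this
  rw [hs]
  norm_cast at this ⊢
  omega

lemma val_zpow_eq {x : K} {r : ℤ} (hx : w x = r) (n : ℤ) : w (x ^ n) = (n * r : ℤ) := by
  cases n with
  | ofNat n => simpa using val_pow_eq hx n
  | negSucc n =>
    rw [zpow_negSucc]
    have := val_inv_eq (val_pow_eq hx (n + 1))
    rw [this, Int.negSucc_eq]
    congr 1; push_cast; ring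

lemma val_div_eq {x y : K} {r s : ℤ} (hx : w x = r) (hy : w y = s) :
    w (x / y) = (r - s : ℤ) := by
  rw [div_eq_mul_inv, sub_eq_add_neg]
  exact val_mul_eq hx (val_inv_eq hy)

lemma val_div_le {x y : K} {r s : ℤ} (hx : (r : WithTop ℤ) ≤ w x) (hy : w y = s) :
    ((r - s : ℤ) : WithTop ℤ) ≤ w (x / y) := by
  rw [div_eq_mul_inv, sub_eq_add_neg]
  exact val_mul_le hx (val_inv_eq hy).ge

lemma val_pow_nonneg {x : K} (hx : 0 ≤ w x) (n : ℕ) : 0 ≤ w (x ^ n) := by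
  rw [AddValuation.map_pow]; exact nsmul_nonneg hx n

lemma val_one_eq : w 1 = (0 : ℤ) := by simp

variable (w) in
lemma val_natCast_nonneg (n : ℕ) : 0 ≤ w (n : K) := by
  induction n with
  | zero => simp
  | succ n ih => push_cast; exact AddValuation.map_le_add w ih (by simp)

/-- A nonzero element of the prime field is a root of unity by Fermat, so every valuation is trivial
on it. -/
lemma val_natCast_eq (p : ℕ) [Fact p.Prime] [CharP K p] {n : ℕ} (hn : ¬ p ∣ n) :
    w (n : K) = (0 : ℤ) := by
  have h0 : (n : K) ≠ 0 := by rwa [Ne, CharP.cast_eq_zero_iff K p]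
  have h1 : (n : K) ^ (p - 1) = 1 := by
    have hz : (n : ZMod p) ≠ 0 := by rwa [Ne, CharP.cast_eq_zero_iff (ZMod p) p]
    have := ZMod.pow_card_sub_one_eq_one hz
    have h2 := congrArg (ZMod.castHom (dvd_refl p) K) this
    simpa using h2
  obtain ⟨r, hr⟩ := exists_val_eq w h0
  have h2 := val_pow_eq hr (p - 1)
  rw [h1, val_one_eq] at h2
  have hp : 1 < p := (Fact.out : p.Prime).one_lt
  have h3 : ((p - 1 : ℕ) : ℤ) * r = 0 := by exact_mod_cast h2.symm
  rcases mul_eq_zero.mp h3 with h | h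
  · omega
  · rw [hr, h]

end ValBasics

/-! ### The Artin–Schreier map and reduction of poles -/

section ArtinSchreier

variable {K : Type*} [Field K] (p : ℕ) [Fact p.Prime]

/-- The Artin–Schreier map `x ↦ x ^ p - x`. -/
def artinSchreier (x : K) : K := x ^ p - x

variable [CharP K p]

lemma artinSchreier_add (x y : K) :
    artinSchreier p (x + y) = artinSchreier p x + artinSchreier p y := by
  simp only [artinSchreier, add_pow_char]; ring

lemma artinSchreier_sub (x y : K) :
    artinSchreier p (x - y) = artinSchreier p x - artinSchreier p y := by
  simp only [artinSchreier, sub_pow_char]; ring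

omit [CharP K p] in
lemma artinSchreier_zero : artinSchreier p (0 : K) = 0 := by
  simp [artinSchreier, (Fact.out : p.Prime).ne_zero]

omit [Fact p.Prime] [CharP K p] in
lemma map_artinSchreier {L R : Type*} [Field L] [FunLike R K L] [RingHomClass R K L] (f : R)
    (x : K) : f (artinSchreier p x) = artinSchreier p (f x) := by
  simp [artinSchreier]

lemma artinSchreier_natCast (n : ℕ) : artinSchreier p (n : K) = 0 := by
  have : ((n : ZMod p)) ^ p = n := ZMod.pow_card _
  have h2 := congrArg (ZMod.castHom (dvd_refl p) K) this
  simp only [map_pow, map_natCast] at h2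
  rw [artinSchreier, h2, sub_self]

lemma artinSchreier_natCast_mul (n : ℕ) (x : K) :
    artinSchreier p (n * x) = n * artinSchreier p x := by
  have h2 := artinSchreier_natCast (K := K) p n
  rw [artinSchreier, sub_eq_zero] at h2
  simp only [artinSchreier, mul_pow, h2]; ring

/-- X ^ p - X already splits over the prime field, so the kernel of ℘ is the prime field in every
field of characteristic p. -/
lemma exists_natCast_of_artinSchreier_eq_zero {x : K} (hx : artinSchreier p x = 0) :
    ∃ n : ℕ, x = n := by
  have h := (FiniteField.roots_X_pow_card_sub_X (ZMod p))
  have h1 : (X ^ p - X : (ZMod p)[X]) = ∏ a : ZMod p, (X - C a) := by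
    have := FiniteField.X_pow_card_sub_X_natDegree_eq (ZMod p) (Fact.out : p.Prime).one_lt
    have hm : (X ^ p - X : (ZMod p)[X]).Monic := by
      apply monic_X_pow_sub
      simpa using (Fact.out : p.Prime).one_lt
    rw [ZMod.card] at h
    have hc : Multiset.card (X ^ p - X : (ZMod p)[X]).roots =
        (X ^ p - X : (ZMod p)[X]).natDegree := by
      rw [h, this]; simp
    have := prod_multiset_X_sub_C_of_monic_of_roots_card_eq hm hc
    rw [h] at this
    rw [← this]; rfl
  have h2 := congrArg (fun f => Polynomial.eval₂ (ZMod.castHom (dvd_refl p) K) x f) h1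
  simp only [eval₂_sub, eval₂_pow, eval₂_X, eval₂_finsetProd, eval₂_C] at h2
  rw [show x ^ p - x = 0 from hx] at h2
  obtain ⟨a, -, ha⟩ := Finset.prod_eq_zero_iff.mp h2.symm
  refine ⟨a.val, ?_⟩
  rw [sub_eq_zero] at ha
  rw [ha]
  simp

variable {p} {w : AddValuation K (WithTop ℤ)}

omit [CharP K p] in
lemma val_artinSchreier_of_neg {x : K} {r : ℤ} (hx : w x = r) (hr : r < 0) :
    w (artinSchreier p x) = (p * r : ℤ) := by
  refine val_sub_eq (val_pow_eq hx p) ?_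
  rw [hx]
  have hp : (1 : ℤ) < p := by exact_mod_cast (Fact.out : p.Prime).one_lt
  norm_cast
  nlinarith

omit [Fact p.Prime] [CharP K p] in
lemma val_artinSchreier_nonneg {x : K} (hx : 0 ≤ w x) : 0 ≤ w (artinSchreier p x) :=
  AddValuation.map_le_sub w (val_pow_nonneg hx p) hx

-- A pole of ℘(x) comes from x ^ p, which dominates x. The resulting divisibility of pole orders by
-- p is the source of the contradictions in the local comparison.
omit [CharP K p] in
lemma val_of_artinSchreier_neg {x : K} {s : ℤ} (hx : w (artinSchreier p x) = s) (hs : s < 0) :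
    ∃ r : ℤ, r < 0 ∧ s = p * r ∧ w x = r := by
  have hx0 : x ≠ 0 := by
    rintro rfl
    rw [artinSchreier_zero] at hx
    simp at hx
  obtain ⟨r, hr⟩ := exists_val_eq w hx0
  have hr0 : r < 0 := by
    by_contra! h
    have := val_artinSchreier_nonneg (p := p) (w := w) (x := x) (by rw [hr]; exact_mod_cast h)
    rw [hx] at this
    exact absurd hs (not_lt.mpr (by exact_mod_cast this))
  refine ⟨r, hr0, ?_, hr⟩
  have := val_artinSchreier_of_neg (p := p) hr hr0
  rw [hx] at this
  exact_mod_cast this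

/-- Reduction of Artin–Schreier classes: over a discretely valued subfield with value group `e ℤ`
and perfect residue field, any pole order can be made prime to `p`. -/
lemma exists_reduced (E : Subfield K) {e : ℤ} (he : 0 < e) {π : K} (hπE : π ∈ E) (hπ : w π = e)
    (hval : ∀ x ∈ E, x ≠ 0 → ∃ r : ℤ, w x = (e * r : ℤ))
    (hperf : ∀ u : K, w u = 0 → ∃ m : ℕ, 1 ≤ m ∧ 0 < w (u ^ p ^ m - u)) {c : K} (hc : c ∈ E) :
    ∃ x ∈ E, w c ≤ w (c - artinSchreier p x) ∧ (0 ≤ w (c - artinSchreier p x) ∨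
      ∃ t : ℤ, 0 < t ∧ ¬ (p : ℤ) ∣ t ∧ w (c - artinSchreier p x) = (-(e * t) : ℤ)) := by
  have hp : (1 : ℤ) < p := by exact_mod_cast (Fact.out : p.Prime).one_lt
  by_cases hc0 : 0 ≤ w c
  · exact ⟨0, E.zero_mem, by simp [artinSchreier_zero], Or.inl (by simpa [artinSchreier_zero])⟩
  have hcne : c ≠ 0 := by rintro rfl; simp at hc0
  obtain ⟨r, hr⟩ := hval c hc hcne
  have hr0 : r < 0 := by
    by_contra! h
    exact hc0 (by rw [hr]; exact_mod_cast mul_nonneg he.le h)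
  obtain ⟨k, hk⟩ : ∃ k : ℕ, r = -(k : ℤ) := ⟨r.natAbs, by omega⟩
  subst hk
  induction k using Nat.strong_induction_on generalizing c with
  | _ k ih =>
  by_cases hdiv : (p : ℤ) ∣ k
  · obtain ⟨s, hs⟩ := hdiv
    have hs0 : 0 < s := by nlinarith
    have hu : w (c * π ^ (p * s : ℤ)) = 0 := by
      rw [val_mul_eq hr (val_zpow_eq hπ _), hs]
      have : e * -(p * s) + p * s * e = 0 := by ring
      rw [this]; rfl
    obtain ⟨m, hm1, hm⟩ := hperf _ hu
    set u := c * π ^ (p * s : ℤ) with hu_def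
    have hu' : w u = (0 : ℤ) := hu
    have huE : u ∈ E := E.mul_mem hc (zpow_mem hπE _)
    have hπ0 := ne_zero_of_val hπ
    -- An approximate p-th root of c: since u ^ p ^ m ≡ u, the power u ^ p ^ (m - 1) is a p-th root
    -- of u modulo the maximal ideal. Being a power of u it stays in E, so no residue has to be
    -- lifted to E.
    set y := u ^ p ^ (m - 1) * π ^ (-s) with hy
    have hyE : y ∈ E := E.mul_mem (E.pow_mem huE _) (zpow_mem hπE _)
    have hwy : w y = (-(s * e) : ℤ) := by
      rw [hy, val_mul_eq (val_pow_eq hu' _) (val_zpow_eq hπ _)]; congr 1; ring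
    have hyp : c - y ^ p = (u - u ^ p ^ m) * π ^ (-(p * s) : ℤ) := by
      have h1 : c = u * π ^ (-(p * s) : ℤ) := by
        rw [hu_def, mul_assoc, ← zpow_add₀ hπ0]; simp
      have h2 : y ^ p = u ^ p ^ m * π ^ (-(p * s) : ℤ) := by
        rw [hy, mul_pow, ← pow_mul, ← pow_succ, Nat.sub_add_cancel hm1, ← zpow_natCast (π ^ (-s)),
          ← zpow_mul]
        congr 2; ring
      rw [h2]; nth_rw 1 [h1]; ring
    have hbig : ((e * -(k : ℤ) : ℤ) : WithTop ℤ) < w (c - artinSchreier p y) := by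
      have : c - artinSchreier p y = (c - y ^ p) + y := by rw [artinSchreier]; ring
      rw [this, hyp]
      refine AddValuation.map_lt_add w ?_ ?_
      · rw [val_lt_iff]
        have hm' : ((1 : ℤ) : WithTop ℤ) ≤ w (u - u ^ p ^ m) := by
          rw [AddValuation.map_sub_swap]
          have := (val_lt_iff (w := w) (x := u ^ p ^ m - u) (r := 0)).mp (by exact_mod_cast hm)
          simpa using this
        have := val_mul_le hm' (val_zpow_eq hπ (-(p * s) : ℤ)).ge
        refine le_trans ?_ this
        norm_cast
        rw [hs]; nlinarith
      · rw [hwy, hs]; norm_cast; nlinarith [mul_pos hs0 he]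
    have hc'E : c - artinSchreier p y ∈ E :=
      E.sub_mem hc (E.sub_mem (E.pow_mem hyE _) hyE)
    by_cases h0 : 0 ≤ w (c - artinSchreier p y)
    · exact ⟨y, hyE, hr ▸ hbig.le, Or.inl h0⟩
    have hne : c - artinSchreier p y ≠ 0 := by
      intro h; rw [h] at h0; simp at h0
    obtain ⟨r', hr'⟩ := hval _ hc'E hne
    have hr'0 : r' < 0 := by
      by_contra! h
      exact h0 (by rw [hr']; exact_mod_cast mul_nonneg he.le h)
    have hlt : -(k : ℤ) < r' := by
      rw [hr'] at hbig
      have : e * -(k : ℤ) < e * r' := by exact_mod_cast hbig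
      exact lt_of_mul_lt_mul_left this he.le
    have hrr : r' = -((r'.natAbs : ℕ) : ℤ) := by omega
    obtain ⟨x, hxE, hx1, hx2⟩ := ih r'.natAbs (by omega) hc'E h0 hne (by rw [← hrr]; exact hr')
      (by omega)
    have hsum : c - artinSchreier p (y + x) = c - artinSchreier p y - artinSchreier p x := by
      rw [artinSchreier_add]; ring
    refine ⟨y + x, E.add_mem hyE hxE, ?_, ?_⟩
    · rw [hsum]; exact (hr ▸ hbig.le).trans hx1
    · rw [hsum]; exact hx2
  · refine ⟨0, E.zero_mem, by simp [artinSchreier_zero], Or.inr ⟨k, by omega, hdiv, ?_⟩⟩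
    rw [artinSchreier_zero, sub_zero, hr]; congr 1; ring

end ArtinSchreier

/-! ### The operator τ - 1 in characteristic p -/

section CyclicAction

variable {K : Type*} [Field K]

lemma ringAut_pow_add_apply (τ : RingAut K) (a b : ℕ) (x : K) :
    (τ ^ (a + b)) x = (τ ^ a) ((τ ^ b) x) := by
  rw [pow_add]; rfl

lemma ringAut_pow_succ_apply (τ : RingAut K) (a : ℕ) (x : K) :
    (τ ^ (a + 1)) x = τ ((τ ^ a) x) := by
  rw [pow_succ']; rfl

lemma ringAut_pow_apply_eq_self {τ : RingAut K} {x : K} (h : τ x = x) (a : ℕ) :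
    (τ ^ a) x = x := by
  induction a with
  | zero => rfl
  | succ a ih => rw [ringAut_pow_succ_apply, ih, h]

/-- The subfield fixed by an automorphism. -/
def fixedSubfield (τ : RingAut K) : Subfield K where
  carrier := {x | τ x = x}
  mul_mem' {a b} ha hb := by simp_all
  one_mem' := by simp
  add_mem' {a b} ha hb := by simp_all
  zero_mem' := by simp
  neg_mem' {a} ha := by simp_all
  inv_mem' a ha := by simp_all

lemma mem_fixedSubfield {τ : RingAut K} {x : K} : x ∈ fixedSubfield τ ↔ τ x = x := Iff.rfl

lemma fixedSubfield_pow_le (τ : RingAut K) {a b : ℕ} (h : a ∣ b) :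
    fixedSubfield (τ ^ a) ≤ fixedSubfield (τ ^ b) := by
  obtain ⟨c, rfl⟩ := h
  intro x hx
  rw [mem_fixedSubfield, pow_mul]
  exact ringAut_pow_apply_eq_self hx c

lemma map_prod_iterate {τ : RingAut K} {m : ℕ} {x : K} (h : (τ ^ m) x = x) :
    τ (∏ i ∈ Finset.range m, (τ ^ i) x) = ∏ i ∈ Finset.range m, (τ ^ i) x := by
  rw [map_prod]
  simp only [← ringAut_pow_succ_apply]
  rcases m with _ | m
  · simp
  · rw [Finset.prod_range_succ, h, Finset.prod_range_succ' (fun i => (τ ^ i) x)]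
    simp

lemma sum_iterate_sub (τ : RingAut K) (m : ℕ) (x : K) :
    ∑ i ∈ Finset.range m, (τ ^ i) (τ x - x) = (τ ^ m) x - x := by
  have : ∀ i, (τ ^ i) (τ x - x) = (τ ^ (i + 1)) x - (τ ^ i) x := by
    intro i
    rw [map_sub, ringAut_pow_add_apply, pow_one]
  simp only [this]
  rw [Finset.sum_range_sub (fun i => (τ ^ i) x)]
  simp

/-- `τ - 1` as an additive endomorphism. -/
def subOne (τ : RingAut K) : AddMonoid.End K where
  toFun x := τ x - x
  map_zero' := by simp
  map_add' x y := by simp only [map_add]; ring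

lemma subOne_apply (τ : RingAut K) (x : K) : subOne τ x = τ x - x := rfl

lemma end_mul_apply (f g : AddMonoid.End K) (x : K) : (f * g) x = f (g x) := rfl

lemma subOne_mul_of_fixed {τ : RingAut K} {c : K} (hc : τ c = c) (x : K) (r : ℕ) :
    (subOne τ ^ r) (c * x) = c * (subOne τ ^ r) x := by
  induction r generalizing x with
  | zero => rfl
  | succ r ih =>
    simp only [pow_succ, end_mul_apply]
    rw [← ih]
    congr 1
    simp only [subOne_apply, map_mul, hc]; ring

lemma subOne_pow_mem {τ : RingAut K} {E : Subfield K} (hE : ∀ x ∈ E, τ x ∈ E) (r : ℕ) {x : K}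
    (hx : x ∈ E) : (subOne τ ^ r) x ∈ E := by
  induction r with
  | zero => exact hx
  | succ r ih =>
    rw [pow_succ', end_mul_apply, subOne_apply]
    exact E.sub_mem (hE _ ih) ih

/-- A form of additive Hilbert 90, for a stable subfield `E`. -/
lemma exists_map_sub_eq {τ : RingAut K} {E : Subfield K} (hE : ∀ x ∈ E, τ x ∈ E) {N : ℕ} {θ : K}
    (hθE : θ ∈ E) (hθ : (subOne τ ^ (N - 1)) θ = 1) {g : K} (hgE : g ∈ E)
    (hg : (subOne τ ^ (N - 1)) g = 0) : ∃ h ∈ E, τ h - h = g := by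
  have key : ∀ r : ℕ, r ≤ N - 1 → ∀ g ∈ E, (subOne τ ^ r) g = 0 → ∃ h ∈ E, subOne τ h = g := by
    intro r
    induction r with
    | zero =>
      intro _ g _ hg
      have : g = 0 := by simpa using hg
      exact ⟨0, E.zero_mem, by rw [this, map_zero]⟩
    | succ r ih =>
      intro hr g hgE hg
      set c := (subOne τ ^ r) g with hc
      have hcE : c ∈ E := subOne_pow_mem hE r hgE
      have hcfix : τ c = c := by
        rw [pow_succ', end_mul_apply, ← hc, subOne_apply, sub_eq_zero] at hg
        exact hg
      -- The exponent makes (τ - 1) ^ r applied to (τ - 1) e equal to (τ - 1) ^ (N - 1) θ = 1.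
      -- Subtracting c (τ - 1) e therefore lowers by one the power of τ - 1 that kills g.
      set e := (subOne τ ^ (N - 1 - r - 1)) θ with he
      have heE : e ∈ E := subOne_pow_mem hE _ hθE
      have he1 : (subOne τ ^ r) (subOne τ e) = 1 := by
        rw [he, ← end_mul_apply, ← end_mul_apply, mul_assoc, ← pow_succ', ← pow_add]
        convert hθ using 3
        omega
      obtain ⟨h, hhE, hh⟩ := ih (by omega) (g - c * subOne τ e)
        (E.sub_mem hgE (E.mul_mem hcE (E.sub_mem (hE _ heE) heE))) (by
        rw [map_sub, subOne_mul_of_fixed hcfix, he1, mul_one, ← hc, sub_self])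
      refine ⟨h + c * e, E.add_mem hhE (E.mul_mem hcE heE), ?_⟩
      have h3 := subOne_mul_of_fixed hcfix e 1
      rw [pow_one] at h3
      rw [map_add, hh, h3]; ring
  exact key _ le_rfl g hgE hg

variable (p : ℕ) [Fact p.Prime] [CharP K p]

/-- Additive endomorphisms form a ring of characteristic p in which τ commutes with 1, so the
Frobenius identity expands (τ - 1) ^ p ^ a. -/
lemma subOne_pow_char_pow (τ : RingAut K) (a : ℕ) (x : K) :
    (subOne τ ^ p ^ a) x = (τ ^ p ^ a) x - x := by
  let f : AddMonoid.End K := { toFun := τ, map_zero' := map_zero τ, map_add' := map_add τ }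
  have hf : subOne τ = f - 1 := rfl
  have hpow : ∀ i z, (f ^ i) z = (τ ^ i) z := by
    intro i
    induction i with
    | zero => intro z; rfl
    | succ i ih =>
      intro z
      rw [pow_succ', ringAut_pow_succ_apply, end_mul_apply, ih]; rfl
  have : CharP (AddMonoid.End K) p := by
    refine ⟨fun n => ?_⟩
    rw [← CharP.cast_eq_zero_iff K p n]
    constructor
    · intro h
      have := DFunLike.congr_fun h (1 : K)
      simpa [AddMonoid.End.natCast_apply] using this
    · intro h
      ext y
      rw [AddMonoid.End.natCast_apply, nsmul_eq_mul, h, zero_mul]; rfl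
  rw [hf, sub_pow_char_pow_of_commute p a (Commute.one_right f), one_pow]
  change (f ^ p ^ a) x - x = _
  rw [hpow]

/-- A nontrivial automorphism of `p`-power order in characteristic `p` satisfies `ρ z = z + 1`
for some `z`. -/
lemma exists_map_eq_add_one {τ : RingAut K} {a : ℕ} (h1 : τ ^ p ^ a = 1) (hne : τ ≠ 1) :
    ∃ z, τ z = z + 1 := by
  classical
  -- τ - 1 is nilpotent. With r its index, (τ - 1) ^ (r - 1) θ is a nonzero fixed element for some
  -- θ; dividing (τ - 1) ^ (r - 2) θ by it gives z, and r ≥ 2 because τ ≠ 1.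
  have hnil : ∃ r, ∀ x, (subOne τ ^ r) x = 0 :=
    ⟨p ^ a, fun x => by rw [subOne_pow_char_pow, h1]; simp⟩
  set r := Nat.find hnil with hr
  have hr1 := Nat.find_spec hnil
  rw [← hr] at hr1
  have hr2 : 2 ≤ r := by
    by_contra! hlt
    apply hne
    ext x
    have hx : (subOne τ ^ 1) x = 0 := by
      rcases (show r = 0 ∨ r = 1 by omega) with h | h
      · have h3 : ∀ x : K, x = 0 := by simpa [h] using hr1
        exact h3 _
      · rw [← h]; exact hr1 x
    simpa [subOne_apply, sub_eq_zero] using hx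
  obtain ⟨θ, hθ⟩ : ∃ θ, (subOne τ ^ (r - 1)) θ ≠ 0 := by
    have := Nat.find_min hnil (m := r - 1) (by omega)
    push Not at this
    exact this
  set c := (subOne τ ^ (r - 1)) θ with hc
  have hcfix : τ c = c := by
    have h := hr1 θ
    have : r = (r - 1) + 1 := by omega
    rw [this, pow_succ', end_mul_apply, ← hc, subOne_apply, sub_eq_zero] at h
    exact h
  refine ⟨c⁻¹ * (subOne τ ^ (r - 2)) θ, ?_⟩
  have hcinv : τ c⁻¹ = c⁻¹ := by rw [map_inv₀, hcfix]
  rw [← sub_eq_iff_eq_add', ← subOne_apply]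
  have := subOne_mul_of_fixed hcinv ((subOne τ ^ (r - 2)) θ) 1
  rw [pow_one] at this
  have h2 : subOne τ ((subOne τ ^ (r - 2)) θ) = c := by
    rw [hc, show r - 1 = r - 2 + 1 by omega, pow_succ']; rfl
  rw [this, h2, inv_mul_cancel₀ hθ]

end CyclicAction

/-! ### Totally ramified cyclic extensions: the layers and their generators -/

variable {K : Type*} [Field K] {p : ℕ} [Fact p.Prime] [CharP K p] {n : ℕ}
  {w : AddValuation K (WithTop ℤ)} {τ : RingAut K}

/-- `τ` is an automorphism of order `p ^ n`, and the normalized valuation `w` is `τ`-invariant and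
totally ramified over the field fixed by `τ`, with perfect residue field. -/
structure IsTotallyRamifiedCyclic (p n : ℕ) (w : AddValuation K (WithTop ℤ)) (τ : RingAut K) :
    Prop where
  val_map : ∀ x, w (τ x) = w x
  pow_eq_one : τ ^ p ^ n = 1
  pow_ne_one : ∀ j < n, τ ^ p ^ j ≠ 1
  exists_uniformizer : ∃ π, w π = (1 : ℤ)
  dvd_val : ∀ x, τ x = x → x ≠ 0 → ∃ r : ℤ, w x = (p ^ n * r : ℤ)
  exists_residue : ∀ x, 0 ≤ w x → ∃ c, τ c = c ∧ 0 < w (x - c)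
  perfect : ∀ u, w u = 0 → ∃ m : ℕ, 1 ≤ m ∧ 0 < w (u ^ p ^ m - u)

namespace IsTotallyRamifiedCyclic

omit [Fact p.Prime] [CharP K p] in
lemma val_pow_map (h : IsTotallyRamifiedCyclic p n w τ) (a : ℕ) (x : K) :
    w ((τ ^ a) x) = w x := by
  induction a with
  | zero => rfl
  | succ a ih => rw [ringAut_pow_succ_apply, h.val_map, ih]

omit [Fact p.Prime] [CharP K p] in
lemma val_norm (h : IsTotallyRamifiedCyclic p n w τ) (a m : ℕ) {x : K} {r : ℤ} (hx : w x = r) :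
    w (∏ i ∈ Finset.range m, ((τ ^ a) ^ i) x) = (m * r : ℤ) := by
  induction m with
  | zero => simp
  | succ m ih =>
    rw [Finset.prod_range_succ, val_mul_eq ih (s := r) (by rw [← pow_mul, h.val_pow_map, hx])]
    congr 1; push_cast; ring

-- The norm from the j-th layer (the field fixed by τ ^ p ^ j) to the base multiplies valuations by
-- p ^ j and lands in values divisible by p ^ n.
omit [CharP K p] in
lemma dvd_val_fixed (h : IsTotallyRamifiedCyclic p n w τ) {j : ℕ} (hj : j ≤ n) {x : K}
    (hx : (τ ^ p ^ j) x = x) (hx0 : x ≠ 0) : ∃ r : ℤ, w x = (p ^ (n - j) * r : ℤ) := by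
  obtain ⟨r, hr⟩ := exists_val_eq w hx0
  have h1 := h.val_norm 1 (p ^ j) hr
  rw [pow_one] at h1
  obtain ⟨s, hs⟩ := h.dvd_val _ (map_prod_iterate hx) (ne_zero_of_val h1)
  rw [h1] at hs
  refine ⟨s, ?_⟩
  rw [hr]
  have hs' : ((p ^ j : ℕ) : ℤ) * r = p ^ n * s := by exact_mod_cast hs
  have hp : (p : ℤ) ^ j ≠ 0 := pow_ne_zero _ (by exact_mod_cast (Fact.out : p.Prime).ne_zero)
  congr 1
  apply mul_left_cancel₀ hp
  rw [← mul_assoc, ← pow_add, Nat.add_sub_cancel' hj, ← hs']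
  push_cast; ring

-- The norm of a uniformizer of `K` down to the layer is a uniformizer there.
omit [Fact p.Prime] [CharP K p] in
lemma exists_fixed_uniformizer (h : IsTotallyRamifiedCyclic p n w τ) {j : ℕ} (hj : j ≤ n) :
    ∃ π, (τ ^ p ^ j) π = π ∧ w π = (p ^ (n - j) : ℤ) := by
  obtain ⟨π, hπ⟩ := h.exists_uniformizer
  refine ⟨∏ i ∈ Finset.range (p ^ (n - j)), ((τ ^ p ^ j) ^ i) π, map_prod_iterate ?_, ?_⟩
  · rw [← pow_mul, ← pow_add, Nat.add_sub_cancel' hj, h.pow_eq_one]; rfl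
  · rw [h.val_norm (p ^ j) (p ^ (n - j)) hπ]; push_cast; rw [mul_one]

lemma exists_reduced_fixed (h : IsTotallyRamifiedCyclic p n w τ) {j : ℕ} (hj : j ≤ n) {c : K}
    (hc : (τ ^ p ^ j) c = c) :
    ∃ x, (τ ^ p ^ j) x = x ∧ w c ≤ w (c - artinSchreier p x) ∧
      (0 ≤ w (c - artinSchreier p x) ∨
      ∃ t : ℤ, 0 < t ∧ ¬ (p : ℤ) ∣ t ∧ w (c - artinSchreier p x) = (-(p ^ (n - j) * t) : ℤ)) := by
  obtain ⟨π, hπf, hπ⟩ := h.exists_fixed_uniformizer hj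
  have hp : (0 : ℤ) < p ^ (n - j) := pow_pos (by exact_mod_cast (Fact.out : p.Prime).pos) _
  exact exists_reduced (fixedSubfield (τ ^ p ^ j)) hp hπf hπ
    (fun x hx hx0 => h.dvd_val_fixed hj hx hx0) h.perfect hc

-- Residues are represented by fixed elements, so τ acts trivially on the residue field: everything
-- is inertia.
omit [Fact p.Prime] [CharP K p] in
lemma val_map_sub_pos (h : IsTotallyRamifiedCyclic p n w τ) (a : ℕ) {x : K} (hx : 0 ≤ w x) :
    0 < w ((τ ^ a) x - x) := by
  obtain ⟨c, hc, hxc⟩ := h.exists_residue x hx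
  have : (τ ^ a) x - x = (τ ^ a) (x - c) - (x - c) := by
    rw [map_sub, ringAut_pow_apply_eq_self hc]; ring
  rw [this]
  have h0 : ((0 : ℤ) : WithTop ℤ) < w (x - c) := hxc
  have h1 := val_lt_iff.mp h0
  refine lt_of_lt_of_le (b := ((0 + 1 : ℤ) : WithTop ℤ)) (by norm_num) ?_
  refine AddValuation.map_le_sub w ?_ h1
  rwa [h.val_pow_map]

omit [Fact p.Prime] in
/-- An integral element has trace in the maximal ideal. -/
lemma val_neg_of_sum_eq_one (h : IsTotallyRamifiedCyclic p n w τ) (a : ℕ) {g : K}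
    (hg : ∑ i ∈ Finset.range p, ((τ ^ a) ^ i) g = 1) : ¬ 0 ≤ w g := by
  intro h0
  -- Subtracting g from each of the p conjugates is free, since p g = 0; each difference then lies
  -- in the maximal ideal.
  have h1 : ∑ i ∈ Finset.range p, (((τ ^ a) ^ i) g - g) = 1 := by
    rw [Finset.sum_sub_distrib, hg]; simp
  have h2 : (0 : WithTop ℤ) < w (∑ i ∈ Finset.range p, (((τ ^ a) ^ i) g - g)) := by
    refine AddValuation.map_lt_sum w (by simp) fun i _ => ?_
    rw [← pow_mul]
    exact h.val_map_sub_pos _ h0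
  rw [h1] at h2
  simp at h2

/-- Artin–Schreier generators of the layers, with pole order `t` prime to `p` (the ramification
break of the layer). -/
lemma exists_generator (h : IsTotallyRamifiedCyclic p n w τ) {j : ℕ} (hj : j < n) :
    ∃ (z : K) (t : ℤ), (τ ^ p ^ j) z = z + 1 ∧ 0 < t ∧ ¬ (p : ℤ) ∣ t ∧
      w z = (-(p ^ (n - (j + 1)) * t) : ℤ) := by
  obtain ⟨z, hz⟩ := exists_map_eq_add_one p (τ := τ ^ p ^ j) (a := n - j) (by
    rw [← pow_mul, ← pow_add, Nat.add_sub_cancel' hj.le, h.pow_eq_one]) (h.pow_ne_one j hj)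
  have hc : (τ ^ p ^ j) (artinSchreier p z) = artinSchreier p z := by
    rw [map_artinSchreier, hz, artinSchreier_add]
    have := artinSchreier_natCast (K := K) p 1
    rw [Nat.cast_one] at this
    rw [this, add_zero]
  obtain ⟨x, hx, -, h2⟩ := h.exists_reduced_fixed hj.le hc
  have hz' : (τ ^ p ^ j) (z - x) = (z - x) + 1 := by rw [map_sub, hz, hx]; ring
  rw [← artinSchreier_sub] at h2
  -- An integral element is moved into the maximal ideal, while this one is moved by 1.
  have hnot : ¬ 0 ≤ w (z - x) := by
    intro h0
    have := h.val_map_sub_pos (p ^ j) h0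
    rw [hz'] at this
    simp at this
  rcases h2 with h2 | ⟨t, ht, htp, h2⟩
  · exfalso
    have hne : z - x ≠ 0 := by intro h; rw [h] at hnot; simp at hnot
    obtain ⟨r, hr⟩ := exists_val_eq w hne
    have hr0 : r < 0 := by
      by_contra! h
      exact hnot (by rw [hr]; exact_mod_cast h)
    rw [val_artinSchreier_of_neg hr hr0] at h2
    have hp : (0 : ℤ) < p := by exact_mod_cast (Fact.out : p.Prime).pos
    have : 0 ≤ p * r := by exact_mod_cast h2
    nlinarith
  · have hp : (0 : ℤ) < p := by exact_mod_cast (Fact.out : p.Prime).pos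
    obtain ⟨r, hr0, hr1, hr2⟩ := val_of_artinSchreier_neg h2 (by
      have : (0 : ℤ) < p ^ (n - j) * t := mul_pos (pow_pos hp _) ht
      omega)
    refine ⟨z - x, t, hz', ht, htp, ?_⟩
    rw [hr2]
    congr 1
    have hnj : n - j = (n - (j + 1)) + 1 := by omega
    rw [hnj, pow_succ] at hr1
    apply mul_left_cancel₀ hp.ne'
    rw [← hr1]; ring

/-- The effect of an automorphism `ρ` on the valuation of `a z ^ i`. -/
lemma val_map_sub_monomial {ρ : RingAut K} (hρ : ∀ x, w (ρ x) = w x) {T : ℤ} (hT : 0 < T)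
    {a z : K} {ra rz : ℤ} (ha : w a = ra) (hz : w z = rz)
    (ha' : ((ra + (T + 1) : ℤ) : WithTop ℤ) ≤ w (ρ a - a)) (hz' : w (ρ z - z) = (rz + T : ℤ))
    (i : ℕ) :
    ((ra + i * rz + T : ℤ) : WithTop ℤ) ≤ w (ρ (a * z ^ i) - a * z ^ i) ∧
      (¬ p ∣ i → w (ρ (a * z ^ i) - a * z ^ i) = (ra + i * rz + T : ℤ)) := by
  have ha0 := ne_zero_of_val ha
  have hz0 := ne_zero_of_val hz
  set α := ρ a / a with hα
  set ζ := ρ z / z with hζ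
  have hα1 : ((T + 1 : ℤ) : WithTop ℤ) ≤ w (α - 1) := by
    have : α - 1 = (ρ a - a) / a := by rw [hα]; field_simp
    rw [this]
    refine le_trans ?_ (val_div_le ha' ha)
    norm_cast; omega
  have hζ1 : w (ζ - 1) = T := by
    have : ζ - 1 = (ρ z - z) / z := by rw [hζ]; field_simp
    rw [this, val_div_eq hz' hz]
    congr 1; ring
  have hζ0 : w ζ = (0 : ℤ) := by
    rw [hζ, val_div_eq ((hρ z).trans hz) hz]; congr 1; ring
  have hpos : ∀ k : ℕ, ((T : ℤ) : WithTop ℤ) ≤ w (ζ ^ k - 1) := by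
    intro k
    rw [← geom_sum_mul ζ k]
    have : ((0 + T : ℤ) : WithTop ℤ) ≤ w ((∑ i ∈ Finset.range k, ζ ^ i) * (ζ - 1)) := by
      refine val_mul_le ?_ hζ1.ge
      refine AddValuation.map_le_sum w fun i _ => ?_
      rw [val_pow_eq hζ0]; simp
    simpa using this
  -- The cofactor of ζ - 1 in ζ ^ i - 1 is congruent to i, hence a unit when p does not divide i.
  have heq : ¬ p ∣ i → w (ζ ^ i - 1) = (T : ℤ) := by
    intro hi
    rw [← geom_sum_mul ζ i]
    have h1 : w (∑ k ∈ Finset.range i, ζ ^ k) = (0 : ℤ) := by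
      have h2 : ∑ k ∈ Finset.range i, ζ ^ k = (i : K) + ∑ k ∈ Finset.range i, (ζ ^ k - 1) := by
        rw [Finset.sum_sub_distrib]; simp
      rw [h2]
      refine val_add_eq (val_natCast_eq p hi) ?_
      refine AddValuation.map_lt_sum w (by simp) fun k _ => ?_
      exact lt_of_lt_of_le (by exact_mod_cast hT) (hpos k)
    rw [val_mul_eq h1 hζ1]; congr 1; ring
  have hmon : ρ (a * z ^ i) - a * z ^ i = (a * z ^ i) * ((ζ ^ i - 1) + (α - 1) * ζ ^ i) := by
    have h1 : ρ (a * z ^ i) = (a * z ^ i) * (α * ζ ^ i) := by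
      rw [hα, hζ, map_mul, map_pow, div_pow]; field_simp
    rw [h1]; ring
  have haz : w (a * z ^ i) = (ra + i * rz : ℤ) := val_mul_eq ha (val_pow_eq hz i)
  have hsec : ((T + 1 : ℤ) : WithTop ℤ) ≤ w ((α - 1) * ζ ^ i) := by
    have := val_mul_le hα1 (val_pow_eq hζ0 i).ge
    simpa using this
  have hTT : ((T : ℤ) : WithTop ℤ) ≤ ((T + 1 : ℤ) : WithTop ℤ) := by norm_cast; omega
  rw [hmon]
  refine ⟨val_mul_le haz.ge (AddValuation.map_le_add w (hpos i) (hTT.trans hsec)), fun hi => ?_⟩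
  refine val_mul_eq haz (val_add_eq (heq hi) (val_lt_iff.mpr hsec))

omit [CharP K p] in
/-- Approximation of elements of the next layer by monomials in its generator. -/
lemma exists_monomial (h : IsTotallyRamifiedCyclic p n w τ) {l : ℕ} (hl : l < n) {z : K} {t : ℤ}
    (ht : ¬ (p : ℤ) ∣ t) (hz : w z = (-(p ^ (n - (l + 1)) * t) : ℤ)) {x : K} {s : ℤ}
    (hx : w x = (p ^ (n - (l + 1)) * s : ℤ)) :
    ∃ (a : K) (ra : ℤ) (i : ℕ), (τ ^ p ^ l) a = a ∧ w a = ra ∧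
      ra + i * (-(p ^ (n - (l + 1)) * t)) = p ^ (n - (l + 1)) * s ∧
      ((p ^ (n - (l + 1)) * s : ℤ) : WithTop ℤ) < w (x - a * z ^ i) ∧
      (¬ (p : ℤ) ∣ s → ¬ p ∣ i) := by
  have hpp : Prime (p : ℤ) := Nat.prime_iff_prime_int.mp Fact.out
  set e : ℤ := p ^ (n - (l + 1)) with he
  -- Since t is invertible modulo p, some power z ^ i moves the value s into the value group of the
  -- lower layer; i is congruent to -s/t modulo p, so it is prime to p when s is.
  obtain ⟨i, r', hir⟩ : ∃ (i : ℕ) (r' : ℤ), s + i * t = p * r' := by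
    have hc : IsCoprime t (p : ℤ) :=
      ((Prime.coprime_iff_not_dvd hpp).mpr ht).symm
    obtain ⟨u, v, huv⟩ := hc
    have hp0 : (0 : ℤ) < p := by exact_mod_cast (Fact.out : p.Prime).pos
    refine ⟨((-s * u) % p).toNat, (s + ((-s * u) % p) * t) / p, ?_⟩
    rw [Int.toNat_of_nonneg (Int.emod_nonneg _ hp0.ne'), Int.mul_ediv_cancel']
    have h1 : (-s * u) % p = -s * u - p * ((-s * u) / p) := by
      rw [Int.emod_def]
    rw [h1]
    refine ⟨s * v - ((-s * u) / p) * t, ?_⟩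
    linear_combination (-s) * huv
  obtain ⟨π, hπf, hπ⟩ := h.exists_fixed_uniformizer hl.le
  have hnl : (p : ℤ) ^ (n - l) = e * p := by
    rw [he, ← pow_succ]; congr 1; omega
  rw [hnl] at hπ
  set a₀ := π ^ r' with ha₀
  have hwa₀ : w a₀ = (r' * (e * p) : ℤ) := val_zpow_eq hπ r'
  have hmon : w (a₀ * z ^ i) = (e * s : ℤ) := by
    rw [val_mul_eq hwa₀ (val_pow_eq hz i)]; congr 1
    linear_combination (-e) * hir
  have hu : w (x / (a₀ * z ^ i)) = (0 : ℤ) := by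
    rw [val_div_eq hx hmon, sub_self]
  obtain ⟨c, hc, hcx⟩ := h.exists_residue _ hu.ge
  have hwc : w c = (0 : ℤ) := by
    have : c = x / (a₀ * z ^ i) - (x / (a₀ * z ^ i) - c) := by ring
    rw [this]
    exact val_sub_eq hu hcx
  have hm0 := ne_zero_of_val hmon
  refine ⟨c * a₀, r' * (e * p), i, ?_, ?_, ?_, ?_, ?_⟩
  · rw [map_mul, ringAut_pow_apply_eq_self hc, ha₀, map_zpow₀, hπf]
  · rw [val_mul_eq hwc hwa₀]; congr 1; ring
  · linear_combination (-e) * hir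
  · have h1 : x - c * a₀ * z ^ i = (x / (a₀ * z ^ i) - c) * (a₀ * z ^ i) := by
      rw [sub_mul, div_mul_cancel₀ _ hm0]; ring
    rw [h1, val_lt_iff]
    have h2 : ((1 : ℤ) : WithTop ℤ) ≤ w (x / (a₀ * z ^ i) - c) := by
      have := (val_lt_iff (w := w) (r := 0)).mp (by exact_mod_cast hcx)
      simpa using this
    refine le_trans ?_ (val_mul_le h2 hmon.ge)
    norm_cast; omega
  · intro hs hi
    apply hs
    have hi' : (p : ℤ) ∣ i := by exact_mod_cast hi
    have : s = p * r' - i * t := by linear_combination hir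
    rw [this]
    exact dvd_sub (dvd_mul_right _ _) (hi'.mul_right _)

/-- If an automorphism moves the elements of the `l`-th layer by more than `T`, and moves the
generator of the next layer by exactly `T`, then it moves the next layer by `T`. -/
lemma val_map_sub_layer (h : IsTotallyRamifiedCyclic p n w τ) {ρ : RingAut K}
    (hρ : ∀ x, w (ρ x) = w x) {l : ℕ} (hl : l < n) {T : ℕ} (hT : 0 < T)
    (hE : ∀ a, (τ ^ p ^ l) a = a → ∀ r : ℤ, (r : WithTop ℤ) ≤ w a →
      ((r + (T + 1) : ℤ) : WithTop ℤ) ≤ w (ρ a - a))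
    {z : K} {t : ℤ} (ht : ¬ (p : ℤ) ∣ t) (hzl : (τ ^ p ^ (l + 1)) z = z)
    (hz : w z = (-(p ^ (n - (l + 1)) * t) : ℤ))
    (hρz : w (ρ z - z) = (-(p ^ (n - (l + 1)) * t) + T : ℤ)) {x : K}
    (hx : (τ ^ p ^ (l + 1)) x = x) :
    (∀ r : ℤ, (r : WithTop ℤ) ≤ w x → ((r + T : ℤ) : WithTop ℤ) ≤ w (ρ x - x)) ∧
    (∀ s : ℤ, ¬ (p : ℤ) ∣ s → w x = (p ^ (n - (l + 1)) * s : ℤ) →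
      w (ρ x - x) = (p ^ (n - (l + 1)) * s + T : ℤ)) := by
  have hT' : (0 : ℤ) < T := by exact_mod_cast hT
  -- The bound is improved one unit at a time: the leading monomial already moves by T, and the
  -- remainder starts at least one unit higher, so the weaker bound for it suffices. Each step
  -- applies to all x, so no convergence is needed.
  have key : ∀ k : ℕ, k ≤ T → ∀ x, (τ ^ p ^ (l + 1)) x = x → ∀ r : ℤ, (r : WithTop ℤ) ≤ w x →
      ((r + k : ℤ) : WithTop ℤ) ≤ w (ρ x - x) := by
    intro k
    induction k with
    | zero =>
      intro _ x _ r hr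
      refine AddValuation.map_le_sub w ?_ ?_ <;> simpa [hρ] using hr
    | succ k ih =>
      intro hk x hx r hr
      by_cases hx0 : x = 0
      · simp [hx0]
      obtain ⟨s, hs⟩ := h.dvd_val_fixed (j := l + 1) hl hx hx0
      obtain ⟨a, ra, i, haf, ha, hsum, hlt, -⟩ := h.exists_monomial hl ht hz hs
      have h1 := (val_map_sub_monomial hρ hT' ha hz (hE a haf ra ha.ge) hρz i).1
      have hx' : (τ ^ p ^ (l + 1)) (x - a * z ^ i) = x - a * z ^ i := by
        have : (τ ^ p ^ (l + 1)) a = a :=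
          fixedSubfield_pow_le τ (pow_dvd_pow p (Nat.le_succ l)) haf
        rw [map_sub, map_mul, map_pow, hx, hzl, this]
      have h2 := ih (by omega) _ hx' _ (val_lt_iff.mp hlt)
      have h3 : ρ x - x = (ρ (a * z ^ i) - a * z ^ i) + (ρ (x - a * z ^ i) - (x - a * z ^ i)) := by
        rw [map_sub]; ring
      rw [hs] at hr
      have hr' : r ≤ p ^ (n - (l + 1)) * s := by exact_mod_cast hr
      rw [h3]
      rw [hsum] at h1
      refine AddValuation.map_le_add w (le_trans ?_ h1) (le_trans ?_ h2) <;>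
      · rw [WithTop.coe_le_coe]
        push_cast
        omega
  refine ⟨key T le_rfl x hx, fun s hps hs => ?_⟩
  obtain ⟨a, ra, i, haf, ha, hsum, hlt, hi⟩ := h.exists_monomial hl ht hz hs
  have h1 := (val_map_sub_monomial hρ hT' ha hz (hE a haf ra ha.ge) hρz i).2 (hi hps)
  have hx' : (τ ^ p ^ (l + 1)) (x - a * z ^ i) = x - a * z ^ i := by
    have : (τ ^ p ^ (l + 1)) a = a := fixedSubfield_pow_le τ (pow_dvd_pow p (Nat.le_succ l)) haf
    rw [map_sub, map_mul, map_pow, hx, hzl, this]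
  have h2 := key T le_rfl _ hx' _ (val_lt_iff.mp hlt)
  have h3 : ρ x - x = (ρ (a * z ^ i) - a * z ^ i) + (ρ (x - a * z ^ i) - (x - a * z ^ i)) := by
    rw [map_sub]; ring
  rw [h3]
  rw [hsum] at h1
  refine val_add_eq h1 (val_lt_iff.mpr (le_trans ?_ h2))
  rw [WithTop.coe_le_coe]
  omega

end IsTotallyRamifiedCyclic

/-! ### Ramification breaks and pole orders in the tower -/

variable {K : Type*} [Field K] {p : ℕ} [Fact p.Prime] [CharP K p] {n : ℕ}
  {w : AddValuation K (WithTop ℤ)} {τ : RingAut K}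

/-- `τ ^ p ^ j` moves the elements of the `l`-th layer as an automorphism with lower ramification
break `t` does. -/
def MovesLayer (p n : ℕ) (w : AddValuation K (WithTop ℤ)) (τ : RingAut K) (j l t : ℕ) : Prop :=
  ∀ x, (τ ^ p ^ l) x = x →
    (∀ r : ℤ, (r : WithTop ℤ) ≤ w x →
      ((r + p ^ (n - l) * t : ℤ) : WithTop ℤ) ≤ w ((τ ^ p ^ j) x - x)) ∧
    (∀ s : ℤ, ¬ (p : ℤ) ∣ s → w x = (p ^ (n - l) * s : ℤ) →
      w ((τ ^ p ^ j) x - x) = (p ^ (n - l) * s + p ^ (n - l) * t : ℤ))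

/-- `z` is a reduced Artin–Schreier generator of the `j`-th layer, with break `t`. -/
structure IsLayerGenerator (p n : ℕ) (w : AddValuation K (WithTop ℤ)) (τ : RingAut K) (j : ℕ)
    (z : K) (t : ℕ) : Prop where
  map_eq : (τ ^ p ^ j) z = z + 1
  pos : 0 < t
  not_dvd : ¬ (p : ℤ) ∣ t
  val_eq : w z = (-(p ^ (n - (j + 1)) * t) : ℤ)

namespace IsLayerGenerator

variable {j : ℕ} {z : K} {t : ℕ}

omit [Fact p.Prime] in
lemma map_succ_eq (h : IsLayerGenerator p n w τ j z t) : (τ ^ p ^ (j + 1)) z = z := by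
  have : ∀ i : ℕ, ((τ ^ p ^ j) ^ i) z = z + i := by
    intro i
    induction i with
    | zero => simp
    | succ i ih => rw [ringAut_pow_succ_apply, ih, map_add, h.map_eq, map_natCast]; push_cast; ring
  rw [pow_succ, pow_mul, this]; simp

lemma map_artinSchreier_eq (h : IsLayerGenerator p n w τ j z t) :
    (τ ^ p ^ j) (artinSchreier p z) = artinSchreier p z := by
  have := artinSchreier_natCast (K := K) p 1
  rw [Nat.cast_one] at this
  rw [map_artinSchreier, h.map_eq, artinSchreier_add, this, add_zero]

omit [CharP K p] in
lemma val_artinSchreier (h : IsLayerGenerator p n w τ j z t) (hj : j < n) :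
    w (artinSchreier p z) = (p ^ (n - j) * (-t) : ℤ) := by
  have hp : (0 : ℤ) < p := by exact_mod_cast (Fact.out : p.Prime).pos
  have ht : (0 : ℤ) < t := by exact_mod_cast h.pos
  rw [val_artinSchreier_of_neg h.val_eq (by have := mul_pos (pow_pos hp (n - (j + 1))) ht; omega),
    show n - j = n - (j + 1) + 1 by omega, pow_succ]
  congr 1; ring

end IsLayerGenerator

namespace IsTotallyRamifiedCyclic

lemma exists_isLayerGenerator (h : IsTotallyRamifiedCyclic p n w τ) {j : ℕ} (hj : j < n) :
    ∃ (z : K) (t : ℕ), IsLayerGenerator p n w τ j z t := by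
  obtain ⟨z, t, h1, h2, h3, h4⟩ := h.exists_generator hj
  lift t to ℕ using h2.le
  exact ⟨z, t, h1, by exact_mod_cast h2, h3, h4⟩

/-- τ ^ p ^ j fixes the j-th layer and moves the generator z by 1, which lies exactly -w(z) above
w(z). -/
lemma movesLayer_succ_self (h : IsTotallyRamifiedCyclic p n w τ) {j : ℕ} (hj : j < n) {z : K}
    {t : ℕ} (hz : IsLayerGenerator p n w τ j z t) : MovesLayer p n w τ j (j + 1) t := by
  intro x hx
  have hp : 0 < p := (Fact.out : p.Prime).pos
  have := h.val_map_sub_layer (ρ := τ ^ p ^ j) (h.val_pow_map _) hj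
    (T := p ^ (n - (j + 1)) * t) (mul_pos (pow_pos hp _) hz.pos) ?_ hz.not_dvd hz.map_succ_eq
    hz.val_eq ?_ hx
  · push_cast at this
    exact this
  · intro a ha r _
    rw [ha, sub_self]; simp
  · rw [hz.map_eq, add_sub_cancel_left, AddValuation.map_one]
    rw [show (-((p : ℤ) ^ (n - (j + 1)) * t) + ((p ^ (n - (j + 1)) * t : ℕ) : ℤ)) = 0 by
      push_cast; ring]
    rfl

/-- With ρ = τ ^ p ^ j, the displacement of z is read off from ℘(ρ z - z) = ρ ℘(z) - ℘(z). The
element ℘(z) lies in the lower layer with value -s prime to p, so its displacement is known exactly,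
and t < s makes it a pole, whose order ℘ divides by p. -/
lemma movesLayer_succ (h : IsTotallyRamifiedCyclic p n w τ) {j l : ℕ} (hl : l < n)
    {t s : ℕ} (ht : 0 < t) (hm : MovesLayer p n w τ j l t) {z : K}
    (hz : IsLayerGenerator p n w τ l z s) (hts : t < s) : MovesLayer p n w τ j (l + 1) t := by
  intro x hx
  have hp : 0 < p := (Fact.out : p.Prime).pos
  have hp1 : (1 : ℤ) < p := by exact_mod_cast (Fact.out : p.Prime).one_lt
  have hnl : (p : ℤ) ^ (n - l) = p * p ^ (n - (l + 1)) := by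
    rw [← pow_succ']; congr 1; omega
  have he : (0 : ℤ) < p ^ (n - (l + 1)) := pow_pos (by omega) _
  have ht' : (0 : ℤ) < t := by exact_mod_cast ht
  have hts' : (t : ℤ) < s := by exact_mod_cast hts
  have := h.val_map_sub_layer (ρ := τ ^ p ^ j) (h.val_pow_map _) hl
    (T := p ^ (n - (l + 1)) * t) (mul_pos (pow_pos hp _) ht) ?_ hz.not_dvd hz.map_succ_eq
    hz.val_eq ?_ hx
  · push_cast at this
    exact this
  · intro a ha r hr
    refine le_trans ?_ ((hm a ha).1 r hr)
    rw [WithTop.coe_le_coe, hnl]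
    push_cast
    nlinarith [mul_pos he ht']
  · have h1 := (hm _ hz.map_artinSchreier_eq).2 (-s)
      (by rw [dvd_neg]; exact hz.not_dvd) (hz.val_artinSchreier hl)
    rw [map_artinSchreier, ← artinSchreier_sub] at h1
    obtain ⟨r, -, hr1, hr2⟩ := val_of_artinSchreier_neg h1 (by
      rw [hnl]; nlinarith [mul_pos (mul_pos (lt_trans one_pos hp1) he) (sub_pos.mpr hts')])
    rw [hr2]
    congr 1
    apply mul_left_cancel₀ (lt_trans one_pos hp1).ne'
    rw [← hr1, hnl]; push_cast; ring

/-- For ρ = τ ^ p ^ j the element g = ρ z - z has trace τ ^ p ^ (j + 1) z - z = 1, so it is not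
integral. Hence ℘(g) = ρ ℘(z) - ℘(z) has a pole, and its order is a positive multiple of s - t. -/
lemma break_lt_succ (h : IsTotallyRamifiedCyclic p n w τ) {j : ℕ} (hj : j + 1 < n)
    {t s : ℕ} (hm : MovesLayer p n w τ j (j + 1) t) {z : K}
    (hz : IsLayerGenerator p n w τ (j + 1) z s) : t < s := by
  have hp : (0 : ℤ) < p := by exact_mod_cast (Fact.out : p.Prime).pos
  have he : (0 : ℤ) < p ^ (n - (j + 1)) := pow_pos hp _
  set g := (τ ^ p ^ j) z - z with hg
  have hsum : ∑ i ∈ Finset.range p, ((τ ^ p ^ j) ^ i) g = 1 := by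
    rw [hg, sum_iterate_sub, ← pow_mul, ← pow_succ, hz.map_eq]; ring
  have hneg := h.val_neg_of_sum_eq_one _ hsum
  have hg0 : g ≠ 0 := by intro h0; rw [h0] at hneg; simp at hneg
  obtain ⟨r, hr⟩ := exists_val_eq w hg0
  have hr0 : r < 0 := by
    by_contra! h0
    exact hneg (by rw [hr]; exact_mod_cast h0)
  have h1 := (hm _ hz.map_artinSchreier_eq).2 (-s)
      (by rw [dvd_neg]; exact hz.not_dvd) (hz.val_artinSchreier hj)
  rw [map_artinSchreier, ← artinSchreier_sub, val_artinSchreier_of_neg hr hr0] at h1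
  have h2 : p * r = p ^ (n - (j + 1)) * (-s : ℤ) + p ^ (n - (j + 1)) * t := by exact_mod_cast h1
  have h3 : (0 : ℤ) < p ^ (n - (j + 1)) * ((s : ℤ) - t) := by nlinarith
  have := pos_of_mul_pos_right h3 he.le
  omega

/-- The generators of all the layers, with their breaks. -/
structure Tower (p n : ℕ) (w : AddValuation K (WithTop ℤ)) (τ : RingAut K) (z : ℕ → K)
    (t : ℕ → ℕ) : Prop where
  gen : ∀ j < n, IsLayerGenerator p n w τ j (z j) (t j)
  lt_succ : ∀ j, j + 1 < n → t j < t (j + 1)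
  moves : ∀ j l, j < l → l ≤ n → MovesLayer p n w τ j l (t j)

lemma exists_tower (h : IsTotallyRamifiedCyclic p n w τ) :
    ∃ (z : ℕ → K) (t : ℕ → ℕ), Tower p n w τ z t := by
  have : ∀ j, ∃ (z : K) (t : ℕ), j < n → IsLayerGenerator p n w τ j z t := by
    intro j
    by_cases hj : j < n
    · obtain ⟨z, t, hz⟩ := h.exists_isLayerGenerator hj
      exact ⟨z, t, fun _ => hz⟩
    · exact ⟨0, 0, fun h => absurd h hj⟩
  choose z t hgen using this
  have hlt : ∀ j, j + 1 < n → t j < t (j + 1) := fun j hj =>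
    h.break_lt_succ hj (h.movesLayer_succ_self (by omega) (hgen j (by omega))) (hgen (j + 1) hj)
  have hmono : ∀ j l, j < l → l < n → t j < t l := by
    intro j l hjl
    induction l with
    | zero => omega
    | succ l ih =>
      intro hl
      rcases (show j = l ∨ j < l by omega) with rfl | hj
      · exact hlt _ hl
      · exact (ih hj (by omega)).trans (hlt _ hl)
  refine ⟨z, t, hgen, hlt, fun j l hjl => ?_⟩
  induction l with
  | zero => omega
  | succ l ih =>
    intro hl
    rcases (show j = l ∨ j < l by omega) with rfl | hj
    · exact h.movesLayer_succ_self hl (hgen j hl)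
    · exact h.movesLayer_succ hl (hgen j (by omega)).pos (ih hj (by omega)) (hgen l hl)
        (hmono j l hj hl)

/-- Pole orders in the tower of an element of pole order `lam` in the base field. -/
def poleOrder (p : ℕ) (t : ℕ → ℕ) (lam : ℤ) : ℕ → ℤ
  | 0 => lam
  | j + 1 => p * poleOrder p t lam j - (p - 1) * t j

/-- In the next layer let c' = c - ℘(y) be the reduction of c, which has pole order L in the layer
below. Then y has pole order L there, and for ρ = τ ^ p ^ j the equality ρ c' - c' = -℘(ρ y - y)
compares pole orders: s - t_j = p (L - t_j) for the pole order s of c'. This is the recursion of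
`poleOrder`. -/
lemma Tower.exists_reduced (h : IsTotallyRamifiedCyclic p n w τ) {z : ℕ → K} {t : ℕ → ℕ}
    (hT : Tower p n w τ z t) {a : K} {lam : ℤ} (ha : τ a = a) (hlam : ¬ (p : ℤ) ∣ lam)
    (hwa : w a = (-(p ^ n * lam) : ℤ)) (j : ℕ) (hj : j ≤ n)
    (hlt : ∀ i < j, (t i : ℤ) < poleOrder p t lam i) :
    ∃ x, (τ ^ p ^ j) x = x ∧ ¬ (p : ℤ) ∣ poleOrder p t lam j ∧
      w (a - artinSchreier p x) = (p ^ (n - j) * (-poleOrder p t lam j) : ℤ) := by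
  have hp1 : (1 : ℤ) < p := by exact_mod_cast (Fact.out : p.Prime).one_lt
  have hp0 : (0 : ℤ) < p := by omega
  induction j with
  | zero =>
    refine ⟨0, map_zero _, hlam, ?_⟩
    rw [artinSchreier_zero, sub_zero, hwa, Nat.sub_zero, poleOrder]
    congr 1; ring
  | succ j ih =>
    obtain ⟨x, hx, hdvd, hval⟩ := ih (by omega) (fun i hi => hlt i (by omega))
    have hltj := hlt j (by omega)
    have htj : (0 : ℤ) < t j := by exact_mod_cast (hT.gen j hj).pos
    set L := poleOrder p t lam j with hL
    set c := a - artinSchreier p x with hc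
    have hnj : (p : ℤ) ^ (n - j) = p * p ^ (n - (j + 1)) := by
      rw [← pow_succ']; congr 1; omega
    set e : ℤ := p ^ (n - (j + 1)) with he_def
    have he : 0 < e := pow_pos hp0 _
    have hcj : (τ ^ p ^ j) c = c := by
      rw [hc, map_sub, map_artinSchreier, hx, ringAut_pow_apply_eq_self ha]
    have hcj1 : (τ ^ p ^ (j + 1)) c = c := fixedSubfield_pow_le τ (pow_dvd_pow p j.le_succ) hcj
    have hxj1 : (τ ^ p ^ (j + 1)) x = x := fixedSubfield_pow_le τ (pow_dvd_pow p j.le_succ) hx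
    obtain ⟨y, hy, hle, hred⟩ := h.exists_reduced_fixed (j := j + 1) hj hcj1
    rw [← he_def] at hred
    rw [hnj] at hval
    set c' := c - artinSchreier p y with hc'
    have hLneg : p * e * -L < 0 := by
      have := mul_pos (mul_pos hp0 he) (htj.trans hltj)
      linarith [neg_mul_eq_mul_neg (p * e) L]
    -- Reduction strictly lowers the pole: seen in the next layer, the old order p L is divisible by
    -- p and the reduced one is not.
    have hclt : ((p * e * -L : ℤ) : WithTop ℤ) < w c' := by
      rcases hred with h0 | ⟨s, hs, hsp, hs'⟩
      · exact lt_of_lt_of_le (by exact_mod_cast hLneg) h0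
      · rw [hval] at hle
        refine lt_of_le_of_ne hle ?_
        rw [hs']
        intro heq
        have h1 : p * e * -L = -(e * s) := by exact_mod_cast heq
        apply hsp
        refine ⟨L, mul_left_cancel₀ he.ne' ?_⟩
        linear_combination h1
    have hwy : w (artinSchreier p y) = (p * e * -L : ℤ) := by
      have : artinSchreier p y = c - c' := by rw [hc']; ring
      rw [this]
      exact val_sub_eq hval hclt
    obtain ⟨r, hr0, hr1, hr2⟩ := val_of_artinSchreier_neg hwy hLneg
    have hr : r = e * (-L) := by
      apply mul_left_cancel₀ hp0.ne'
      rw [← hr1]; ring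
    rw [hr] at hr2
    have hmv := hT.moves j (j + 1) (by omega) hj
    have h1 := (hmv y hy).2 (-L) (by rwa [dvd_neg]) hr2
    rw [← he_def] at h1
    have hneg : e * -L + e * t j < 0 := by nlinarith
    have h2 : w ((τ ^ p ^ j) c' - c') = (p * (e * -L + e * t j) : ℤ) := by
      have : (τ ^ p ^ j) c' - c' = -(artinSchreier p ((τ ^ p ^ j) y - y)) := by
        rw [hc', map_sub, hcj, map_artinSchreier, artinSchreier_sub]; ring
      rw [this, AddValuation.map_neg, val_artinSchreier_of_neg h1 hneg]
    rcases hred with h0 | ⟨s, hs, hsp, hs'⟩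
    · exfalso
      have h3 : 0 ≤ w ((τ ^ p ^ j) c' - c') :=
        AddValuation.map_le_sub w (by rwa [h.val_pow_map]) h0
      rw [h2] at h3
      have : 0 ≤ p * (e * -L + e * t j) := by exact_mod_cast h3
      nlinarith
    · have hc'f : (τ ^ p ^ (j + 1)) c' = c' := by
        rw [hc', map_sub, map_artinSchreier, hy, hcj1]
      have h3 := (hmv c' hc'f).2 (-s) (by rwa [dvd_neg]) (by rw [hs', ← he_def]; congr 1; ring)
      rw [h2, ← he_def] at h3
      have h4 : p * (e * -L + e * t j) = e * -s + e * t j := by exact_mod_cast h3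
      have h5 : poleOrder p t lam (j + 1) = s := by
        rw [poleOrder, ← hL]
        apply mul_left_cancel₀ he.ne'
        linear_combination -h4
      refine ⟨x + y, by rw [map_add, hxj1, hy], by rwa [h5], ?_⟩
      rw [h5, artinSchreier_add]
      have : a - (artinSchreier p x + artinSchreier p y) = c' := by rw [hc', hc]; ring
      rw [this, hs']
      congr 1; ring

-- With c i the order of the i-th lower ramification group, this is Herbrand's function evaluated at
-- the breaks: λ - φ(t_j) is, up to the factor p ^ j, at most L_j - t_j. Only lower bounds for the
-- group orders are needed.
omit [Fact p.Prime] [CharP K p] in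
lemma Tower.sum_card_le {z : ℕ → K} {t : ℕ → ℕ} (hT : Tower p n w τ z t) {c : ℕ → ℕ}
    (hc : ∀ j < n, ∀ i ≤ t j, p ^ (n - j) ≤ c i) (lam : ℤ) (j : ℕ) (hj : j < n) :
    p ^ n * lam - ∑ i ∈ Finset.Icc 1 (t j), (c i : ℤ) ≤
      p ^ (n - j) * (poleOrder p t lam j - t j) := by
  induction j with
  | zero =>
    have : ∑ i ∈ Finset.Icc 1 (t 0), (p ^ n : ℤ) ≤ ∑ i ∈ Finset.Icc 1 (t 0), (c i : ℤ) := by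
      refine Finset.sum_le_sum fun i hi => ?_
      rw [Finset.mem_Icc] at hi
      exact_mod_cast hc 0 hj i hi.2
    rw [Finset.sum_const, Nat.card_Icc, Nat.add_sub_cancel, nsmul_eq_mul] at this
    rw [poleOrder, Nat.sub_zero]
    linarith
  | succ j ih =>
    have h1 := ih (by omega)
    have hlt := hT.lt_succ j hj
    have hsplit : Finset.Icc 1 (t (j + 1)) =
        Finset.Icc 1 (t j) ∪ Finset.Ioc (t j) (t (j + 1)) := by
      ext i
      simp only [Finset.mem_union, Finset.mem_Icc, Finset.mem_Ioc]
      omega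
    have hdis : Disjoint (Finset.Icc 1 (t j)) (Finset.Ioc (t j) (t (j + 1))) := by
      rw [Finset.disjoint_left]
      intro i hi hi'
      simp only [Finset.mem_Icc, Finset.mem_Ioc] at hi hi'
      omega
    rw [hsplit, Finset.sum_union hdis]
    have h2 : ∑ i ∈ Finset.Ioc (t j) (t (j + 1)), (p ^ (n - (j + 1)) : ℤ) ≤
        ∑ i ∈ Finset.Ioc (t j) (t (j + 1)), (c i : ℤ) := by
      refine Finset.sum_le_sum fun i hi => ?_
      rw [Finset.mem_Ioc] at hi
      exact_mod_cast hc (j + 1) hj i hi.2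
    rw [Finset.sum_const, Nat.card_Ioc, nsmul_eq_mul, Nat.cast_sub hlt.le] at h2
    have hnj : (p : ℤ) ^ (n - j) = p * p ^ (n - (j + 1)) := by
      rw [← pow_succ']; congr 1; omega
    rw [hnj] at h1
    rw [poleOrder]
    linarith

/-- The last lower ramification break `b` of a totally ramified cyclic extension, and the behaviour
in the penultimate layer of Artin–Schreier classes of the base field of pole order beyond the
last upper ramification break. -/
lemma exists_last_break (h : IsTotallyRamifiedCyclic p n w τ) (hn : 1 ≤ n) :
    ∃ b : ℕ, (∀ x, 0 ≤ w x → ((b + 1 : ℤ) : WithTop ℤ) ≤ w ((τ ^ p ^ (n - 1)) x - x)) ∧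
      ∀ c : ℕ → ℕ, (∀ j < n, ∀ i : ℕ, (∀ x, 0 ≤ w x →
        ((i + 1 : ℤ) : WithTop ℤ) ≤ w ((τ ^ p ^ j) x - x)) → p ^ (n - j) ≤ c i) →
      ∀ (a : K) (lam : ℤ), τ a = a → ¬ (p : ℤ) ∣ lam → w a = (-(p ^ n * lam) : ℤ) →
      ∑ i ∈ Finset.Icc 1 b, (c i : ℤ) < p ^ n * lam →
      ∀ z', (τ ^ p ^ (n - 1)) (artinSchreier p z') = artinSchreier p z' →
      ∃ (x y : K) (L : ℤ), (τ ^ p ^ (n - 1)) x = x ∧ (τ ^ p ^ (n - 1)) y = y ∧ ¬ (p : ℤ) ∣ L ∧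
        0 < L ∧ w (a - artinSchreier p x) = (-(p * L) : ℤ) ∧
        ((-(p * L) : ℤ) : WithTop ℤ) < w (artinSchreier p z' - artinSchreier p y) := by
  have hp1 : (1 : ℤ) < p := by exact_mod_cast (Fact.out : p.Prime).one_lt
  obtain ⟨z, t, hT⟩ := h.exists_tower
  have hmoves : ∀ j < n, ∀ x, 0 ≤ w x →
      ((t j + 1 : ℤ) : WithTop ℤ) ≤ w ((τ ^ p ^ j) x - x) := by
    intro j hj x hx
    obtain ⟨c, hc, hxc⟩ := h.exists_residue x hx
    have h1 := (hT.moves j n hj le_rfl (x - c) (by rw [h.pow_eq_one]; rfl)).1 1 (by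
      have := (val_lt_iff (w := w) (r := 0)).mp (by exact_mod_cast hxc)
      simpa using this)
    have h2 : (τ ^ p ^ j) (x - c) - (x - c) = (τ ^ p ^ j) x - x := by
      rw [map_sub, ringAut_pow_apply_eq_self hc]; ring
    rw [h2] at h1
    refine le_trans ?_ h1
    rw [WithTop.coe_le_coe]
    simp [add_comm]
  -- The last lower break is the break of the top layer. In `hmoves` the displacement t + 1 rather
  -- than t comes from first subtracting a fixed residue, which leaves an element of value at least
  -- 1.
  refine ⟨t (n - 1), hmoves (n - 1) (by omega), ?_⟩
  intro c hc a lam ha hlam hwa hsum z' hz'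
  have hmono : ∀ j, j < n → t j ≤ t (n - 1) := by
    have : ∀ m j, j + m = n - 1 → j < n → t j ≤ t (n - 1) := by
      intro m
      induction m with
      | zero => intro j hj _; rw [show j = n - 1 by omega]
      | succ m ih =>
        intro j hj hjn
        exact (hT.lt_succ j (by omega)).le.trans (ih (j + 1) (by omega) (by omega))
    exact fun j hj => this (n - 1 - j) j (by omega) hj
  have hlt : ∀ j < n, (t j : ℤ) < poleOrder p t lam j := by
    intro j hj
    have h1 := hT.sum_card_le (c := c) (fun j hj i hi => hc j hj i fun x hx =>
      le_trans (by rw [WithTop.coe_le_coe]; omega) (hmoves j hj x hx)) lam j hj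
    have h2 : ∑ i ∈ Finset.Icc 1 (t j), (c i : ℤ) ≤ ∑ i ∈ Finset.Icc 1 (t (n - 1)), (c i : ℤ) :=
      Finset.sum_le_sum_of_subset_of_nonneg (Finset.Icc_subset_Icc le_rfl (hmono j hj))
        (fun _ _ _ => by positivity)
    have h3 : (0 : ℤ) < p ^ (n - j) * (poleOrder p t lam j - t j) := by linarith
    have := pos_of_mul_pos_right h3 (by positivity)
    omega
  obtain ⟨x, hx, hdvd, hval⟩ := hT.exists_reduced h ha hlam hwa (n - 1) (by omega)
    (fun i hi => hlt i (by omega))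
  have hgen := hT.gen (n - 1) (by omega)
  have hd : artinSchreier p ((τ ^ p ^ (n - 1)) z' - z') = 0 := by
    rw [artinSchreier_sub, ← map_artinSchreier, hz', sub_self]
  obtain ⟨m, hm⟩ := exists_natCast_of_artinSchreier_eq_zero p hd
  have hL := hlt (n - 1) (by omega)
  set L := poleOrder p t lam (n - 1)
  -- z' and the reduced generator of the top layer are moved by elements of the prime field, so z'
  -- minus a multiple of that generator lies in the penultimate layer. What remains of ℘(z') has
  -- pole order at most t_(n-1) < L in that layer.
  refine ⟨x, z' - m * z (n - 1), L, hx, ?_, hdvd, ?_, ?_, ?_⟩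
  · rw [map_sub, map_mul, map_natCast, hgen.map_eq, mul_add, mul_one, ← hm]; ring
  · have : (0 : ℤ) < t (n - 1) := by exact_mod_cast hgen.pos
    omega
  · rw [hval, show n - (n - 1) = 1 by omega]; congr 1; ring
  · rw [artinSchreier_sub, artinSchreier_natCast_mul]
    have h1 := hgen.val_artinSchreier (by omega)
    rw [show n - (n - 1) = 1 by omega, pow_one] at h1
    have h2 := val_mul_le (w := w) (r := 0) (by exact_mod_cast val_natCast_nonneg w m) h1.ge
    have h3 : artinSchreier p z' - (artinSchreier p z' - m * artinSchreier p (z (n - 1))) =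
        m * artinSchreier p (z (n - 1)) := by ring
    rw [h3]
    refine lt_of_lt_of_le ?_ h2
    rw [WithTop.coe_lt_coe]
    nlinarith

end IsTotallyRamifiedCyclic

/-! ### Extension of places and normalized valuations -/

section Extension

/-- Every valuation ring extends along a field extension. -/
lemma exists_mem_placesAbove {k : Type*} (L : Type*) [Field k] [Field L] [Algebra k L]
    (𝔭 : ValuationSubring k) : (placesAbove L 𝔭).Nonempty := by
  let f : k →+* L := algebraMap k L
  let A : Subring L := 𝔭.toSubring.map f
  let g : 𝔭.toSubring ≃+* A := 𝔭.toSubring.equivMapOfInjective f f.injective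
  let I : Ideal A := (IsLocalRing.maximalIdeal 𝔭).comap (g.symm : A →+* 𝔭.toSubring)
  have hI : I ≠ ⊤ := Ideal.comap_ne_top _ (IsLocalRing.maximalIdeal.isMaximal 𝔭).ne_top
  obtain ⟨B, hAB, hB⟩ := Ideal.image_subset_nonunits_valuationSubring I hI
  refine ⟨B, ?_⟩
  ext x
  rw [ValuationSubring.mem_comap]
  constructor
  · intro hx
    by_contra hx'
    have hx0 : x ≠ 0 := by rintro rfl; exact hx' 𝔭.zero_mem
    have hinv : x⁻¹ ∈ 𝔭 := (𝔭.mem_or_inv_mem x).resolve_left hx'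
    have hmem : (⟨x⁻¹, hinv⟩ : 𝔭) ∈ IsLocalRing.maximalIdeal 𝔭 := by
      rw [← 𝔭.coe_mem_nonunits_iff, ValuationSubring.inv_mem_nonunits_iff]
      exact Or.inr hx'
    have h1 : ((g ⟨x⁻¹, hinv⟩ : A) : L) ∈ B.nonunits := by
      refine hB ⟨g ⟨x⁻¹, hinv⟩, ?_, rfl⟩
      change g.symm (g _) ∈ IsLocalRing.maximalIdeal 𝔭
      rw [g.symm_apply_apply]; exact hmem
    have h2 : ((g ⟨x⁻¹, hinv⟩ : A) : L) = (f x)⁻¹ := by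
      rw [← map_inv₀]; rfl
    rw [h2, ValuationSubring.inv_mem_nonunits_iff] at h1
    rcases h1 with h1 | h1
    · exact hx0 (by simpa using h1)
    · exact h1 hx
  · intro hx
    exact hAB ⟨x, hx, rfl⟩

variable {k K : Type*} [Field k] [Field K] [Algebra k K]

/-- The additive valuation `w` has valuation ring `𝔭`. -/
def IsValOf (w : AddValuation K (WithTop ℤ)) (𝔓 : ValuationSubring K) : Prop :=
  ∀ x, x ∈ 𝔓 ↔ 0 ≤ w x

lemma IsValOf.mem_nonunits_iff {w : AddValuation K (WithTop ℤ)} {𝔓 : ValuationSubring K}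
    (h : IsValOf w 𝔓) {x : K} : x ∈ 𝔓.nonunits ↔ 0 < w x := by
  rw [ValuationSubring.mem_nonunits_iff_or, h]
  by_cases hx : x = 0
  · simp [hx]
  obtain ⟨r, hr⟩ := exists_val_eq w hx
  rw [hr, val_inv_eq hr]
  simp only [hx, false_or]
  norm_cast
  omega

/-- `w` extends `e` times `v`. -/
def ExtendsVal (v : AddValuation k (WithTop ℤ)) (w : AddValuation K (WithTop ℤ)) (e : ℕ) : Prop :=
  ∀ (a : k) (r : ℤ), v a = r → w (algebraMap k K a) = (e * r : ℤ)

variable {v : AddValuation k (WithTop ℤ)}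

lemma ExtendsVal.nonneg_iff {w : AddValuation K (WithTop ℤ)} {e : ℕ} (h : ExtendsVal v w e)
    (he : e ≠ 0) {a : k} : 0 ≤ w (algebraMap k K a) ↔ 0 ≤ v a := by
  by_cases ha : a = 0
  · simp [ha]
  obtain ⟨r, hr⟩ := exists_val_eq v ha
  rw [h a r hr, hr]
  norm_cast
  have : (0 : ℤ) < e := by exact_mod_cast Nat.pos_of_ne_zero he
  constructor
  · intro h; exact nonneg_of_mul_nonneg_right h this
  · intro h; positivity

lemma ExtendsVal.pos_iff {w : AddValuation K (WithTop ℤ)} {e : ℕ} (h : ExtendsVal v w e)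
    (he : e ≠ 0) {a : k} : 0 < w (algebraMap k K a) ↔ 0 < v a := by
  by_cases ha : a = 0
  · simp [ha]
  obtain ⟨r, hr⟩ := exists_val_eq v ha
  rw [h a r hr, hr]
  norm_cast
  have : (0 : ℤ) < e := by exact_mod_cast Nat.pos_of_ne_zero he
  constructor
  · intro h; exact pos_of_mul_pos_right h this.le
  · intro h; positivity

/-- A valuation extending `e v` is determined by its valuation ring. -/
lemma ExtendsVal.val_eq_of_nonneg_imp {w w' : AddValuation K (WithTop ℤ)} {e : ℕ} (he : e ≠ 0)
    (hv : ∃ π, v π = (1 : ℤ)) (h : ExtendsVal v w e) (h' : ExtendsVal v w' e)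
    (hww : ∀ x, 0 ≤ w x → 0 ≤ w' x) (x : K) : w' x = w x := by
  by_cases hx : x = 0
  · simp [hx]
  obtain ⟨π, hπ⟩ := hv
  obtain ⟨r, hr⟩ := exists_val_eq w hx
  obtain ⟨r', hr'⟩ := exists_val_eq w' hx
  have hy := val_zpow_eq hπ r
  rw [mul_one] at hy
  have h1 := val_div_eq (val_pow_eq hr e) (h _ _ hy)
  have h1' := val_div_eq (val_pow_eq hr' e) (h' _ _ hy)
  -- With r = w x this is a unit for w; both it and its inverse are integral for w', so it is a unit
  -- for w' too, which forces w' x = r.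
  set u := x ^ e / algebraMap k K (π ^ r)
  rw [sub_self] at h1
  have h2 := hww u (by rw [h1]; exact le_rfl)
  have h3 := hww u⁻¹ (by rw [val_inv_eq h1]; simp)
  rw [h1'] at h2
  rw [val_inv_eq h1'] at h3
  have h4 : (0 : ℤ) ≤ e * r' - e * r := by exact_mod_cast h2
  have h5 : (0 : ℤ) ≤ -(e * r' - e * r) := by exact_mod_cast h3
  have h6 : (e : ℤ) * r' = e * r := by omega
  rw [hr', hr, mul_left_cancel₀ (by exact_mod_cast he) h6]

/-- The normalized valuation of a prime divisor of finite ramification index `e ≠ 0`. -/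
lemma exists_normalized_val {𝔭 : ValuationSubring k} (hv𝔭 : IsValOf v 𝔭)
    (hv : ∃ π, v π = (1 : ℤ)) {𝔓 : ValuationSubring K} (h𝔓 : 𝔓 ∈ placesAbove K 𝔭)
    (he : ramificationIndex k 𝔓 ≠ 0) :
    ∃ w : AddValuation K (WithTop ℤ), IsValOf w 𝔓 ∧ ExtendsVal v w (ramificationIndex k 𝔓) ∧
      ∃ π, w π = (1 : ℤ) := by
  classical
  set e := ramificationIndex k 𝔓 with he_def
  let θ : kˣ →* 𝔓.ValueGroupˣ := (Units.map (𝔓.valuation : K →* 𝔓.ValueGroup)).comp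
    (Units.map (algebraMap k K : k →* K))
  have hindex : θ.range.index = e := rfl
  have hθ : ∀ u : kˣ, ((θ u : 𝔓.ValueGroupˣ) : 𝔓.ValueGroup) = 𝔓.valuation (algebraMap k K u) :=
    fun u => rfl
  have hmem : ∀ x : k, 𝔓.valuation (algebraMap k K x) ≤ 1 ↔ 0 ≤ v x := by
    intro x
    rw [ValuationSubring.valuation_le_one_iff, ← ValuationSubring.mem_comap,
      show 𝔓.comap (algebraMap k K) = 𝔭 from h𝔓, hv𝔭]
  choose ν hν using fun u : kˣ => exists_val_eq v u.ne_zero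
  let ψ : kˣ →* Multiplicative ℤ :=
    { toFun := fun u => Multiplicative.ofAdd (ν u)
      map_one' := by
        have := hν 1
        rw [Units.val_one, AddValuation.map_one] at this
        have h0 : ν 1 = 0 := by exact_mod_cast this.symm
        rw [h0]; rfl
      map_mul' := fun a b => by
        rw [← ofAdd_add]
        congr 1
        have h1 := hν (a * b)
        rw [Units.val_mul, val_mul_eq (hν a) (hν b)] at h1
        exact_mod_cast h1.symm }
  have hψ : ∀ u : kˣ, v u = (Multiplicative.toAdd (ψ u) : ℤ) := hν
  have hψθ : ∀ a b : kˣ, θ a ≤ θ b → Multiplicative.toAdd (ψ b) ≤ Multiplicative.toAdd (ψ a) := by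
    intro a b hab
    have h1 : 𝔓.valuation (algebraMap k K ((a / b : kˣ) : k)) ≤ 1 := by
      rw [← hθ, _root_.map_div]
      exact_mod_cast div_le_one'.mpr hab
    rw [hmem, hψ, _root_.map_div, toAdd_div] at h1
    have : (0 : ℤ) ≤ Multiplicative.toAdd (ψ a) - Multiplicative.toAdd (ψ b) := by
      exact_mod_cast h1
    omega
  have hψθ' : ∀ a b : kˣ, Multiplicative.toAdd (ψ b) ≤ Multiplicative.toAdd (ψ a) → θ a ≤ θ b := by
    intro a b hab
    have h1 : 𝔓.valuation (algebraMap k K ((a / b : kˣ) : k)) ≤ 1 := by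
      rw [hmem, hψ, _root_.map_div, toAdd_div]
      have : (0 : ℤ) ≤ Multiplicative.toAdd (ψ a) - Multiplicative.toAdd (ψ b) := by omega
      exact_mod_cast this
    rw [← hθ, _root_.map_div] at h1
    exact div_le_one'.mp (by exact_mod_cast h1)
  have hpow : ∀ γ : 𝔓.ValueGroupˣ, ∃ y, θ y = γ ^ e := by
    intro γ
    have := Subgroup.pow_index_mem (H := θ.range) γ
    rw [hindex] at this
    exact this
  choose y hy using hpow
  -- γ ^ e comes from k because e is the index, so the value of γ is defined as the k-value of γ ^
  -- e. This reverses the order and multiplies the values of k by e.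
  let φ : 𝔓.ValueGroupˣ →* Multiplicative ℤ := MonoidHom.mk' (fun γ => ψ (y γ)) (by
    intro a b
    have h1 : θ (y (a * b)) = θ (y a * y b) := by rw [map_mul, hy, hy, hy, mul_pow]
    have h2 := hψθ _ _ h1.le
    have h3 := hψθ _ _ h1.ge
    rw [← map_mul]
    exact le_antisymm h3 h2)
  have hφ : ∀ γ, φ γ = ψ (y γ) := fun γ => rfl
  have hφle : ∀ a b, Multiplicative.toAdd (φ b) ≤ Multiplicative.toAdd (φ a) ↔ a ≤ b := by
    intro a b
    have he' : e ≠ 0 := he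
    constructor
    · intro h
      have := hψθ' _ _ h
      rw [hy, hy] at this
      exact le_of_pow_le_pow_left' he' this
    · intro h
      apply hψθ
      rw [hy, hy]
      exact pow_le_pow_left' h e
  have hφθ : ∀ u, φ (θ u) = ψ u ^ e := by
    intro u
    have h1 : θ (y (θ u)) = θ (u ^ e) := by rw [hy, map_pow]
    rw [hφ, ← map_pow]
    exact le_antisymm (hψθ _ _ h1.ge) (hψθ _ _ h1.le)
  have hsurj : Function.Surjective φ := by
    have hψs : Function.Surjective ψ := by
      obtain ⟨π, hπ⟩ := hv
      intro m
      refine ⟨Units.mk0 π (ne_zero_of_val hπ) ^ (Multiplicative.toAdd m), ?_⟩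
      have h1 : ψ (Units.mk0 π (ne_zero_of_val hπ)) = Multiplicative.ofAdd 1 := by
        have h2 := hψ (Units.mk0 π (ne_zero_of_val hπ))
        rw [Units.val_mk0, hπ] at h2
        have : Multiplicative.toAdd (ψ (Units.mk0 π (ne_zero_of_val hπ))) = 1 := by
          exact_mod_cast h2.symm
        exact congrArg Multiplicative.ofAdd this
      rw [map_zpow, h1, ← ofAdd_zsmul, smul_eq_mul, mul_one]; rfl
    -- Index comparison: the preimage of eℤ under φ is the image of kˣ, of index e, so eℤ has index
    -- e in the range of φ as well as in ℤ. Hence φ is onto.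
    let Z : Subgroup (Multiplicative ℤ) := (powMonoidHom e).range
    have hZle : Z ≤ φ.range := by
      rintro _ ⟨m, rfl⟩
      obtain ⟨u, rfl⟩ := hψs m
      exact ⟨θ u, hφθ u⟩
    have hcomap : Z.comap φ = θ.range := by
      ext γ
      rw [Subgroup.mem_comap]
      constructor
      · rintro ⟨m, hm⟩
        obtain ⟨u, rfl⟩ := hψs m
        refine ⟨u, ?_⟩
        have h1 : φ (θ u) = φ γ := by rw [hφθ, ← hm]; rfl
        exact le_antisymm ((hφle _ _).mp h1.ge) ((hφle _ _).mp h1.le)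
      · rintro ⟨u, rfl⟩
        exact ⟨ψ u, (hφθ u).symm⟩
    have hZindex : Z.index = e := by
      have h1 : Z = AddSubgroup.toSubgroup (AddSubgroup.zmultiples (e : ℤ)) := by
        ext m
        change _ ↔ Multiplicative.toAdd m ∈ AddSubgroup.zmultiples (e : ℤ)
        rw [Int.mem_zmultiples_iff]
        constructor
        · rintro ⟨a, rfl⟩
          exact ⟨Multiplicative.toAdd a, by rw [powMonoidHom_apply, toAdd_pow, nsmul_eq_mul]⟩
        · rintro ⟨a, ha⟩
          refine ⟨Multiplicative.ofAdd a, ?_⟩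
          rw [powMonoidHom_apply, ← ofAdd_nsmul, nsmul_eq_mul, ← ha]; rfl
      rw [h1, AddSubgroup.index_toSubgroup, Int.index_zmultiples, Int.natAbs_natCast]
    have h1 := Subgroup.relIndex_mul_index hZle
    rw [← Subgroup.index_comap, hcomap, hindex, hZindex] at h1
    have h2 : φ.range.index = 1 := by
      have : e * φ.range.index = e * 1 := by rw [h1, mul_one]
      exact Nat.eq_of_mul_eq_mul_left (Nat.pos_of_ne_zero he) this
    rw [Subgroup.index_eq_one] at h2
    exact MonoidHom.range_eq_top.mp h2
  let val : ∀ x : K, x ≠ 0 → 𝔓.ValueGroupˣ := fun x hx =>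
    Units.map (𝔓.valuation : K →* 𝔓.ValueGroup) (Units.mk0 x hx)
  let f : K → WithTop ℤ := fun x => if hx : x = 0 then ⊤ else
    ((Multiplicative.toAdd (φ (val x hx)) : ℤ) : WithTop ℤ)
  have hf0 : f 0 = ⊤ := dif_pos rfl
  have hf : ∀ x (hx : x ≠ 0), f x = ((Multiplicative.toAdd (φ (val x hx)) : ℤ) : WithTop ℤ) :=
    fun x hx => dif_neg hx
  have hfle : ∀ x y, 𝔓.valuation x ≤ 𝔓.valuation y → f y ≤ f x := by
    intro x y hxy
    by_cases hx : x = 0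
    · rw [hx, hf0]; exact le_top
    have hy : y ≠ 0 := by
      rintro rfl
      rw [map_zero, le_zero_iff, map_eq_zero] at hxy
      exact hx hxy
    rw [hf x hx, hf y hy]
    norm_cast
    rw [hφle]
    exact hxy
  let w : AddValuation K (WithTop ℤ) := AddValuation.of f hf0
    (by
      rw [hf 1 one_ne_zero]
      have : val 1 one_ne_zero = 1 := by
        ext
        change 𝔓.valuation 1 = 1
        simp
      rw [this, map_one]; rfl)
    (by
      intro x y
      rcases le_total (𝔓.valuation x) (𝔓.valuation y) with h | h
      · exact (min_le_right _ _).trans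
          (hfle _ _ ((𝔓.valuation.map_add x y).trans (max_le h le_rfl)))
      · exact (min_le_left _ _).trans
          (hfle _ _ ((𝔓.valuation.map_add x y).trans (max_le le_rfl h))))
    (by
      intro x y
      by_cases hx : x = 0
      · simp [hx, hf0]
      by_cases hy : y = 0
      · simp [hy, hf0]
      rw [hf x hx, hf y hy, hf _ (mul_ne_zero hx hy)]
      have : val (x * y) (mul_ne_zero hx hy) = val x hx * val y hy := by
        ext
        exact map_mul 𝔓.valuation x y
      rw [this, map_mul, toAdd_mul]; norm_cast)
  have hwf : ∀ x, w x = f x := fun x => rfl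
  refine ⟨w, ?_, ?_, ?_⟩
  · intro x
    rw [hwf, ← ValuationSubring.valuation_le_one_iff]
    by_cases hx : x = 0
    · simp [hx, hf0]
    rw [hf x hx]
    have h1 := hφle (val x hx) 1
    rw [map_one, toAdd_one] at h1
    norm_cast
    rw [h1]
    rfl
  · intro a r har
    have ha : a ≠ 0 := ne_zero_of_val har
    have ha' : algebraMap k K a ≠ 0 := by simpa using ha
    rw [hwf, hf _ ha']
    have h1 : val (algebraMap k K a) ha' = θ (Units.mk0 a ha) := by ext; rfl
    rw [h1, hφθ, toAdd_pow]
    have h2 := hψ (Units.mk0 a ha)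
    rw [Units.val_mk0, har] at h2
    have h3 : r = Multiplicative.toAdd (ψ (Units.mk0 a ha)) := by exact_mod_cast h2
    rw [h3]; simp
  · obtain ⟨γ, hγ⟩ := hsurj (Multiplicative.ofAdd 1)
    obtain ⟨x, hx⟩ := 𝔓.valuation_surjective γ
    have hx0 : x ≠ 0 := by
      rintro rfl
      rw [map_zero] at hx
      exact γ.ne_zero hx.symm
    refine ⟨x, ?_⟩
    rw [hwf, hf x hx0]
    have : val x hx0 = γ := by ext; exact hx
    rw [this, hγ]; rfl

end Extension

/-! ### Totally ramified places: power basis, integrality, uniqueness -/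

section TotallyRamified

variable {k K : Type*} [Field k] [Field K] [Algebra k K] {v : AddValuation k (WithTop ℤ)}
  {w : AddValuation K (WithTop ℤ)} {N : ℕ} {π : K}

/-- The nonzero terms have values in distinct classes modulo N, so there is no cancellation and the
sum has the least of their values. -/
lemma val_sum_le_val_term (h : ExtendsVal v w N) (hπ : w π = (1 : ℤ)) (a : Fin N → k) (i : Fin N) :
    w (∑ j, algebraMap k K (a j) * π ^ (j : ℕ)) ≤ w (algebraMap k K (a i) * π ^ (i : ℕ)) := by
  classical
  have hterm : ∀ j, a j ≠ 0 → ∃ r : ℤ,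
      w (algebraMap k K (a j) * π ^ (j : ℕ)) = (N * r + j : ℤ) := by
    intro j hj
    obtain ⟨r, hr⟩ := exists_val_eq v hj
    exact ⟨r, by rw [val_mul_eq (h _ _ hr) (val_pow_eq hπ j), mul_one]⟩
  obtain ⟨j, hj⟩ : ∃ j, ∀ i, w (algebraMap k K (a j) * π ^ (j : ℕ)) ≤
      w (algebraMap k K (a i) * π ^ (i : ℕ)) := by
    obtain ⟨j, -, hj⟩ := Finset.exists_min_image Finset.univ
      (fun j : Fin N => w (algebraMap k K (a j) * π ^ (j : ℕ))) ⟨i, Finset.mem_univ i⟩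
    exact ⟨j, fun i => hj i (Finset.mem_univ i)⟩
  refine le_trans (le_of_eq ?_) (hj i)
  by_cases haj : a j = 0
  · have hall : ∀ i, algebraMap k K (a i) * π ^ (i : ℕ) = 0 := by
      intro i
      have := hj i
      rw [haj, map_zero, zero_mul, AddValuation.map_zero, top_le_iff, AddValuation.top_iff] at this
      exact this
    rw [Finset.sum_eq_zero fun i _ => hall i, hall j]
  obtain ⟨r, hr⟩ := hterm j haj
  rw [← Finset.add_sum_erase _ _ (Finset.mem_univ j), hr]
  refine val_add_eq hr (AddValuation.map_lt_sum w (WithTop.coe_ne_top) fun l hl => ?_)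
  refine lt_of_le_of_ne (hr ▸ hj l) ?_
  by_cases hal : a l = 0
  · rw [hal, map_zero, zero_mul, AddValuation.map_zero]; exact WithTop.coe_ne_top
  obtain ⟨s, hs⟩ := hterm l hal
  rw [hs]
  intro heq
  have heq' : N * r + j = N * s + (l : ℤ) := by exact_mod_cast heq
  have h1 := congrArg (fun m : ℤ => m % N) heq'
  simp only [Int.mul_add_emod_self_left] at h1
  rw [Int.emod_eq_of_lt (by positivity) (by exact_mod_cast j.2),
    Int.emod_eq_of_lt (by positivity) (by exact_mod_cast l.2)] at h1
  exact Finset.ne_of_mem_erase hl (Fin.ext (by exact_mod_cast h1.symm))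

lemma exists_eq_sum_pow (h : ExtendsVal v w N) (hπ : w π = (1 : ℤ))
    (hN : Module.finrank k K = N) (hN0 : N ≠ 0) (x : K) :
    ∃ a : Fin N → k, x = ∑ j, algebraMap k K (a j) * π ^ (j : ℕ) := by
  have : FiniteDimensional k K := Module.finite_of_finrank_pos (by omega)
  have hπ0 := ne_zero_of_val hπ
  have hli : LinearIndependent k (fun i : Fin N => π ^ (i : ℕ)) := by
    rw [Fintype.linearIndependent_iff]
    intro g hg i
    simp only [Algebra.smul_def] at hg
    have := val_sum_le_val_term h hπ g i
    rw [hg, AddValuation.map_zero, top_le_iff, AddValuation.top_iff] at this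
    simpa [hπ0] using this
  have : Nonempty (Fin N) := ⟨⟨0, by omega⟩⟩
  have hspan := hli.span_eq_top_of_card_eq_finrank (by rw [Fintype.card_fin, hN])
  have hx : x ∈ Submodule.span k (Set.range fun i : Fin N => π ^ (i : ℕ)) := by
    rw [hspan]; trivial
  obtain ⟨a, ha⟩ := (Submodule.mem_span_range_iff_exists_fun k).mp hx
  exact ⟨a, by rw [← ha]; simp only [Algebra.smul_def]⟩

lemma exists_integral_coordinates (h : ExtendsVal v w N) (hπ : w π = (1 : ℤ))
    (hN : Module.finrank k K = N) (hN0 : N ≠ 0) {x : K} (hx : 0 ≤ w x) :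
    ∃ a : Fin N → k, (∀ j, 0 ≤ v (a j)) ∧ x = ∑ j, algebraMap k K (a j) * π ^ (j : ℕ) := by
  obtain ⟨a, ha⟩ := exists_eq_sum_pow h hπ hN hN0 x
  refine ⟨a, fun j => ?_, ha⟩
  by_cases haj : a j = 0
  · simp [haj]
  have h1 := val_sum_le_val_term h hπ a j
  obtain ⟨r, hr⟩ := exists_val_eq v haj
  rw [← ha, val_mul_eq (h _ _ hr) (val_pow_eq hπ j)] at h1
  have h2 := hx.trans h1
  rw [hr]
  have h3 : (0 : ℤ) ≤ N * r + j * 1 := by exact_mod_cast h2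
  have h4 : (j : ℤ) < N := by exact_mod_cast j.2
  have h5 : 0 ≤ r := by
    by_contra! hneg
    nlinarith
  exact_mod_cast h5

lemma exists_residue_of_totallyRamified (h : ExtendsVal v w N) (hπ : w π = (1 : ℤ))
    (hN : Module.finrank k K = N) (hN0 : N ≠ 0) {x : K} (hx : 0 ≤ w x) :
    ∃ c : k, 0 ≤ v c ∧ 0 < w (x - algebraMap k K c) := by
  obtain ⟨a, ha0, ha⟩ := exists_integral_coordinates h hπ hN hN0 hx
  let i0 : Fin N := ⟨0, by omega⟩
  refine ⟨a i0, ha0 i0, ?_⟩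
  have hsub : x - algebraMap k K (a i0) =
      ∑ j ∈ Finset.univ.erase i0, algebraMap k K (a j) * π ^ (j : ℕ) := by
    rw [ha, ← Finset.add_sum_erase _ _ (Finset.mem_univ i0)]
    simp [i0]
  rw [hsub]
  refine AddValuation.map_lt_sum w (by simp) fun j hj => ?_
  have hj0 : (j : ℕ) ≠ 0 := fun h0 => Finset.ne_of_mem_erase hj (Fin.ext h0)
  have h1 := val_mul_le (w := w) (r := 0) (by exact_mod_cast (h.nonneg_iff hN0).mpr (ha0 j))
    (val_pow_eq hπ j).ge
  refine lt_of_lt_of_le ?_ h1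
  have : (0 : ℤ) < 0 + j * 1 := by omega
  exact_mod_cast this

/-- The valuation ring is the module spanned by 1, π, …, π ^ (N - 1), so each of its elements acts
on a finitely generated module. -/
lemma isIntegral_of_totallyRamified (h : ExtendsVal v w N) (hπ : w π = (1 : ℤ))
    (hN : Module.finrank k K = N) (hN0 : N ≠ 0) {R : Type*} [CommRing R] [Algebra R K]
    (hR : ∀ a : k, 0 ≤ v a → ∃ r : R, algebraMap R K r = algebraMap k K a)
    (hR' : ∀ r : R, 0 ≤ w (algebraMap R K r)) {x : K} (hx : 0 ≤ w x) : IsIntegral R x := by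
  let M : Submodule R K := Submodule.span R (Set.range fun i : Fin N => π ^ (i : ℕ))
  have hM : ∀ y, y ∈ M ↔ 0 ≤ w y := by
    intro y
    rw [Submodule.mem_span_range_iff_exists_fun R]
    constructor
    · rintro ⟨c, rfl⟩
      refine AddValuation.map_le_sum w fun i _ => ?_
      rw [Algebra.smul_def]
      rw [AddValuation.map_mul]
      exact add_nonneg (hR' (c i)) (val_pow_nonneg (by rw [hπ]; norm_num) _)
    · intro hy
      obtain ⟨a, ha0, ha⟩ := exists_integral_coordinates h hπ hN hN0 hy
      choose c hc using fun j => hR (a j) (ha0 j)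
      exact ⟨c, by rw [ha]; simp only [Algebra.smul_def, hc]⟩
  refine isIntegral_of_smul_mem_submodule M ?_ ?_ x ?_
  · rw [Submodule.ne_bot_iff]
    exact ⟨1, (hM 1).mpr (by simp), one_ne_zero⟩
  · exact Submodule.fg_span (Set.finite_range _)
  · intro y hy
    rw [hM] at hy ⊢
    have := val_mul_le (w := w) (r := 0) (s := 0) (by exact_mod_cast hx) (by exact_mod_cast hy)
    rw [smul_eq_mul]
    simpa using this

/-- Elements integral over `𝔭` lie in every prime divisor above `𝔭`. -/
lemma mem_of_isIntegralElem {𝔭 : ValuationSubring k} {𝔓 : ValuationSubring K}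
    (h𝔓 : 𝔓 ∈ placesAbove K 𝔭) {x : K}
    (hx : ((algebraMap k K).comp 𝔭.subtype).IsIntegralElem x) : x ∈ 𝔓 := by
  have hle : ∀ a : 𝔭, algebraMap k K a ∈ 𝔓 := by
    intro a
    have : (a : k) ∈ 𝔓.comap (algebraMap k K) := by
      rw [show 𝔓.comap (algebraMap k K) = 𝔭 from h𝔓]; exact a.2
    exact this
  let g : 𝔭 →+* 𝔓 := ((algebraMap k K).comp 𝔭.subtype).codRestrict 𝔓 hle
  have hint : IsIntegral 𝔓 x := by
    obtain ⟨q, hq, hqx⟩ := hx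
    refine ⟨q.map g, hq.map g, ?_⟩
    rw [eval₂_map]
    exact hqx
  obtain ⟨y, hy⟩ := IsIntegrallyClosed.isIntegral_iff.mp hint
  rw [← hy]
  exact y.2

lemma isIntegralElem_of_totallyRamified {𝔭 : ValuationSubring k} (hv : IsValOf v 𝔭)
    (h : ExtendsVal v w N) (hπ : w π = (1 : ℤ)) (hN : Module.finrank k K = N) (hN0 : N ≠ 0)
    {x : K} (hx : 0 ≤ w x) : ((algebraMap k K).comp 𝔭.subtype).IsIntegralElem x := by
  have key : ∀ {R : Type _} [CommRing R] (f : R →+* K),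
      (∀ a : k, 0 ≤ v a → ∃ r : R, f r = algebraMap k K a) → (∀ r : R, 0 ≤ w (f r)) →
      f.IsIntegralElem x := by
    intro R _ f h1 h2
    let := f.toAlgebra
    exact isIntegral_of_totallyRamified h hπ hN hN0 (R := R) h1 h2 hx
  refine key _ (fun a ha => ⟨⟨a, (hv a).mpr ha⟩, rfl⟩) (fun r => ?_)
  exact (h.nonneg_iff hN0).mpr ((hv _).mp r.2)

/-- Every place above has its ring integral over 𝔭, hence contained in every other one. -/
lemma place_unique_of_totallyRamified {𝔭 : ValuationSubring k} (hv : IsValOf v 𝔭)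
    (hv1 : ∃ π, v π = (1 : ℤ)) (hN0 : Module.finrank k K ≠ 0)
    (hram : IsFullyRamified K 𝔭) {𝔓 𝔓' : ValuationSubring K} (h : 𝔓 ∈ placesAbove K 𝔭)
    (h' : 𝔓' ∈ placesAbove K 𝔭) : 𝔓 = 𝔓' := by
  have hle : ∀ 𝔓 ∈ placesAbove K 𝔭, ∀ 𝔓' ∈ placesAbove K 𝔭, ∀ x ∈ 𝔓, x ∈ 𝔓' := by
    intro 𝔓 h 𝔓' h' x hx
    obtain ⟨w, hw, hext, π, hπ⟩ := exists_normalized_val hv hv1 h (by rwa [hram 𝔓 h])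
    rw [hram 𝔓 h] at hext
    exact mem_of_isIntegralElem h'
      (isIntegralElem_of_totallyRamified hv hext hπ rfl hN0 ((hw x).mp hx))
  exact ValuationSubring.ext _ _ fun x => ⟨hle 𝔓 h 𝔓' h' x, hle 𝔓' h' 𝔓 h x⟩

/-- Integrality over 𝔭 is preserved by σ, so w ∘ σ is nonnegative wherever w is; two extensions of N
v so related coincide. -/
lemma val_algEquiv_of_totallyRamified {𝔭 : ValuationSubring k} (hv : IsValOf v 𝔭)
    (hv1 : ∃ π, v π = (1 : ℤ)) {𝔓 : ValuationSubring K} (h𝔓 : 𝔓 ∈ placesAbove K 𝔭)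
    (hw : IsValOf w 𝔓) (h : ExtendsVal v w N) (hπ : w π = (1 : ℤ))
    (hN : Module.finrank k K = N) (hN0 : N ≠ 0) (σ : K ≃ₐ[k] K) (x : K) : w (σ x) = w x := by
  have hext : ExtendsVal v (w.comap (σ : K →+* K)) N := by
    intro a r hr
    change w (σ (algebraMap k K a)) = _
    rw [σ.commutes]
    exact h a r hr
  refine h.val_eq_of_nonneg_imp (w' := w.comap (σ : K →+* K)) hN0 hv1 hext (fun y hy => ?_) x
  change 0 ≤ w (σ y)
  rw [← hw]
  apply mem_of_isIntegralElem h𝔓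
  obtain ⟨q, hq, hqx⟩ := isIntegralElem_of_totallyRamified hv h hπ hN hN0 hy
  refine ⟨q, hq, ?_⟩
  have h1 := congrArg σ hqx
  rw [map_zero] at h1
  rw [← h1]
  have h2 : (algebraMap k K).comp 𝔭.subtype =
      (σ : K →+* K).comp ((algebraMap k K).comp 𝔭.subtype) := by
    ext a
    simp
  conv_lhs => rw [h2]
  exact (hom_eval₂ q _ (σ : K →+* K) y).symm

end TotallyRamified

/-! ### Perfectness of the residue field -/

section Residue

variable {k K : Type*} [Field k] [Field K] [Algebra k K] {v : AddValuation k (WithTop ℤ)}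
  {w : AddValuation K (WithTop ℤ)} {p : ℕ} [Fact p.Prime] [CharP K p]

/-- The residue field of an algebraic extension of a valued field with finite residue field is
algebraic over the prime field. -/
lemma exists_pow_sub_self_pos [Algebra.IsAlgebraic k K] {e : ℕ} (he : e ≠ 0)
    (h : ExtendsVal v w e) {𝔓 : ValuationSubring K} (hw : IsValOf w 𝔓) {m : ℕ} (hm : 1 ≤ m)
    (hfin : ∀ a, 0 ≤ v a → 0 < v (a ^ p ^ m - a)) {u : K} (hu : 0 ≤ w u) :
    ∃ m : ℕ, 1 ≤ m ∧ 0 < w (u ^ p ^ m - u) := by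
  classical
  let κ := IsLocalRing.ResidueField 𝔓
  let res : 𝔓 →+* κ := IsLocalRing.residue 𝔓
  have hres : ∀ x : 𝔓, res x = 0 ↔ 0 < w x := by
    intro x
    rw [IsLocalRing.residue_eq_zero_iff, ← ValuationSubring.coe_mem_nonunits_iff,
      hw.mem_nonunits_iff]
  have : CharP 𝔓 p := (RingHom.charP_iff 𝔓.subtype Subtype.val_injective p).mpr inferInstance
  have hκp : CharP κ p := by
    have : (p : κ) = 0 := by
      rw [← map_natCast res, CharP.cast_eq_zero 𝔓 p, map_zero]
    exact (CharP.charP_iff_prime_eq_zero Fact.out).mpr this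
  let : Algebra (ZMod p) κ := ZMod.algebra κ p
  let A := integralClosure (ZMod p) κ
  have hmemA : ∀ a : k, ∀ ha : algebraMap k K a ∈ 𝔓, res ⟨_, ha⟩ ∈ A := by
    intro a ha
    have h1 := hfin a ((h.nonneg_iff he).mp ((hw _).mp ha))
    rw [← h.pos_iff he] at h1
    have h2 : res (⟨_, ha⟩ ^ p ^ m - ⟨_, ha⟩) = 0 := by
      rw [hres]
      simpa using h1
    rw [map_sub, map_pow] at h2
    refine ⟨X ^ p ^ m - X, ?_, ?_⟩
    · apply monic_X_pow_sub
      rw [degree_X]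
      have : 1 < p ^ m := Nat.one_lt_pow (by omega) (Fact.out : p.Prime).one_lt
      exact_mod_cast this
    · simpa using h2
  obtain ⟨q, hq0, hqu⟩ := Algebra.IsAlgebraic.isAlgebraic (R := k) u
  -- divide by a coefficient of least valuation
  obtain ⟨j, hj, hjmin⟩ := Finset.exists_min_image q.support (fun i => v (q.coeff i))
    (by rwa [Polynomial.support_nonempty])
  rw [mem_support_iff] at hj
  let a : ℕ → k := fun i => q.coeff i / q.coeff j
  have ha : ∀ i, algebraMap k K (a i) ∈ 𝔓 := by
    intro i
    rw [hw, h.nonneg_iff he]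
    by_cases hi : q.coeff i = 0
    · simp [a, hi]
    have h1 := hjmin i (mem_support_iff.mpr hi)
    obtain ⟨r, hr⟩ := exists_val_eq v hi
    obtain ⟨s, hs⟩ := exists_val_eq v hj
    rw [hr, hs] at h1
    rw [val_div_eq hr hs]
    have : s ≤ r := by exact_mod_cast h1
    have : 0 ≤ r - s := by omega
    exact_mod_cast this
  have haj : a j = 1 := div_self hj
  let b : ℕ → A := fun i => ⟨res ⟨_, ha i⟩, hmemA _ (ha i)⟩
  let f : A[X] := ∑ i ∈ Finset.range (q.natDegree + 1), C (b i) * X ^ i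
  have hf0 : f ≠ 0 := by
    intro hf
    have h1 : f.coeff j = b j := by
      simp only [f, finsetSum_coeff, coeff_C_mul_X_pow]
      rw [Finset.sum_ite_eq, if_pos]
      rw [Finset.mem_range, Nat.lt_succ_iff]
      exact le_natDegree_of_ne_zero hj
    rw [hf, coeff_zero] at h1
    have h2 : res ⟨_, ha j⟩ = 0 := (congrArg Subtype.val h1).symm
    rw [hres] at h2
    change 0 < w (algebraMap k K (a j)) at h2
    rw [haj, map_one] at h2
    simp at h2
  let u' : 𝔓 := ⟨u, (hw u).mpr hu⟩
  have hfu : aeval (res u') f = 0 := by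
    have h1 : (∑ i ∈ Finset.range (q.natDegree + 1), (⟨_, ha i⟩ : 𝔓) * u' ^ i) = 0 := by
      apply Subtype.val_injective
      have h2 : ((∑ i ∈ Finset.range (q.natDegree + 1), (⟨_, ha i⟩ : 𝔓) * u' ^ i : 𝔓) : K) =
          ∑ i ∈ Finset.range (q.natDegree + 1), algebraMap k K (a i) * u ^ i := by
        rw [← ValuationSubring.subtype_apply, map_sum]; rfl
      rw [h2]
      have h3 : ∑ i ∈ Finset.range (q.natDegree + 1), algebraMap k K (a i) * u ^ i =
          (algebraMap k K (q.coeff j))⁻¹ * aeval u q := by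
        rw [aeval_eq_sum_range, Finset.mul_sum]
        refine Finset.sum_congr rfl fun i _ => ?_
        rw [Algebra.smul_def]
        simp only [a, map_div₀]
        ring
      rw [h3, hqu, mul_zero]; rfl
    have h4 := congrArg res h1
    rw [map_sum, map_zero] at h4
    simp only [f, map_sum, map_mul, aeval_C, map_pow, aeval_X]
    rw [← h4]
    refine Finset.sum_congr rfl fun i _ => ?_
    rw [map_mul, map_pow]
    rfl
  -- The reduced equation has coefficients algebraic over the prime field, so its root is too and
  -- lies in a finite field, where a power of Frobenius is the identity.
  have halg : IsAlgebraic (ZMod p) (res u') := by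
    have h1 : IsAlgebraic A (res u') := ⟨f, hf0, hfu⟩
    have : Algebra.IsAlgebraic (ZMod p) A := inferInstance
    exact h1.restrictScalars (ZMod p)
  have hint : IsIntegral (ZMod p) (res u') := halg.isIntegral
  let E := IntermediateField.adjoin (ZMod p) {res u'}
  have : FiniteDimensional (ZMod p) E := IntermediateField.adjoin.finiteDimensional hint
  have : Finite E := Module.finite_of_finite (ZMod p)
  let := Fintype.ofFinite E
  refine ⟨Module.finrank (ZMod p) E, Module.finrank_pos, ?_⟩
  have hcard : Fintype.card E = p ^ Module.finrank (ZMod p) E := by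
    rw [Module.card_eq_pow_finrank (K := ZMod p) (V := E), ZMod.card]
  have h1 := FiniteField.pow_card (⟨res u', IntermediateField.mem_adjoin_simple_self _ _⟩ : E)
  rw [hcard] at h1
  have h2 : res u' ^ p ^ Module.finrank (ZMod p) E = res u' := congrArg Subtype.val h1
  have h3 : res (u' ^ p ^ Module.finrank (ZMod p) E - u') = 0 := by
    rw [map_sub, map_pow, h2, sub_self]
  rw [hres] at h3
  simpa using h3

end Residue

/-! ### Galois groups, ramification groups and the conductor -/

section Cyclic

variable {k K : Type*} [Field k] [Field K] [Algebra k K] {v : AddValuation k (WithTop ℤ)}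
  {w : AddValuation K (WithTop ℤ)} {p : ℕ} [Fact p.Prime] [CharP K p] {n : ℕ}

/-- A field automorphism over `k`, as a ring automorphism. -/
abbrev toRingAut (σ : K ≃ₐ[k] K) : RingAut K := MulSemiringAction.toRingAut (K ≃ₐ[k] K) K σ

lemma toRingAut_pow_apply (σ : K ≃ₐ[k] K) (m : ℕ) (x : K) :
    (toRingAut σ ^ m) x = (σ ^ m) x := by
  rw [toRingAut, ← map_pow]; rfl

/-- The bridge from a Galois extension with a place of ramification index p ^ n to the abstract pair
(w, τ), on which the ramification theory above is built. -/
lemma isTotallyRamifiedCyclic_of_generator [IsGalois k K] {𝔭 : ValuationSubring k}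
    (hv : IsValOf v 𝔭) (hv1 : ∃ π, v π = (1 : ℤ)) {m : ℕ} (hm : 1 ≤ m)
    (hfin : ∀ a, 0 ≤ v a → 0 < v (a ^ p ^ m - a)) {𝔓 : ValuationSubring K}
    (h𝔓 : 𝔓 ∈ placesAbove K 𝔭) (hw : IsValOf w 𝔓) (h : ExtendsVal v w (p ^ n))
    (hw1 : ∃ π, w π = (1 : ℤ)) (hN : Module.finrank k K = p ^ n) {σ : K ≃ₐ[k] K}
    (hσ : ∀ g, g ∈ Subgroup.zpowers σ) : IsTotallyRamifiedCyclic p n w (toRingAut σ) := by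
  have hp : p.Prime := Fact.out
  have hN0 : p ^ n ≠ 0 := pow_ne_zero _ hp.ne_zero
  have : FiniteDimensional k K :=
    Module.finite_of_finrank_pos (by rw [hN]; exact Nat.pos_of_ne_zero hN0)
  obtain ⟨π, hπ⟩ := hw1
  have hord : orderOf σ = p ^ n := by
    rw [orderOf_eq_card_of_forall_mem_zpowers hσ, IsGalois.card_aut_eq_finrank, hN]
  have hfix : ∀ x, σ x = x → ∃ a, algebraMap k K a = x := by
    intro x hx
    rw [← Set.mem_range, ← IntermediateField.mem_bot, IsGalois.mem_bot_iff_fixed]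
    intro g
    have : g ∈ MulAction.stabilizer (K ≃ₐ[k] K) x :=
      (Subgroup.zpowers_le.mpr (show σ ∈ MulAction.stabilizer (K ≃ₐ[k] K) x from hx)) (hσ g)
    exact this
  refine ⟨val_algEquiv_of_totallyRamified hv hv1 h𝔓 hw h hπ hN hN0 σ, ?_, ?_, ⟨π, hπ⟩, ?_, ?_, ?_⟩
  · rw [toRingAut, ← map_pow, ← hord, pow_orderOf_eq_one, map_one]
  · intro j hj heq
    have h1 : σ ^ p ^ j = 1 := by
      ext x
      rw [← toRingAut_pow_apply, heq]; rfl
    have h2 := orderOf_dvd_of_pow_eq_one h1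
    rw [hord, Nat.pow_dvd_pow_iff_le_right hp.one_lt] at h2
    omega
  · intro x hx hx0
    obtain ⟨a, rfl⟩ := hfix x hx
    have ha : a ≠ 0 := by rintro rfl; simp at hx0
    obtain ⟨r, hr⟩ := exists_val_eq v ha
    exact ⟨r, by rw [h a r hr]; push_cast; rfl⟩
  · intro x hx
    obtain ⟨c, -, hc⟩ := exists_residue_of_totallyRamified h hπ hN hN0 hx
    exact ⟨algebraMap k K c, σ.commutes c, hc⟩
  · intro u hu
    exact exists_pow_sub_self_pos hN0 h hw hm hfin hu.ge

omit [CharP K p] [Fact p.Prime] in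
lemma mem_maximalIdeal_pow_iff {𝔓 : ValuationSubring K} (hw : IsValOf w 𝔓)
    (hw1 : ∃ π, w π = (1 : ℤ)) (r : ℕ) (x : 𝔓) :
    x ∈ IsLocalRing.maximalIdeal 𝔓 ^ r ↔ ((r : ℤ) : WithTop ℤ) ≤ w x := by
  obtain ⟨π, hπ⟩ := hw1
  have hdiv : ∀ (r : ℕ) (x : 𝔓), ((r : ℤ) : WithTop ℤ) ≤ w x → ∃ y : 𝔓, (x : K) = y * π ^ r := by
    intro r x hx
    have h1 := val_div_le hx (val_pow_eq hπ r)
    refine ⟨⟨x / π ^ r, (hw _).mpr ?_⟩, ?_⟩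
    · refine le_trans ?_ h1
      simp
    · exact (div_mul_cancel₀ _ (pow_ne_zero _ (ne_zero_of_val hπ))).symm
  let ϖ : 𝔓 := ⟨π, (hw π).mpr (by rw [hπ]; norm_num)⟩
  have hmax : IsLocalRing.maximalIdeal 𝔓 = Ideal.span {ϖ} := by
    ext x
    rw [← ValuationSubring.coe_mem_nonunits_iff, hw.mem_nonunits_iff, Ideal.mem_span_singleton']
    constructor
    · intro hx
      obtain ⟨y, hy⟩ := hdiv 1 x (by
        have := (val_lt_iff (w := w) (r := 0)).mp (by exact_mod_cast hx)
        simpa using this)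
      exact ⟨y, Subtype.ext (by rw [hy, pow_one]; rfl)⟩
    · rintro ⟨y, rfl⟩
      change 0 < w (y * π)
      have := val_mul_le (w := w) (r := 0) (by exact_mod_cast (hw _).mp y.2) hπ.ge
      exact lt_of_lt_of_le (by norm_num) this
  rw [hmax, Ideal.span_singleton_pow, Ideal.mem_span_singleton']
  constructor
  · rintro ⟨y, rfl⟩
    change _ ≤ w (y * π ^ r)
    rw [AddValuation.map_mul, val_pow_eq hπ, mul_one]
    exact le_add_of_nonneg_left ((hw _).mp y.2)
  · intro hx
    obtain ⟨y, hy⟩ := hdiv r x hx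
    exact ⟨y, Subtype.ext hy.symm⟩

omit [CharP K p] [Fact p.Prime] in
lemma mem_lowerRamificationGroup_iff {𝔓 : ValuationSubring K} (hw : IsValOf w 𝔓)
    (hw1 : ∃ π, w π = (1 : ℤ)) (i : ℕ) (g : 𝔓.decompositionSubgroup k) :
    g ∈ lowerRamificationGroup k 𝔓 i ↔
      ∀ x, 0 ≤ w x → ((i + 1 : ℤ) : WithTop ℤ) ≤ w ((g : K ≃ₐ[k] K) x - x) := by
  have h1 : g ∈ lowerRamificationGroup k 𝔓 i ↔
      ∀ x : 𝔓, g • x - x ∈ IsLocalRing.maximalIdeal 𝔓 ^ (i + 1) := Iff.rfl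
  rw [h1]
  constructor
  · intro h x hx
    have := (mem_maximalIdeal_pow_iff hw hw1 _ _).mp (h ⟨x, (hw x).mpr hx⟩)
    push_cast at this
    exact_mod_cast this
  · intro h x
    rw [mem_maximalIdeal_pow_iff hw hw1]
    have := h x ((hw _).mp x.2)
    push_cast
    exact_mod_cast this

omit [CharP K p] [Fact p.Prime] in
lemma mem_decompositionSubgroup_of_val {𝔓 : ValuationSubring K} (hw : IsValOf w 𝔓)
    (hinv : ∀ (σ : K ≃ₐ[k] K) x, w (σ x) = w x) (σ : K ≃ₐ[k] K) :
    σ ∈ 𝔓.decompositionSubgroup k := by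
  rw [MulAction.mem_stabilizer_iff]
  ext x
  rw [ValuationSubring.mem_pointwise_smul_iff_inv_smul_mem, hw, hw]
  change 0 ≤ w (σ⁻¹ x) ↔ _
  rw [hinv]

section Conductor

variable {𝔓 : ValuationSubring K}

omit [CharP K p] [Fact p.Prime] in
lemma herbrand_mono : Monotone (herbrand k 𝔓) := by
  intro a b hab
  unfold herbrand
  refine div_le_div_of_nonneg_right ?_ (by positivity)
  exact Finset.sum_le_sum_of_subset_of_nonneg (Finset.Icc_subset_Icc le_rfl hab)
    (fun _ _ _ => by positivity)

omit [CharP K p] [Fact p.Prime] in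
lemma exists_le_herbrand [FiniteDimensional k K] (v : ℚ) : ∃ u, v ≤ herbrand k 𝔓 u := by
  have hpos : ∀ i, (1 : ℚ) ≤ Nat.card (lowerRamificationGroup k 𝔓 i) := by
    intro i
    exact_mod_cast Nat.card_pos
  set c := Nat.card (lowerRamificationGroup k 𝔓 0) with hc
  refine ⟨⌈v⌉₊ * c, ?_⟩
  have h0 : (0 : ℚ) < c := lt_of_lt_of_le one_pos (hpos 0)
  rw [herbrand, ← hc, le_div_iff₀ h0]
  have h1 : ∑ i ∈ Finset.Icc 1 (⌈v⌉₊ * c), (1 : ℚ) ≤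
      ∑ i ∈ Finset.Icc 1 (⌈v⌉₊ * c), (Nat.card (lowerRamificationGroup k 𝔓 i) : ℚ) :=
    Finset.sum_le_sum fun i _ => hpos i
  rw [Finset.sum_const, Nat.card_Icc, Nat.add_sub_cancel, nsmul_eq_mul, mul_one] at h1
  refine le_trans ?_ h1
  push_cast
  exact mul_le_mul_of_nonneg_right (Nat.le_ceil v) h0.le

-- Each nontrivial automorphism moves some integral element by a finite value, and the group is
-- finite, so one bound serves all of them.
omit [CharP K p] [Fact p.Prime] in
lemma exists_lowerRamificationGroup_eq_bot [FiniteDimensional k K] (hw : IsValOf w 𝔓)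
    (hw1 : ∃ π, w π = (1 : ℤ)) : ∃ s, ∀ u, s ≤ u → lowerRamificationGroup k 𝔓 u = ⊥ := by
  have hex : ∀ g : 𝔓.decompositionSubgroup k, ∃ s : ℕ, ∀ u, s ≤ u →
      g ∈ lowerRamificationGroup k 𝔓 u → g = 1 := by
    intro g
    by_cases hg : g = 1
    · exact ⟨0, fun _ _ _ => hg⟩
    have : ∃ x, 0 ≤ w x ∧ (g : K ≃ₐ[k] K) x ≠ x := by
      by_contra! hall
      apply hg
      ext x
      change (g : K ≃ₐ[k] K) x = x
      rcases 𝔓.mem_or_inv_mem x with hx | hx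
      · exact hall x ((hw x).mp hx)
      · have := hall _ ((hw _).mp hx)
        rw [map_inv₀] at this
        exact inv_injective this
    obtain ⟨x, hx, hgx⟩ := this
    obtain ⟨r, hr⟩ := exists_val_eq w (sub_ne_zero.mpr hgx)
    refine ⟨r.toNat, fun u hu hmem => ?_⟩
    have h1 := (mem_lowerRamificationGroup_iff hw hw1 u g).mp hmem x hx
    rw [hr] at h1
    have : (u + 1 : ℤ) ≤ r := by exact_mod_cast h1
    omega
  choose s hs using hex
  obtain ⟨B, hB⟩ := (Set.finite_range s).bddAbove
  refine ⟨B, fun u hu => ?_⟩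
  rw [Subgroup.eq_bot_iff_forall]
  exact fun g hg => hs g u ((hB ⟨g, rfl⟩).trans hu) hg

omit [CharP K p] [Fact p.Prime] in
/-- If an element `≠ 1` lies in the `b`-th lower ramification group, the conductor exponent is
larger than `herbrand b`. -/
lemma herbrand_lt_of_conductor_le [FiniteDimensional k K] {𝔭 : ValuationSubring k}
    (h𝔓 : 𝔓 ∈ placesAbove K 𝔭) (huniq : ∀ 𝔓' ∈ placesAbove K 𝔭, 𝔓' = 𝔓)
    (hw : IsValOf w 𝔓) (hw1 : ∃ π, w π = (1 : ℤ)) {α b : ℕ} (hα : conductor K 𝔭 ≤ α)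
    {g : 𝔓.decompositionSubgroup k} (hg1 : g ≠ 1)
    (hg : ∀ s ≤ b, g ∈ lowerRamificationGroup k 𝔓 s) : herbrand k 𝔓 b < α := by
  -- The infimum of the empty set is 0 by convention, so the conductor is meaningful only once some
  -- upper group is known to be trivial.
  have hne : {m : ℕ | ∀ 𝔓 ∈ placesAbove K 𝔭, upperRamificationGroup k 𝔓 m = ⊥}.Nonempty := by
    obtain ⟨s, hs⟩ := exists_lowerRamificationGroup_eq_bot (k := k) hw hw1
    refine ⟨⌈herbrand k 𝔓 s⌉₊ + 1, fun 𝔓' h' => ?_⟩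
    rw [huniq 𝔓' h']
    have hmem := Nat.sInf_mem (s := {u : ℕ | ((⌈herbrand k 𝔓 s⌉₊ + 1 : ℕ) : ℚ) ≤ herbrand k 𝔓 u})
      (exists_le_herbrand _)
    refine hs _ ?_
    by_contra! hlt
    have h1 := herbrand_mono (k := k) (𝔓 := 𝔓) hlt.le
    have h2 := Nat.le_ceil (herbrand k 𝔓 s)
    have h3 := le_trans hmem h1
    push_cast at h3
    linarith
  have hmem := Nat.sInf_mem hne 𝔓 h𝔓
  change upperRamificationGroup k 𝔓 (conductor K 𝔭) = ⊥ at hmem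
  have hlt : herbrand k 𝔓 b < conductor K 𝔭 := by
    by_contra! hle
    have h1 : sInf {u : ℕ | ((conductor K 𝔭 : ℕ) : ℚ) ≤ herbrand k 𝔓 u} ≤ b := Nat.sInf_le hle
    have h2 := hg _ h1
    change g ∈ upperRamificationGroup k 𝔓 (conductor K 𝔭) at h2
    rw [hmem, Subgroup.mem_bot] at h2
    exact hg1 h2
  exact hlt.trans_le (by exact_mod_cast hα)

end Conductor

/-- In a fully ramified cyclic extension of degree `p ^ n` and conductor exponent at most `α`, an
element of the base field of pole order `≥ α` prime to `p` has, modulo the image of the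
Artin–Schreier map on the penultimate layer, a larger reduced pole order than any Artin–Schreier
generator. -/
lemma exists_reduced_of_conductor_le [IsGalois k K] (hn : 1 ≤ n) {𝔭 : ValuationSubring k}
    (hv : IsValOf v 𝔭) (hv1 : ∃ π, v π = (1 : ℤ)) {m : ℕ} (hm : 1 ≤ m)
    (hfin : ∀ a, 0 ≤ v a → 0 < v (a ^ p ^ m - a)) {𝔓 : ValuationSubring K}
    (h𝔓 : 𝔓 ∈ placesAbove K 𝔭) (hw : IsValOf w 𝔓) (h : ExtendsVal v w (p ^ n))
    (hw1 : ∃ π, w π = (1 : ℤ)) (hN : Module.finrank k K = p ^ n) {σ : K ≃ₐ[k] K}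
    (hσ : ∀ g, g ∈ Subgroup.zpowers σ) (hram : IsFullyRamified K 𝔭) {α : ℕ}
    (hα : conductor K 𝔭 ≤ α) {a : k} {lam : ℤ} (hlam : ¬ (p : ℤ) ∣ lam) (hle : (α : ℤ) ≤ lam)
    (ha : v a = (-lam : ℤ)) {z : K}
    (hz : (σ ^ p ^ (n - 1)) (artinSchreier p z) = artinSchreier p z) :
    ∃ (x y : K) (L : ℤ), (σ ^ p ^ (n - 1)) x = x ∧ (σ ^ p ^ (n - 1)) y = y ∧ ¬ (p : ℤ) ∣ L ∧
      0 < L ∧ w (algebraMap k K a - artinSchreier p x) = (-(p * L) : ℤ) ∧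
      ((-(p * L) : ℤ) : WithTop ℤ) < w (artinSchreier p z - artinSchreier p y) := by
  have hp : p.Prime := Fact.out
  have hN0 : p ^ n ≠ 0 := pow_ne_zero _ hp.ne_zero
  have : FiniteDimensional k K :=
    Module.finite_of_finrank_pos (by rw [hN]; exact Nat.pos_of_ne_zero hN0)
  have hcyc := isTotallyRamifiedCyclic_of_generator hv hv1 hm hfin h𝔓 hw h hw1 hN hσ
  have hinv : ∀ (g : K ≃ₐ[k] K) x, w (g x) = w x := by
    obtain ⟨π, hπ⟩ := hw1
    exact fun g => val_algEquiv_of_totallyRamified hv hv1 h𝔓 hw h hπ hN hN0 g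
  have hord : orderOf σ = p ^ n := by
    rw [orderOf_eq_card_of_forall_mem_zpowers hσ, IsGalois.card_aut_eq_finrank, hN]
  obtain ⟨b, hb, hmain⟩ := hcyc.exists_last_break hn
  let d : 𝔓.decompositionSubgroup k := ⟨σ, mem_decompositionSubgroup_of_val hw hinv σ⟩
  have hdord : orderOf d = p ^ n := by rw [← hord, Subgroup.orderOf_mk]
  have hdmem : ∀ j i : ℕ, (∀ x, 0 ≤ w x →
      ((i + 1 : ℤ) : WithTop ℤ) ≤ w ((toRingAut σ ^ p ^ j) x - x)) →
      d ^ p ^ j ∈ lowerRamificationGroup k 𝔓 i := by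
    intro j i hi
    rw [mem_lowerRamificationGroup_iff hw hw1]
    intro x hx
    have := hi x hx
    rw [toRingAut_pow_apply] at this
    exact this
  have hherb := herbrand_lt_of_conductor_le h𝔓
    (fun 𝔓' h' => place_unique_of_totallyRamified hv hv1 (hN ▸ hN0) hram h' h𝔓) hw hw1 hα
    (g := d ^ p ^ (n - 1)) (b := b) (by
      intro h1
      have h2 := orderOf_dvd_of_pow_eq_one h1
      rw [hdord, Nat.pow_dvd_pow_iff_le_right hp.one_lt] at h2
      omega)
    (fun s hs => hdmem _ _ fun x hx => le_trans (by rw [WithTop.coe_le_coe]; omega) (hb x hx))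
  -- This is herbrand(b) < α ≤ lam cleared of denominators; only |G_0| ≤ p ^ n is used, not
  -- equality.
  have hsum : ∑ i ∈ Finset.Icc 1 b, (Nat.card (lowerRamificationGroup k 𝔓 i) : ℤ) <
      p ^ n * lam := by
    have h0 : (0 : ℚ) < Nat.card (lowerRamificationGroup k 𝔓 0) := by exact_mod_cast Nat.card_pos
    have h1 : (Nat.card (lowerRamificationGroup k 𝔓 0) : ℚ) ≤ p ^ n := by
      have h2 : Nat.card (lowerRamificationGroup k 𝔓 0) ≤ Nat.card (K ≃ₐ[k] K) :=
        (Subgroup.card_le_card_group _).trans (Subgroup.card_le_card_group _)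
      rw [IsGalois.card_aut_eq_finrank, hN] at h2
      exact_mod_cast h2
    rw [herbrand, div_lt_iff₀ h0] at hherb
    have h3 : (α : ℚ) * Nat.card (lowerRamificationGroup k 𝔓 0) ≤ α * p ^ n :=
      mul_le_mul_of_nonneg_left h1 (by positivity)
    have h4 : ∑ i ∈ Finset.Icc 1 b, (Nat.card (lowerRamificationGroup k 𝔓 i) : ℤ) <
        α * p ^ n := by
      exact_mod_cast hherb.trans_le h3
    have h5 : (α : ℤ) * p ^ n ≤ lam * p ^ n := mul_le_mul_of_nonneg_right hle (by positivity)
    linarith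
  -- If σ ^ p ^ j lies in G_i, so does the group of order p ^ (n - j) that it generates; this is the
  -- required lower bound for |G_i|.
  have := hmain (fun i => Nat.card (lowerRamificationGroup k 𝔓 i)) (by
      intro j hj i hi
      have h1 : Subgroup.zpowers (d ^ p ^ j) ≤ lowerRamificationGroup k 𝔓 i :=
        Subgroup.zpowers_le.mpr (hdmem j i hi)
      have h2 := Subgroup.card_le_of_le h1
      rw [Nat.card_zpowers, orderOf_pow, hdord, Nat.gcd_eq_right (pow_dvd_pow p hj.le),
        Nat.pow_div hj.le hp.pos] at h2
      exact h2) (algebraMap k K a) lam (σ.commutes a) hlam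
    (by rw [h a _ ha, show ((p ^ n : ℕ) : ℤ) * -lam = -(p ^ n * lam) by push_cast; ring])
    hsum z (by rw [toRingAut_pow_apply]; exact hz)
  simpa only [toRingAut_pow_apply] using this

end Cyclic

/-! ### From multiplicative to additive valuations -/

section AdditiveVersion

open WithZero

variable {K : Type*} [Field K]

open Classical in
/-- The additive version of a valuation with values in `ℤᵐ⁰`. -/
def additiveVal (V : Valuation K ℤᵐ⁰) : AddValuation K (WithTop ℤ) :=
  AddValuation.of (fun x => if x = 0 then ⊤ else ((-log (V x) : ℤ) : WithTop ℤ)) (if_pos rfl)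
    (by simp)
    (by
      intro x y
      by_cases hx : x = 0
      · simp [hx]
      by_cases hy : y = 0
      · simp [hy]
      by_cases hxy : x + y = 0
      · simp [hxy]
      rw [if_neg hx, if_neg hy, if_neg hxy, ← WithTop.coe_min, WithTop.coe_le_coe, min_neg_neg,
        neg_le_neg_iff]
      have hVx : V x ≠ 0 := by simpa using hx
      have hVy : V y ≠ 0 := by simpa using hy
      have hVxy : V (x + y) ≠ 0 := by simpa using hxy
      rcases le_max_iff.mp (V.map_add x y) with h | h
      · exact le_max_of_le_left ((log_le_log hVxy hVx).mpr h)
      · exact le_max_of_le_right ((log_le_log hVxy hVy).mpr h))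
    (by
      intro x y
      by_cases hx : x = 0
      · simp [hx]
      by_cases hy : y = 0
      · simp [hy]
      rw [if_neg hx, if_neg hy, if_neg (mul_ne_zero hx hy), map_mul, log_mul (by simpa) (by simpa)]
      norm_cast
      ring_nf)

lemma additiveVal_eq_iff {V : Valuation K ℤᵐ⁰} {x : K} {r : ℤ} :
    additiveVal V x = r ↔ V x = exp (-r) := by
  classical
  change (if x = 0 then ⊤ else ((-log (V x) : ℤ) : WithTop ℤ)) = r ↔ _
  by_cases hx : x = 0
  · simp only [hx, if_true, map_zero, WithTop.top_ne_coe, false_iff]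
    exact exp_ne_zero.symm
  rw [if_neg hx]
  have hV : V x ≠ 0 := by simpa using hx
  norm_cast
  constructor
  · rintro rfl; simp [hV]
  · intro h; rw [h]; simp

lemma isValOf_additiveVal (V : Valuation K ℤᵐ⁰) : IsValOf (additiveVal V) V.valuationSubring := by
  intro x
  rw [Valuation.mem_valuationSubring_iff]
  by_cases hx : x = 0
  · simp [hx]
  obtain ⟨r, hr⟩ := exists_val_eq (additiveVal V) hx
  rw [hr, additiveVal_eq_iff.mp hr, ← exp_zero, exp_le_exp]
  norm_cast
  omega

end AdditiveVersion

/-! ### Finite places of F(T) -/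

section FinitePlaces

variable {F : Type*} [Field F] {Q : F[X]} (hQ : Irreducible Q)

/-- The additive valuation of `F(T)` given by an irreducible polynomial. -/
def finiteVal : AddValuation (RatFunc F) (WithTop ℤ) :=
  additiveVal ((HeightOneSpectrum.ofPrime
    (Ideal.prime_span_singleton_iff.mpr hQ.prime)).valuation (RatFunc F))

lemma isValOf_finiteVal : IsValOf (finiteVal hQ) (finitePlace hQ) := isValOf_additiveVal _

lemma finiteVal_self : finiteVal hQ (algebraMap F[X] (RatFunc F) Q) = (1 : ℤ) := by
  rw [finiteVal, additiveVal_eq_iff, HeightOneSpectrum.valuation_of_algebraMap]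
  exact HeightOneSpectrum.intValuation_singleton _ hQ.ne_zero rfl

lemma finiteVal_pow (m : ℕ) : finiteVal hQ (algebraMap F[X] (RatFunc F) Q ^ m) = (m : ℤ) := by
  simpa using val_pow_eq (finiteVal_self hQ) m

lemma algebraMap_mem_finitePlace (f : F[X]) : algebraMap F[X] (RatFunc F) f ∈ finitePlace hQ := by
  rw [finitePlace, Valuation.mem_valuationSubring_iff]
  exact HeightOneSpectrum.valuation_le_one _ f

lemma finiteVal_nonneg (f : F[X]) : 0 ≤ finiteVal hQ (algebraMap F[X] (RatFunc F) f) :=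
  (isValOf_finiteVal hQ _).mp (algebraMap_mem_finitePlace hQ f)

lemma finiteVal_pos {f : F[X]} (h : Q ∣ f) : 0 < finiteVal hQ (algebraMap F[X] (RatFunc F) f) := by
  obtain ⟨g, rfl⟩ := h
  rw [map_mul, AddValuation.map_mul, finiteVal_self]
  have := finiteVal_nonneg hQ g
  calc (0 : WithTop ℤ) < ((1 : ℤ) : WithTop ℤ) + 0 := by simp
    _ ≤ _ := add_le_add le_rfl this

lemma finiteVal_eq_zero {f : F[X]} (h : ¬ Q ∣ f) :
    finiteVal hQ (algebraMap F[X] (RatFunc F) f) = (0 : ℤ) := by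
  rw [finiteVal, additiveVal_eq_iff, neg_zero, WithZero.exp_zero,
    HeightOneSpectrum.valuation_eq_one_iff_notMem]
  change f ∉ Ideal.span {Q}
  rwa [Ideal.mem_span_singleton]

lemma div_mem_finitePlace (f : F[X]) {g : F[X]} (hg : ¬ Q ∣ g) :
    algebraMap F[X] (RatFunc F) f / algebraMap F[X] (RatFunc F) g ∈ finitePlace hQ := by
  rw [isValOf_finiteVal]
  have h := val_div_le (w := finiteVal hQ) (r := 0) (finiteVal_nonneg hQ f)
    (finiteVal_eq_zero hQ hg)
  simpa using h

lemma exists_eq_div_of_mem_finitePlace {x : RatFunc F} (hx : x ∈ finitePlace hQ) :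
    ∃ f g : F[X], ¬ Q ∣ g ∧ x = algebraMap F[X] (RatFunc F) f / algebraMap F[X] (RatFunc F) g := by
  refine ⟨x.num, x.denom, fun h => ?_, x.num_div_denom.symm⟩
  have hnum : ¬ Q ∣ x.num := fun h' =>
    hQ.not_isUnit (x.isCoprime_num_denom.isUnit_of_dvd' h' h)
  have h0 : x * algebraMap F[X] (RatFunc F) x.denom = algebraMap F[X] (RatFunc F) x.num := by
    have hne : algebraMap F[X] (RatFunc F) x.denom ≠ 0 := by simpa using x.denom_ne_zero
    rw [eq_comm, ← div_eq_iff hne, x.num_div_denom]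
  have h1 := finiteVal_eq_zero hQ hnum
  rw [← h0, AddValuation.map_mul] at h1
  have h2 : 0 < finiteVal hQ x + finiteVal hQ (algebraMap F[X] (RatFunc F) x.denom) :=
    (finiteVal_pos hQ h).trans_le (le_add_of_nonneg_left ((isValOf_finiteVal hQ x).mp hx))
  simp [h1] at h2

lemma finitePlace_ne_top : finitePlace hQ ≠ ⊤ := by
  intro h
  have h1 : (algebraMap F[X] (RatFunc F) Q)⁻¹ ∈ finitePlace hQ := by rw [h]; trivial
  rw [isValOf_finiteVal, val_inv_eq (finiteVal_self hQ)] at h1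
  norm_cast at h1

include hQ in
lemma not_dvd_pow_of_ne {P : F[X]} (hP : Irreducible P) (hPm : P.Monic) (hQm : Q.Monic)
    (hne : Q ≠ P) (m : ℕ) : ¬ Q ∣ P ^ m := by
  intro h
  have := (hP.dvd_iff.mp (hQ.prime.dvd_of_dvd_pow h)).resolve_left hQ.not_isUnit
  exact hne (eq_of_monic_of_associated hQm hPm this.symm)

lemma finitePlace_ne {P : F[X]} (hP : Irreducible P) (hPm : P.Monic) (hQm : Q.Monic)
    (hne : Q ≠ P) : finitePlace hQ ≠ finitePlace hP := by
  intro h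
  have h1 : ¬ Q ∣ P := by simpa using not_dvd_pow_of_ne hQ hP hPm hQm hne 1
  have h2 := div_mem_finitePlace hQ 1 h1
  rw [h, isValOf_finiteVal, map_one, one_div, val_inv_eq (finiteVal_self hP)] at h2
  norm_cast at h2

/-- A partial fraction decomposition at a single prime. -/
lemma exists_principalPart {a : RatFunc F} {m : ℕ} (ha : (-m : ℤ) ≤ finiteVal hQ a) :
    ∃ r : F[X], r.degree < (Q ^ m).degree ∧
      a - algebraMap F[X] (RatFunc F) r / algebraMap F[X] (RatFunc F) (Q ^ m) ∈ finitePlace hQ := by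
  have hQ0 : algebraMap F[X] (RatFunc F) Q ≠ 0 := by simpa using hQ.ne_zero
  have h1 : algebraMap F[X] (RatFunc F) Q ^ m * a ∈ finitePlace hQ := by
    rw [isValOf_finiteVal]
    have := val_mul_le (finiteVal_pow hQ m).ge ha
    simpa using this
  obtain ⟨f, g, hg, hfg⟩ := exists_eq_div_of_mem_finitePlace hQ h1
  have hg0 : algebraMap F[X] (RatFunc F) g ≠ 0 := by
    simp only [ne_eq, FaithfulSMul.algebraMap_eq_zero_iff]
    rintro rfl; exact hg (dvd_zero Q)
  have hcop : IsCoprime (Q ^ m) g := (hQ.coprime_iff_not_dvd.mpr hg).pow_left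
  obtain ⟨u, v, huv⟩ := hcop
  -- From u Q ^ m + v g = 1 one gets f / (g Q ^ m) = f u / g + f v / Q ^ m; reducing f v modulo Q ^
  -- m changes the last term by a polynomial.
  refine ⟨(f * v) % Q ^ m, EuclideanDomain.mod_lt _ (pow_ne_zero _ hQ.ne_zero), ?_⟩
  have h2 := EuclideanDomain.div_add_mod (f * v) (Q ^ m)
  have h3 : a - algebraMap F[X] (RatFunc F) ((f * v) % Q ^ m) / algebraMap F[X] (RatFunc F) (Q ^ m)
      = algebraMap F[X] (RatFunc F) (f * u + ((f * v) / Q ^ m) * g) /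
        algebraMap F[X] (RatFunc F) g := by
    have h4 : a = algebraMap F[X] (RatFunc F) f /
        (algebraMap F[X] (RatFunc F) g * algebraMap F[X] (RatFunc F) Q ^ m) := by
      rw [← div_div, ← hfg]; field_simp
    have h5 : f = (f * u + ((f * v) / Q ^ m) * g) * Q ^ m + ((f * v) % Q ^ m) * g := by
      linear_combination (-f) * huv + (-g) * h2
    have h6 := congrArg (algebraMap F[X] (RatFunc F)) h5
    simp only [map_add, map_mul, map_pow] at h6
    rw [h4, map_pow, div_sub_div _ _ (mul_ne_zero hg0 (pow_ne_zero _ hQ0)) (pow_ne_zero _ hQ0),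
      div_eq_div_iff (mul_ne_zero (mul_ne_zero hg0 (pow_ne_zero _ hQ0)) (pow_ne_zero _ hQ0)) hg0]
    simp only [map_add, map_mul]
    linear_combination (algebraMap F[X] (RatFunc F) g * algebraMap F[X] (RatFunc F) Q ^ m) * h6
  rw [h3]
  exact div_mem_finitePlace hQ _ hg

/-- The residue field F[T] / (Q) is finite, so x ^ p ^ m = x on it when it has p ^ m elements. -/
lemma exists_pow_sub_self_pos_finiteVal [Finite F] (p : ℕ) [Fact p.Prime] [CharP F p] :
    ∃ m, 1 ≤ m ∧ ∀ a, 0 ≤ finiteVal hQ a → 0 < finiteVal hQ (a ^ p ^ m - a) := by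
  let R := F[X] ⧸ Ideal.span {Q}
  have : (Ideal.span {Q}).IsMaximal := PrincipalIdealRing.isMaximal_of_irreducible hQ
  let _ : Field R := Ideal.Quotient.field _
  have : Module.Finite F R := (AdjoinRoot.powerBasis hQ.ne_zero).finite
  have : Finite R := Module.finite_of_finite F
  let _ := Fintype.ofFinite R
  have : CharP R p := charP_of_injective_algebraMap (algebraMap F R).injective p
  obtain ⟨m, -, hm⟩ := FiniteField.card R p
  refine ⟨m, m.pos, fun a ha => ?_⟩
  obtain ⟨f, g, hg, rfl⟩ := exists_eq_div_of_mem_finitePlace hQ ((isValOf_finiteVal hQ a).mpr ha)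
  have hg0 : algebraMap F[X] (RatFunc F) g ≠ 0 := by
    simp only [ne_eq, FaithfulSMul.algebraMap_eq_zero_iff]
    rintro rfl; exact hg (dvd_zero Q)
  have hdvd : ∀ h : F[X], Ideal.Quotient.mk (Ideal.span {Q}) (h ^ p ^ (m : ℕ)) =
      Ideal.Quotient.mk (Ideal.span {Q}) h := by
    intro h
    rw [map_pow, ← hm]
    exact FiniteField.pow_card (K := R) _
  have h1 : Q ∣ f ^ p ^ (m : ℕ) * g - f * g ^ p ^ (m : ℕ) := by
    rw [← Ideal.mem_span_singleton, ← Ideal.Quotient.eq, map_mul, map_mul, hdvd, hdvd]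
  have h2 : (algebraMap F[X] (RatFunc F) f / algebraMap F[X] (RatFunc F) g) ^ p ^ (m : ℕ) -
      algebraMap F[X] (RatFunc F) f / algebraMap F[X] (RatFunc F) g =
      algebraMap F[X] (RatFunc F) (f ^ p ^ (m : ℕ) * g - f * g ^ p ^ (m : ℕ)) /
        algebraMap F[X] (RatFunc F) (g ^ p ^ (m : ℕ) * g) := by
    simp only [map_sub, map_mul, map_pow]
    rw [div_pow, div_sub_div _ _ (pow_ne_zero _ hg0) hg0]
    ring_nf
  have h3 : ¬ Q ∣ g ^ p ^ (m : ℕ) * g := by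
    rw [← pow_succ]; exact fun h => hg (hQ.prime.dvd_of_dvd_pow h)
  rw [h2, div_eq_mul_inv, AddValuation.map_mul, val_inv_eq (finiteVal_eq_zero hQ h3)]
  simpa using finiteVal_pos hQ h1

end FinitePlaces

/-! ### The infinite place of F(T) -/

section InfinitePlace

variable {F : Type*} [Field F]

variable (F) in
open Classical in
/-- The additive valuation of `F(T)` at infinity. -/
def inftyVal : AddValuation (RatFunc F) (WithTop ℤ) := additiveVal (RatFunc.inftyValuation F)

variable (F) in
lemma isValOf_inftyVal : IsValOf (inftyVal F) (infinitePlace F) := isValOf_additiveVal _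

lemma inftyVal_eq {x : RatFunc F} (hx : x ≠ 0) : inftyVal F x = (-x.intDegree : ℤ) := by
  classical
  rw [inftyVal, additiveVal_eq_iff, neg_neg, RatFunc.inftyValuation_apply]
  exact RatFunc.inftyValuation_of_nonzero F hx

lemma div_mem_nonunits_infinitePlace_iff {f g : F[X]} (hg : g ≠ 0) :
    algebraMap F[X] (RatFunc F) f / algebraMap F[X] (RatFunc F) g ∈ (infinitePlace F).nonunits ↔
      f.degree < g.degree := by
  rw [(isValOf_inftyVal F).mem_nonunits_iff]
  by_cases hf : f = 0
  · simp [hf, bot_lt_iff_ne_bot, hg]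
  have hf' : algebraMap F[X] (RatFunc F) f ≠ 0 := by simpa using hf
  have hg' : algebraMap F[X] (RatFunc F) g ≠ 0 := by simpa using hg
  rw [inftyVal_eq (div_ne_zero hf' hg'), RatFunc.intDegree_div hf' hg',
    RatFunc.intDegree_polynomial, RatFunc.intDegree_polynomial, degree_eq_natDegree hf,
    degree_eq_natDegree hg, Nat.cast_lt, ← WithTop.coe_zero, WithTop.coe_lt_coe]
  omega

lemma exists_polynomial_sub_mem_nonunits (x : RatFunc F) :
    ∃ f : F[X], x - algebraMap F[X] (RatFunc F) f ∈ (infinitePlace F).nonunits := by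
  refine ⟨x.num / x.denom, ?_⟩
  have h := congrArg (algebraMap F[X] (RatFunc F)) (EuclideanDomain.div_add_mod x.num x.denom)
  have hne : algebraMap F[X] (RatFunc F) x.denom ≠ 0 := by simpa using x.denom_ne_zero
  have h1 : x - algebraMap F[X] (RatFunc F) (x.num / x.denom) =
      algebraMap F[X] (RatFunc F) (x.num % x.denom) / algebraMap F[X] (RatFunc F) x.denom := by
    rw [map_add, map_mul] at h
    rw [eq_div_iff hne, sub_mul]
    nth_rewrite 1 [← x.num_div_denom]
    rw [div_mul_cancel₀ _ hne]
    linear_combination -h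
  rw [h1, div_mem_nonunits_infinitePlace_iff x.denom_ne_zero]
  exact EuclideanDomain.mod_lt _ x.denom_ne_zero

end InfinitePlace

/-! ### Polar parts and global normalization modulo ℘ -/

section PolarParts

variable {F : Type*} [Field F] {P : F[X]}

/-- The additive group of the rational functions `g / P ^ m` with `deg g < deg P ^ m`. -/
def polarParts (P : F[X]) (m : ℕ) : AddSubgroup (RatFunc F) :=
  (degreeLT F (P ^ m).natDegree).toAddSubgroup.map
    ((AddMonoidHom.mulRight (algebraMap F[X] (RatFunc F) (P ^ m))⁻¹).comp
      (algebraMap F[X] (RatFunc F)).toAddMonoidHom)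

lemma mem_polarParts (hP : P ≠ 0) {m : ℕ} {a : RatFunc F} :
    a ∈ polarParts P m ↔ ∃ g : F[X], g.degree < (P ^ m).degree ∧
      a = algebraMap F[X] (RatFunc F) g / algebraMap F[X] (RatFunc F) (P ^ m) := by
  rw [polarParts, AddSubgroup.mem_map]
  simp only [Submodule.mem_toAddSubgroup, mem_degreeLT, degree_eq_natDegree (pow_ne_zero m hP),
    div_eq_mul_inv]
  exact exists_congr fun g => and_congr Iff.rfl eq_comm

lemma natCard_polarParts (hP : P ≠ 0) (m : ℕ) :
    Nat.card (polarParts P m) = Nat.card F ^ (P.natDegree * m) := by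
  have hinj : Function.Injective
      ((AddMonoidHom.mulRight (algebraMap F[X] (RatFunc F) (P ^ m))⁻¹).comp
      (algebraMap F[X] (RatFunc F)).toAddMonoidHom) := by
    intro f g hfg
    have hne : (algebraMap F[X] (RatFunc F) (P ^ m))⁻¹ ≠ 0 := by simpa using fun h => absurd h hP
    exact RatFunc.algebraMap_injective F (mul_right_cancel₀ hne hfg)
  rw [polarParts, ← Nat.card_congr ((degreeLT F (P ^ m).natDegree).toAddSubgroup.equivMapOfInjective
    _ hinj).toEquiv]
  change Nat.card (degreeLT F (P ^ m).natDegree) = _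
  rw [Nat.card_congr (degreeLTEquiv F _).toEquiv, Nat.card_fun, Nat.card_fin, natDegree_pow,
    mul_comm]

lemma finite_polarParts [Finite F] (hP : P ≠ 0) (m : ℕ) : Finite (polarParts P m) := by
  refine Nat.finite_of_card_ne_zero ?_
  rw [natCard_polarParts hP]
  exact pow_ne_zero _ Nat.card_pos.ne'

lemma exists_monic_irreducible_dvd {f : F[X]} (hf : f.degree ≠ 0) :
    ∃ Q : F[X], Q.Monic ∧ Irreducible Q ∧ Q ∣ f :=
  exists_monic_irreducible_factor f (fun h => hf (isUnit_iff_degree_eq_zero.mp h))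

/-- a P ^ m has no finite pole, so it is a polynomial; the vanishing of a at infinity is the degree
condition. -/
lemma mem_polarParts_of_val (hPm : P.Monic) (hP : Irreducible P) {m : ℕ} {a : RatFunc F}
    (hfin : ∀ (Q : F[X]) (hQ : Irreducible Q), Q.Monic → Q ≠ P → a ∈ finitePlace hQ)
    (hPa : (-m : ℤ) ≤ finiteVal hP a) (hinf : a ∈ (infinitePlace F).nonunits) :
    a ∈ polarParts P m := by
  have hP0 : algebraMap F[X] (RatFunc F) (P ^ m) ≠ 0 := by simpa using fun h => absurd h hP.ne_zero
  set b := a * algebraMap F[X] (RatFunc F) (P ^ m) with hb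
  have hbQ : ∀ (Q : F[X]) (hQ : Irreducible Q), Q.Monic → b ∈ finitePlace hQ := by
    intro Q hQ hQm
    by_cases hQP : Q = P
    · subst hQP
      rw [isValOf_finiteVal, hb, map_pow]
      have := val_mul_le hPa (finiteVal_pow hQ m).ge
      simpa using this
    · exact mul_mem (hfin Q hQ hQm hQP) (algebraMap_mem_finitePlace hQ _)
  have hdenom : b.denom = 1 := by
    refine eq_one_of_monic_natDegree_zero b.monic_denom ?_
    by_contra hne
    obtain ⟨Q, hQm, hQ, hQd⟩ := exists_monic_irreducible_dvd (f := b.denom) (fun h => hne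
      (natDegree_eq_of_degree_eq_some h))
    have hnum : ¬ Q ∣ b.num := fun h' =>
      hQ.not_isUnit (b.isCoprime_num_denom.isUnit_of_dvd' h' hQd)
    have h0 : b * algebraMap F[X] (RatFunc F) b.denom = algebraMap F[X] (RatFunc F) b.num := by
      have hne : algebraMap F[X] (RatFunc F) b.denom ≠ 0 := by simpa using b.denom_ne_zero
      rw [eq_comm, ← div_eq_iff hne, b.num_div_denom]
    have h1 := finiteVal_eq_zero hQ hnum
    rw [← h0, AddValuation.map_mul] at h1
    have h2 : 0 < finiteVal hQ b + finiteVal hQ (algebraMap F[X] (RatFunc F) b.denom) :=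
      (finiteVal_pos hQ hQd).trans_le
        (le_add_of_nonneg_left ((isValOf_finiteVal hQ b).mp (hbQ Q hQ hQm)))
    simp [h1] at h2
  have hab : a = algebraMap F[X] (RatFunc F) b.num / algebraMap F[X] (RatFunc F) (P ^ m) := by
    rw [eq_div_iff hP0, ← hb]
    nth_rewrite 1 [← b.num_div_denom]
    rw [hdenom, map_one, div_one]
  rw [mem_polarParts hP.ne_zero]
  refine ⟨b.num, ?_, hab⟩
  rw [hab, div_mem_nonunits_infinitePlace_iff (pow_ne_zero m hP.ne_zero)] at hinf
  exact hinf

lemma polarParts_mem_nonunits (hP : P ≠ 0) {m : ℕ} {a : RatFunc F} (ha : a ∈ polarParts P m) :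
    a ∈ (infinitePlace F).nonunits := by
  obtain ⟨g, hg, rfl⟩ := (mem_polarParts hP).mp ha
  exact (div_mem_nonunits_infinitePlace_iff (pow_ne_zero m hP)).mpr hg

lemma polarParts_mem_finitePlace (hPm : P.Monic) (hP : Irreducible P) {m : ℕ} {a : RatFunc F}
    (ha : a ∈ polarParts P m) {Q : F[X]} (hQ : Irreducible Q) (hQm : Q.Monic) (hne : Q ≠ P) :
    a ∈ finitePlace hQ := by
  obtain ⟨g, -, rfl⟩ := (mem_polarParts hP.ne_zero).mp ha
  exact div_mem_finitePlace hQ g (not_dvd_pow_of_ne hQ hP hPm hQm hne m)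

lemma le_finiteVal_of_mem_polarParts (hP : Irreducible P) {m : ℕ} {a : RatFunc F}
    (ha : a ∈ polarParts P m) : (-m : ℤ) ≤ finiteVal hP a := by
  obtain ⟨g, -, rfl⟩ := (mem_polarParts hP.ne_zero).mp ha
  rw [map_pow]
  have := val_div_le (w := finiteVal hP) (r := 0) (finiteVal_nonneg hP g) (finiteVal_pow hP m)
  simpa using this

variable (p : ℕ) [Fact p.Prime]

lemma artinSchreier_mem_nonunits {K : Type*} [Field K] {A : ValuationSubring K}
    {x : K} (hx : x ∈ A.nonunits) : artinSchreier p x ∈ A.nonunits := by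
  rw [ValuationSubring.mem_nonunits_iff] at hx ⊢
  refine A.valuation.map_sub_lt ?_ hx
  rw [map_pow]
  exact pow_lt_one₀ zero_le hx (Fact.out : p.Prime).ne_zero

lemma artinSchreier_mem_polarParts (hPm : P.Monic) (hP : Irreducible P) {m s : ℕ} (hsm : p * s ≤ m)
    {u : RatFunc F} (hu : u ∈ polarParts P s) : artinSchreier p u ∈ polarParts P m := by
  refine mem_polarParts_of_val hPm hP (fun Q hQ hQm hne => ?_) ?_ ?_
  · have := polarParts_mem_finitePlace hPm hP hu hQ hQm hne
    exact sub_mem (pow_mem this p) this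
  · have h := le_finiteVal_of_mem_polarParts hP hu
    have hp : 1 < p := (Fact.out : p.Prime).one_lt
    by_cases h0 : u = 0
    · simp [h0, artinSchreier_zero]
    obtain ⟨r, hr⟩ := exists_val_eq (finiteVal hP) h0
    rw [hr] at h
    have hr' : -(s : ℤ) ≤ r := by exact_mod_cast h
    rcases lt_or_ge r 0 with hr0 | hr0
    · rw [val_artinSchreier_of_neg hr hr0]
      norm_cast
      have : (p : ℤ) * s ≤ m := by exact_mod_cast hsm
      nlinarith
    · refine le_trans ?_ (val_artinSchreier_nonneg (p := p) (w := finiteVal hP) (x := u) ?_)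
      · norm_cast; omega
      · rw [hr]; exact_mod_cast hr0
  · exact artinSchreier_mem_nonunits p (polarParts_mem_nonunits hP.ne_zero hu)

/-- Polar parts vanish at infinity whereas nonzero constants do not; so ℘ is injective on polar
parts. -/
lemma natCast_eq_zero_of_mem_nonunits [CharP (RatFunc F) p] {j : ℕ}
    (hj : (j : RatFunc F) ∈ (infinitePlace F).nonunits) : (j : RatFunc F) = 0 := by
  rw [(isValOf_inftyVal F).mem_nonunits_iff] at hj
  rw [CharP.cast_eq_zero_iff (RatFunc F) p]
  by_contra h
  rw [val_natCast_eq p h] at hj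
  simp at hj

/-- Removal of the poles of `a` away from `P` modulo `x ↦ x ^ p - x`. -/
lemma exists_sub_artinSchreier_mem_finitePlace [CharP (RatFunc F) p]
    {a : RatFunc F}
    (hfin : ∀ (Q : F[X]) (hQ : Irreducible Q), Q.Monic → Q ≠ P →
      ∃ x, a - artinSchreier p x ∈ finitePlace hQ)
    (hinf : a ∈ (infinitePlace F).nonunits) :
    ∃ x, (∀ (Q : F[X]) (hQ : Irreducible Q), Q.Monic → Q ≠ P →
      a - artinSchreier p x ∈ finitePlace hQ) ∧
      a - artinSchreier p x ∈ (infinitePlace F).nonunits := by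
  classical
  -- Induction on a finite set of primes containing all the poles of a other than P; initially these
  -- are the factors of the denominator.
  suffices h : ∀ (s : Finset F[X]) (a : RatFunc F),
      (∀ (Q : F[X]) (hQ : Irreducible Q), Q.Monic → Q ≠ P → Q ∉ s → a ∈ finitePlace hQ) →
      (∀ (Q : F[X]) (hQ : Irreducible Q), Q.Monic → Q ≠ P →
        ∃ x, a - artinSchreier p x ∈ finitePlace hQ) →
      a ∈ (infinitePlace F).nonunits →
      ∃ x, (∀ (Q : F[X]) (hQ : Irreducible Q), Q.Monic → Q ≠ P →
        a - artinSchreier p x ∈ finitePlace hQ) ∧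
        a - artinSchreier p x ∈ (infinitePlace F).nonunits by
    refine h (UniqueFactorizationMonoid.normalizedFactors a.denom).toFinset a ?_ hfin hinf
    intro Q hQ hQm hne hQs
    rw [← a.num_div_denom]
    refine div_mem_finitePlace hQ _ fun hdvd => hQs ?_
    rw [Multiset.mem_toFinset, UniqueFactorizationMonoid.mem_normalizedFactors_iff' a.denom_ne_zero]
    exact ⟨hQ, hQm.normalize_eq_self, hdvd⟩
  intro s
  induction s using Finset.induction_on with
  | empty =>
    intro a h1 _ h3
    exact ⟨0, by simpa [artinSchreier_zero] using h1, by simpa [artinSchreier_zero] using h3⟩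
  | insert Q s hQs ih =>
    intro a h1 h2 h3
    by_cases hQ : Q.Monic ∧ Q ≠ P ∧ Irreducible Q
    swap
    · refine ih a (fun Q' hQ' hQm' hne' hQs' => h1 Q' hQ' hQm' hne' ?_) h2 h3
      rw [Finset.mem_insert, not_or]
      refine ⟨?_, hQs'⟩
      rintro rfl
      exact hQ ⟨hQm', hne', hQ'⟩
    obtain ⟨hQm, hne, hQ⟩ := hQ
    obtain ⟨x, hx⟩ := h2 Q hQ hQm hne
    obtain ⟨m, hm⟩ : ∃ m : ℕ, (-m : ℤ) ≤ finiteVal hQ x := by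
      by_cases hx0 : x = 0
      · exact ⟨0, by simp [hx0]⟩
      obtain ⟨r, hr⟩ := exists_val_eq (finiteVal hQ) hx0
      refine ⟨r.natAbs, ?_⟩
      rw [hr]; exact WithTop.coe_le_coe.mpr (by omega)
    obtain ⟨g, hg, hxg⟩ := exists_principalPart hQ hm
    -- Only the principal part of x at Q is subtracted: it is regular at every other prime and
    -- vanishes at infinity, so no earlier achievement is lost.
    set y := algebraMap F[X] (RatFunc F) g / algebraMap F[X] (RatFunc F) (Q ^ m)
    have hy : y ∈ polarParts Q m := (mem_polarParts hQ.ne_zero).mpr ⟨g, hg, rfl⟩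
    have hyinf := artinSchreier_mem_nonunits p (polarParts_mem_nonunits hQ.ne_zero hy)
    have hay : a - artinSchreier p y ∈ finitePlace hQ := by
      have h4 := add_mem hx (sub_mem (pow_mem hxg p) hxg)
      rw [← artinSchreier, artinSchreier_sub] at h4
      convert h4 using 1
      ring
    have ha1 : ∀ (Q' : F[X]) (hQ' : Irreducible Q'), Q'.Monic → Q' ≠ P → Q' ∉ s →
        a - artinSchreier p y ∈ finitePlace hQ' := by
      intro Q' hQ' hQm' hne' hQs'
      by_cases hQQ : Q' = Q
      · subst hQQ; exact hay
      have h5 := polarParts_mem_finitePlace hQm hQ hy hQ' hQm' hQQ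
      refine sub_mem (h1 Q' hQ' hQm' hne' ?_) (sub_mem (pow_mem h5 p) h5)
      rw [Finset.mem_insert, not_or]
      exact ⟨hQQ, hQs'⟩
    have ha2 : ∀ (Q' : F[X]) (hQ' : Irreducible Q'), Q'.Monic → Q' ≠ P →
        ∃ x, a - artinSchreier p y - artinSchreier p x ∈ finitePlace hQ' := by
      intro Q' hQ' hQm' hne'
      obtain ⟨x', hx'⟩ := h2 Q' hQ' hQm' hne'
      exact ⟨x' - y, by rw [artinSchreier_sub]; convert hx' using 1; ring⟩
    have ha3 : a - artinSchreier p y ∈ (infinitePlace F).nonunits := by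
      rw [ValuationSubring.mem_nonunits_iff] at h3 hyinf ⊢
      exact Valuation.map_sub_lt _ h3 hyinf
    obtain ⟨z, hz1, hz2⟩ := ih _ ha1 ha2 ha3
    refine ⟨y + z, ?_, ?_⟩
    · simpa only [artinSchreier_add, ← sub_sub] using hz1
    · simpa only [artinSchreier_add, ← sub_sub] using hz2

/-- Local corrections combine into a global one because F[T] is principal: a polynomial corrects
infinity without finite poles, and afterwards principal parts correct the finite primes without
disturbing infinity or one another. The last hypothesis bounds every reduced pole order at P. -/
lemma exists_sub_artinSchreier_mem_polarParts [Finite F] [CharP F p] [CharP (RatFunc F) p]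
    (hPm : P.Monic) (hP : Irreducible P) {α : ℕ} {a : RatFunc F}
    (hfin : ∀ (Q : F[X]) (hQ : Irreducible Q), Q.Monic → Q ≠ P →
      ∃ x, a - artinSchreier p x ∈ finitePlace hQ)
    (hinf : ∃ x, a - artinSchreier p x ∈ (infinitePlace F).nonunits)
    (hα : ∀ (x : RatFunc F) (t : ℤ), 0 < t → ¬ (p : ℤ) ∣ t →
      finiteVal hP (a - artinSchreier p x) = (-t : ℤ) → t < α) :
    ∃ x, a - artinSchreier p x ∈ polarParts P (α - 1) := by
  obtain ⟨x₀, hx₀⟩ := hinf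
  obtain ⟨f, hf⟩ := exists_polynomial_sub_mem_nonunits x₀
  have h1 : a - artinSchreier p (algebraMap F[X] (RatFunc F) f) ∈ (infinitePlace F).nonunits := by
    have h2 := artinSchreier_mem_nonunits p hf
    have h3 : a - artinSchreier p (algebraMap F[X] (RatFunc F) f) = (a - artinSchreier p x₀) +
        artinSchreier p (x₀ - algebraMap F[X] (RatFunc F) f) := by rw [artinSchreier_sub]; ring
    rw [h3]
    rw [ValuationSubring.mem_nonunits_iff] at h2 hx₀ ⊢
    exact Valuation.map_add_lt _ hx₀ h2
  obtain ⟨x₁, hx₁fin, hx₁inf⟩ := exists_sub_artinSchreier_mem_finitePlace p (P := P)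
    (a := a - artinSchreier p (algebraMap F[X] (RatFunc F) f)) (by
      intro Q hQ hQm hne
      obtain ⟨x', hx'⟩ := hfin Q hQ hQm hne
      exact ⟨x' - algebraMap F[X] (RatFunc F) f, by
        rw [artinSchreier_sub]; convert hx' using 1; ring⟩) h1
  set b := a - artinSchreier p (algebraMap F[X] (RatFunc F) f) - artinSchreier p x₁ with hb
  obtain ⟨m₀, hm₀, hperf⟩ := exists_pow_sub_self_pos_finiteVal hP p
  obtain ⟨x₂, -, -, hx₂⟩ := exists_reduced (p := p) (w := finiteVal hP) (⊤ : Subfield (RatFunc F))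
    (e := 1) one_pos (Subfield.mem_top _) (finiteVal_self hP)
    (fun x _ hx => by
      obtain ⟨r, hr⟩ := exists_val_eq (finiteVal hP) hx
      exact ⟨r, by rw [hr, one_mul]⟩)
    (fun u hu => ⟨m₀, hm₀, hperf u hu.ge⟩) (c := b) (Subfield.mem_top _)
  obtain ⟨m, hm⟩ : ∃ m : ℕ, (-m : ℤ) ≤ finiteVal hP x₂ := by
    by_cases hx0 : x₂ = 0
    · exact ⟨0, by simp [hx0]⟩
    obtain ⟨r, hr⟩ := exists_val_eq (finiteVal hP) hx0
    refine ⟨r.natAbs, ?_⟩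
    rw [hr]; exact WithTop.coe_le_coe.mpr (by omega)
  obtain ⟨g, hg, hxg⟩ := exists_principalPart hP hm
  set y := algebraMap F[X] (RatFunc F) g / algebraMap F[X] (RatFunc F) (P ^ m)
  have hy : y ∈ polarParts P m := (mem_polarParts hP.ne_zero).mpr ⟨g, hg, rfl⟩
  rw [isValOf_finiteVal] at hxg
  have hby : b - artinSchreier p y = (b - artinSchreier p x₂) + artinSchreier p (x₂ - y) := by
    rw [artinSchreier_sub]; ring
  have hayb : a - artinSchreier p (algebraMap F[X] (RatFunc F) f + x₁ + y) =
      b - artinSchreier p y := by rw [artinSchreier_add, artinSchreier_add, hb]; ring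
  refine ⟨algebraMap F[X] (RatFunc F) f + x₁ + y, ?_⟩
  -- A reduced pole order t < α is at most α - 1. If α = 0 the bound excludes a reduced pole, so the
  -- truncated subtraction is harmless.
  have hval : ((-(α - 1 : ℕ) : ℤ) : WithTop ℤ) ≤ finiteVal hP (b - artinSchreier p y) := by
    have h0 := val_artinSchreier_nonneg (p := p) hxg
    rcases hx₂ with hx₂ | ⟨t, ht, htp, hx₂⟩
    · have : 0 ≤ finiteVal hP (b - artinSchreier p y) := by
        rw [hby]; exact AddValuation.map_le_add _ hx₂ h0
      refine le_trans ?_ this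
      norm_cast; omega
    · rw [one_mul] at hx₂
      have h4 : finiteVal hP (b - artinSchreier p y) = (-t : ℤ) := by
        rw [hby]
        refine val_add_eq hx₂ (lt_of_lt_of_le ?_ h0)
        norm_cast; omega
      have h5 := hα _ t ht htp (hayb ▸ h4)
      rw [h4]; norm_cast; omega
  rw [hayb]
  refine mem_polarParts_of_val hPm hP (fun Q hQ hQm hne => ?_) hval ?_
  · have h5 := polarParts_mem_finitePlace hPm hP hy hQ hQm hne
    exact sub_mem (hx₁fin Q hQ hQm hne) (sub_mem (pow_mem h5 p) h5)
  · have h6 := artinSchreier_mem_nonunits p (polarParts_mem_nonunits hP.ne_zero hy)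
    rw [ValuationSubring.mem_nonunits_iff] at h6 hx₁inf ⊢
    exact Valuation.map_sub_lt _ hx₁inf h6

end PolarParts

/-! ### The sum w(α) and its closed form -/

section Totient

variable {F : Type*} [Field F] {P : F[X]}

lemma natCard_quotient_span (hP : P ≠ 0) :
    Nat.card (F[X] ⧸ Ideal.span {P}) = Nat.card F ^ P.natDegree := by
  have : Module.Finite F (F[X] ⧸ Ideal.span {P}) := (AdjoinRoot.powerBasis hP).finite
  rw [Module.natCard_eq_pow_finrank (K := F), finrank_quotient_span_eq_natDegree]

/-- The non-units of F[T] / (P ^ m) form the kernel of the reduction to F[T] / (P). The formula is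
written additively to avoid truncated subtraction. -/
lemma polyTotient_pow [Finite F] (hP : Irreducible P) {m : ℕ} (hm : m ≠ 0) :
    polyTotient (P ^ m) + Nat.card F ^ (P.natDegree * (m - 1)) =
      Nat.card F ^ (P.natDegree * m) := by
  have hle : Ideal.span {P ^ m} ≤ Ideal.span {P} := by
    rw [Ideal.span_singleton_le_span_singleton]; exact dvd_pow_self P hm
  let R := F[X] ⧸ Ideal.span {P ^ m}
  let f : R →+* F[X] ⧸ Ideal.span {P} := Ideal.Quotient.factor hle
  have hf : Function.Surjective f := Ideal.Quotient.factor_surjective hle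
  have hR : Nat.card R = Nat.card F ^ (P.natDegree * m) := by
    rw [natCard_quotient_span (pow_ne_zero m hP.ne_zero), natDegree_pow, mul_comm]
  have hq : 0 < Nat.card F := Nat.card_pos
  have : Finite R := Nat.finite_of_card_ne_zero (by rw [hR]; exact (pow_pos hq _).ne')
  have hker : Nat.card f.toAddMonoidHom.ker = Nat.card F ^ (P.natDegree * (m - 1)) := by
    have h1 := AddSubgroup.card_mul_index f.toAddMonoidHom.ker
    rw [AddSubgroup.index_ker,
      show f.toAddMonoidHom.range = ⊤ from AddMonoidHom.range_eq_top.mpr hf,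
      AddSubgroup.card_top,
      natCard_quotient_span hP.ne_zero] at h1
    have h2 : Nat.card F ^ (P.natDegree * m) =
        Nat.card F ^ (P.natDegree * (m - 1)) * Nat.card F ^ P.natDegree := by
      rw [← pow_add, ← Nat.mul_succ, Nat.succ_eq_add_one, Nat.sub_add_cancel (by omega)]
    exact Nat.eq_of_mul_eq_mul_right (pow_pos hq _) (h1.trans (hR.trans h2))
  have hunit : ∀ x : R, IsUnit x ↔ x ∉ f.toAddMonoidHom.ker := by
    intro x
    obtain ⟨g, rfl⟩ := Ideal.Quotient.mk_surjective x
    have h1 : Ideal.Quotient.mk (Ideal.span {P ^ m}) g ∈ f.toAddMonoidHom.ker ↔ P ∣ g := by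
      rw [AddMonoidHom.mem_ker]
      change f (Ideal.Quotient.mk _ g) = 0 ↔ _
      rw [Ideal.Quotient.factor_mk, Ideal.Quotient.eq_zero_iff_dvd]
    rw [h1, ← hP.coprime_iff_not_dvd, ← IsCoprime.pow_left_iff (Nat.pos_of_ne_zero hm)]
    constructor
    · rintro h
      obtain ⟨y, hy⟩ := h.exists_left_inv
      obtain ⟨h, rfl⟩ := Ideal.Quotient.mk_surjective y
      rw [← map_mul, ← map_one (Ideal.Quotient.mk _), eq_comm, Ideal.Quotient.eq,
        Ideal.mem_span_singleton] at hy
      obtain ⟨c, hc⟩ := hy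
      exact ⟨c, h, by linear_combination -hc⟩
    · rintro ⟨c, h, hc⟩
      refine IsUnit.of_mul_eq_one (Ideal.Quotient.mk _ h) ?_
      rw [← map_mul, ← map_one (Ideal.Quotient.mk _), eq_comm, Ideal.Quotient.eq,
        Ideal.mem_span_singleton]
      exact ⟨c, by linear_combination -hc⟩
  have hunits : polyTotient (P ^ m) = Nat.card {x : R // ¬ x ∈ f.toAddMonoidHom.ker} := by
    refine Nat.card_congr ((Equiv.ofBijective (fun u : Rˣ => (⟨u, u.isUnit⟩ : {x : R // IsUnit x}))
      ⟨fun u v h => Units.ext (congrArg Subtype.val h), fun x => ⟨x.2.unit, rfl⟩⟩).trans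
      (Equiv.subtypeEquivRight hunit))
  rw [hunits, ← hker, ← hR, add_comm, ← Nat.card_sum]
  classical
  exact Nat.card_congr (Equiv.sumCompl (· ∈ f.toAddMonoidHom.ker))

/-- As λ runs through the integers prime to p, the exponent λ - ⌊λ/p⌋ takes the values 1, 2, 3, …
once each, so the differences q ^ (d m) - q ^ (d (m - 1)) telescope. -/
lemma one_add_wSum [Finite F] (p : ℕ) [Fact p.Prime] (hP : Irreducible P) (α : ℕ) :
    1 + wSum P p α = Nat.card F ^ (P.natDegree * (α - 1 - (α - 1) / p)) := by
  have hp := (Fact.out : p.Prime)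
  induction α with
  | zero => simp [wSum]
  | succ α ih =>
    rcases Nat.eq_zero_or_pos α with rfl | hα
    · simp [wSum]
    have h1 := Nat.succ_div (a := α - 1) (b := p)
    rw [Nat.sub_add_cancel hα] at h1
    have h2 : α / p ≤ α := Nat.div_le_self α p
    have h2' : (α - 1) / p ≤ α - 1 := Nat.div_le_self _ p
    rw [wSum, Finset.sum_filter, Finset.sum_Ico_succ_top hα, ← Finset.sum_filter, ← wSum,
      Nat.add_sub_cancel, ← add_assoc, ih]
    by_cases hdvd : p ∣ α
    · rw [if_pos hdvd] at h1
      rw [if_neg (fun h => (Nat.Prime.coprime_iff_not_dvd hp).mp h.symm hdvd), add_zero]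
      congr 2
      omega
    · rw [if_neg hdvd, add_zero] at h1
      rw [if_pos ((Nat.Prime.coprime_iff_not_dvd hp).mpr hdvd).symm]
      have h3 : α - α / p ≠ 0 := by
        have := Nat.div_lt_self hα hp.one_lt
        omega
      rw [← polyTotient_pow hP h3, add_comm, ← h1]
      congr 3
      omega

lemma sub_ceil_div (p : ℕ) (hp : 0 < p) (α : ℕ) :
    α - ⌈(α : ℚ) / p⌉₊ = α - 1 - (α - 1) / p := by
  rcases Nat.eq_zero_or_pos α with rfl | hα
  · simp
  have h : ⌈(α : ℚ) / p⌉₊ = (α - 1) / p + 1 := by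
    rw [Nat.ceil_eq_iff (Nat.succ_ne_zero _)]
    have hp' : (0 : ℚ) < p := by exact_mod_cast hp
    have h1 := Nat.div_add_mod (α - 1) p
    have h2 := Nat.mod_lt (α - 1) hp
    set c := (α - 1) / p
    rw [lt_div_iff₀ hp', div_le_iff₀ hp', Nat.succ_sub_one]
    constructor
    · have h3 : c * p < α := by rw [mul_comm]; omega
      exact_mod_cast h3
    · have h3 : α ≤ (c + 1) * p := by rw [add_mul, one_mul, mul_comm]; omega
      exact_mod_cast h3
  omega

end Totient

/-! ### Approximation at a fully decomposed place -/

section FullyDecomposed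

variable {k : Type*} [Field k]

lemma isDiscreteValuationRing_of_isValOf {𝔭 : ValuationSubring k}
    {v : AddValuation k (WithTop ℤ)} (hv : IsValOf v 𝔭) (hπ : ∃ π, v π = (1 : ℤ)) :
    IsDiscreteValuationRing 𝔭 := by
  obtain ⟨π, hπ⟩ := hπ
  have hπ0 := ne_zero_of_val hπ
  have hπ𝔭 : π ∈ 𝔭 := by rw [hv, hπ]; norm_cast
  have hassoc : ∀ (x : 𝔭) (n : ℕ), v x = (n : ℤ) → Associated ((⟨π, hπ𝔭⟩ : 𝔭) ^ n) x := by
    intro x n hx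
    have hu : v ((x : k) / π ^ n) = (0 : ℤ) := by
      simpa using val_div_eq hx (val_pow_eq hπ n)
    have h1 : (x : k) / π ^ n ∈ 𝔭 := by rw [hv, hu]; norm_cast
    have h2 : ((x : k) / π ^ n)⁻¹ ∈ 𝔭 := by rw [hv, val_inv_eq hu]; simp
    refine ⟨⟨⟨_, h1⟩, ⟨_, h2⟩, Subtype.ext (mul_inv_cancel₀ (ne_zero_of_val hu)),
      Subtype.ext (inv_mul_cancel₀ (ne_zero_of_val hu))⟩, Subtype.ext ?_⟩
    change π ^ n * ((x : k) / π ^ n) = x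
    field_simp
  have hval : ∀ x : 𝔭, x ≠ 0 → ∃ n : ℕ, v x = (n : ℤ) := by
    intro x hx
    obtain ⟨r, hr⟩ := exists_val_eq v (x := (x : k)) (by simpa using hx)
    have h0 : 0 ≤ r := by
      have := (hv x).mp x.2
      rw [hr] at this
      exact_mod_cast this
    lift r to ℕ using h0
    exact ⟨r, hr⟩
  refine IsDiscreteValuationRing.ofHasUnitMulPowIrreducibleFactorization
    ⟨⟨π, hπ𝔭⟩, ?_, fun {x} hx => ?_⟩
  · have hunit : ∀ x : 𝔭, v x = (0 : ℤ) → IsUnit x := by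
      intro x hx
      have := hassoc x 0 hx
      rw [pow_zero] at this
      exact (associated_one_iff_isUnit.mp this.symm)
    refine ⟨fun h => ?_, fun a b hab => ?_⟩
    · obtain ⟨y, hy⟩ := h.exists_right_inv
      have h1 := congrArg (fun x : 𝔭 => v (x : k)) hy
      have h2 := (hv y).mp y.2
      have h3 : v (π * (y : k)) = v (1 : k) := h1
      rw [AddValuation.map_mul, hπ, AddValuation.map_one] at h3
      have h4 : (1 : WithTop ℤ) ≤ 0 := by
        rw [← h3]; exact le_add_of_nonneg_right h2
      norm_cast at h4
    · have h1 : π = (a : k) * b := congrArg (fun x : 𝔭 => (x : k)) hab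
      have ha0 : a ≠ 0 := by rintro rfl; simp [hπ0] at h1
      have hb0 : b ≠ 0 := by rintro rfl; simp [hπ0] at h1
      obtain ⟨m, hm⟩ := hval a ha0
      obtain ⟨n, hn⟩ := hval b hb0
      have h2 := val_mul_eq hm hn
      rw [← h1, hπ] at h2
      have h3 : (1 : ℤ) = m + n := by exact_mod_cast h2
      rcases Nat.eq_zero_or_pos m with h | h
      · subst h; exact Or.inl (hunit a hm)
      · have : n = 0 := by omega
        subst this; exact Or.inr (hunit b hn)
  · obtain ⟨n, hn⟩ := hval x hx
    exact ⟨n, hassoc x n hn⟩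

variable {K : Type*} [Field K] [Algebra k K]

section Integers

variable {𝔭 : ValuationSubring k} {A B : Type*} [CommRing A] [CommRing B] [Algebra A k]
  [Algebra A B] [Algebra B K] [Algebra A K] [IsScalarTower A k K] [IsScalarTower A B K]

/-- The center on `B` of a place of `K`. -/
def center (𝔓 : ValuationSubring K) (h : ∀ b : B, algebraMap B K b ∈ 𝔓) : Ideal B :=
  (IsLocalRing.maximalIdeal 𝔓).comap ((algebraMap B K).codRestrict 𝔓.toSubring h : B →+* 𝔓)

omit [Algebra A k] [IsScalarTower A k K] in
lemma mem_center {𝔓 : ValuationSubring K} {h : ∀ b : B, algebraMap B K b ∈ 𝔓} {b : B} :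
    b ∈ center 𝔓 h ↔ algebraMap B K b ∈ 𝔓.nonunits := by
  rw [center, Ideal.mem_comap, ← 𝔓.coe_mem_nonunits_iff]
  rfl

instance (𝔓 : ValuationSubring K) (h : ∀ b : B, algebraMap B K b ∈ 𝔓) : (center 𝔓 h).IsPrime :=
  Ideal.comap_isPrime _ _

lemma mem_nonunits_iff_mem_and {𝔓 : ValuationSubring K} {x : K} (hx : x ≠ 0) :
    x ∈ 𝔓.nonunits ↔ x⁻¹ ∉ 𝔓 := by
  rw [ValuationSubring.mem_nonunits_iff_or]
  simp [hx]

/-- Elements outside the center are units of 𝔓, so 𝔓 dominates the localization of B at its center,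
which is already a valuation ring. -/
lemma eq_valuationSubring_of_center [IsDedekindDomain B] [IsFractionRing B K]
    {𝔓 : ValuationSubring K} (h : ∀ b : B, algebraMap B K b ∈ 𝔓) (v : HeightOneSpectrum B)
    (hv : v.asIdeal = center 𝔓 h) : 𝔓 = (v.valuation K).valuationSubring := by
  have hunit : ∀ d ∈ v.asIdeal.primeCompl, (algebraMap B K d)⁻¹ ∈ 𝔓 := by
    intro d hd
    by_contra hd'
    refine hd ?_
    change d ∈ v.asIdeal
    rw [hv, mem_center, ValuationSubring.mem_nonunits_iff_or]
    exact Or.inr hd'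
  have hfrac : ∀ x : K, v.valuation K x ≤ 1 → ∃ (b : B) (d : v.asIdeal.primeCompl),
      x = algebraMap B K b * (algebraMap B K d)⁻¹ ∧
        v.valuation K x = v.valuation K (algebraMap B K b) := by
    intro x hx
    obtain ⟨b, d, hbd⟩ := v.exists_primeCompl_mul_eq_of_integer x hx
    have hd0 : algebraMap B K d ≠ 0 := by
      simp only [ne_eq, FaithfulSMul.algebraMap_eq_zero_iff]
      intro h0
      exact d.2 (by rw [h0]; exact v.asIdeal.zero_mem)
    refine ⟨b, d, by rw [← hbd, mul_inv_cancel_right₀ hd0], ?_⟩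
    rw [← hbd, map_mul, v.valuation_of_algebraMap (d : B),
      (v.intValuation_eq_one_iff_mem_primeCompl d).mpr d.2, mul_one]
  ext x
  rw [Valuation.mem_valuationSubring_iff]
  constructor
  · intro hx
    by_contra hlt
    rw [not_le] at hlt
    have hx0 : x ≠ 0 := by rintro rfl; simp at hlt
    have h1 : v.valuation K x⁻¹ < 1 := by
      rw [map_inv₀]; exact inv_lt_one_of_one_lt₀ hlt
    obtain ⟨b, d, hbd, hval⟩ := hfrac _ h1.le
    rw [hval, v.valuation_lt_one_iff_mem, hv, mem_center] at h1
    have h2 : x⁻¹ ∈ 𝔓.nonunits := by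
      rw [ValuationSubring.mem_nonunits_iff] at h1 ⊢
      rw [hbd, map_mul]
      exact mul_lt_one_of_lt_of_le h1 ((𝔓.valuation_le_one_iff _).mpr (hunit d d.2))
    rw [mem_nonunits_iff_mem_and (inv_ne_zero hx0), inv_inv] at h2
    exact h2 hx
  · intro hx
    obtain ⟨b, d, hbd, -⟩ := hfrac _ hx
    rw [hbd]
    exact mul_mem (h b) (hunit d d.2)

variable [IsDedekindDomain A] [IsLocalRing A] [IsDedekindDomain B] [IsFractionRing A k]
  [IsFractionRing B K] [Module.Finite A B]

-- Distinct places have distinct centers, so there are at least [K : k] primes of B over the maximal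
-- ideal; the identity ∑ e f = [K : k] then forces e = f = 1 everywhere. Hence residues come from k,
-- and a uniformizer of k remains one.
include A B in
set_option linter.deprecated false in
lemma exists_sub_mem_nonunits_of_integers (hA : ∀ x : k, x ∈ 𝔭 ↔ ∃ a, algebraMap A k a = x)
    {π : A} (hπ0 : π ≠ 0) (hπ : IsLocalRing.maximalIdeal A = Ideal.span {π})
    (hdec : (placesAbove K 𝔭).ncard = Module.finrank k K) {𝔓 : ValuationSubring K}
    (h𝔓 : 𝔓 ∈ placesAbove K 𝔭) (x : K) : ∃ c : k, x - algebraMap k K c ∈ 𝔓.nonunits := by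
  classical
  have : FaithfulSMul A B := by
    rw [faithfulSMul_iff_algebraMap_injective]
    have h := (algebraMap k K).injective.comp (IsFractionRing.injective A k)
    rw [← RingHom.coe_comp, ← IsScalarTower.algebraMap_eq, IsScalarTower.algebraMap_eq A B K,
      RingHom.coe_comp] at h
    exact h.of_comp
  set m := IsLocalRing.maximalIdeal A with hm
  have hm0 : m ≠ ⊥ := by rwa [hπ, Ne, Ideal.span_singleton_eq_bot]
  have hAk : ∀ (𝔔 : ValuationSubring K), 𝔔 ∈ placesAbove K 𝔭 → ∀ c : k,
      algebraMap k K c ∈ 𝔔 ↔ c ∈ 𝔭 := by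
    intro 𝔔 h𝔔 c
    rw [← show 𝔔.comap (algebraMap k K) = 𝔭 from h𝔔, ValuationSubring.mem_comap]
  have hB : ∀ 𝔔 ∈ placesAbove K 𝔭, ∀ b : B, algebraMap B K b ∈ 𝔔 := by
    intro 𝔔 h𝔔 b
    obtain ⟨q, hq, hqb⟩ := (Algebra.IsIntegral.isIntegral (R := A) b)
    refine mem_of_isIntegralElem h𝔔 ?_
    let g : A →+* 𝔭 := (algebraMap A k).codRestrict 𝔭.toSubring fun a => (hA _).mpr ⟨a, rfl⟩
    refine ⟨q.map g, hq.map g, ?_⟩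
    rw [eval₂_map]
    have : ((algebraMap k K).comp 𝔭.subtype).comp g = (algebraMap B K).comp (algebraMap A B) := by
      ext a
      change algebraMap k K (algebraMap A k a) = algebraMap B K (algebraMap A B a)
      rw [← IsScalarTower.algebraMap_apply, ← IsScalarTower.algebraMap_apply]
    rw [this, ← hom_eval₂, hqb, map_zero]
  have hlies : ∀ 𝔔 (h𝔔 : 𝔔 ∈ placesAbove K 𝔭), (center 𝔔 (hB 𝔔 h𝔔)).LiesOver m := by
    intro 𝔔 h𝔔
    refine ⟨?_⟩
    have hne : Ideal.under A (center 𝔔 (hB 𝔔 h𝔔)) ≠ ⊤ := Ideal.IsPrime.ne_top inferInstance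
    refine le_antisymm ?_ (IsLocalRing.le_maximalIdeal hne)
    intro a ha
    rw [Ideal.under, Ideal.mem_comap, mem_center]
    by_cases ha0 : a = 0
    · rw [ha0]; simp
    have hak0 : algebraMap A k a ≠ 0 := by simpa using ha0
    rw [← IsScalarTower.algebraMap_apply, IsScalarTower.algebraMap_apply A k K,
      mem_nonunits_iff_mem_and (by simpa using ha0), ← map_inv₀, hAk 𝔔 h𝔔, hA]
    rintro ⟨b, hb⟩
    refine (IsLocalRing.mem_maximalIdeal a).mp ha (IsUnit.of_mul_eq_one b ?_)
    apply IsFractionRing.injective A k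
    rw [map_mul, hb, map_one, mul_inv_cancel₀ hak0]
  let Sfin := IsDedekindDomain.primesOverFinset m B
  have hmem : ∀ 𝔔 (h𝔔 : 𝔔 ∈ placesAbove K 𝔭), center 𝔔 (hB 𝔔 h𝔔) ∈ Sfin := fun 𝔔 h𝔔 =>
    (IsDedekindDomain.mem_primesOverFinset_iff hm0 _).mpr ⟨inferInstance, hlies 𝔔 h𝔔⟩
  have hbot : ∀ 𝔔 (h𝔔 : 𝔔 ∈ placesAbove K 𝔭), center 𝔔 (hB 𝔔 h𝔔) ≠ ⊥ := by
    intro 𝔔 h𝔔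
    have := hlies 𝔔 h𝔔
    exact Ideal.ne_bot_of_liesOver_of_ne_bot hm0 _
  have hcard : (placesAbove K 𝔭).ncard ≤ Sfin.card := by
    rw [← Set.ncard_coe_finset]
    refine Set.ncard_le_ncard_of_injOn
      (fun 𝔔 => if h𝔔 : 𝔔 ∈ placesAbove K 𝔭 then center 𝔔 (hB 𝔔 h𝔔) else ⊥) ?_ ?_
      Sfin.finite_toSet
    · intro 𝔔 h𝔔
      simp only [dif_pos h𝔔]
      exact hmem 𝔔 h𝔔
    · intro 𝔔 h𝔔 𝔔' h𝔔' heq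
      simp only [dif_pos h𝔔, dif_pos h𝔔'] at heq
      rw [eq_valuationSubring_of_center (hB 𝔔 h𝔔) ⟨_, inferInstance, hbot 𝔔 h𝔔⟩ rfl]
      exact (eq_valuationSubring_of_center (hB 𝔔' h𝔔') ⟨_, inferInstance, hbot 𝔔 h𝔔⟩ heq).symm
  have hsum := Ideal.sum_ramification_inertia B k K hm0
  have hpos : ∀ 𝔮 ∈ Sfin, 1 ≤ Ideal.ramificationIdx' m 𝔮 * Ideal.inertiaDeg' m 𝔮 := by
    intro 𝔮 h𝔮
    obtain ⟨h1, h2⟩ := (IsDedekindDomain.mem_primesOverFinset_iff hm0 _).mp h𝔮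
    exact Nat.mul_pos (Nat.pos_of_ne_zero
      (Ideal.IsDedekindDomain.ramificationIdx'_ne_zero_of_liesOver _ hm0))
      (Nat.pos_of_ne_zero (Ideal.inertiaDeg'_ne_zero m 𝔮))
  have hone : ∀ 𝔮 ∈ Sfin, Ideal.ramificationIdx' m 𝔮 * Ideal.inertiaDeg' m 𝔮 = 1 := by
    have h1 : ∑ 𝔮 ∈ Sfin, 1 = ∑ 𝔮 ∈ Sfin, Ideal.ramificationIdx' m 𝔮 * Ideal.inertiaDeg' m 𝔮 := by
      refine le_antisymm (Finset.sum_le_sum hpos) ?_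
      rw [hsum, ← hdec]
      simpa using hcard
    intro 𝔮 h𝔮
    exact ((Finset.sum_eq_sum_iff_of_le hpos).mp h1 𝔮 h𝔮).symm
  let 𝔮 := center 𝔓 (hB 𝔓 h𝔓)
  have : 𝔮.LiesOver m := hlies 𝔓 h𝔓
  have hef := hone 𝔮 (hmem 𝔓 h𝔓)
  have he : Ideal.ramificationIdx' m 𝔮 = 1 := Nat.eq_one_of_mul_eq_one_right hef
  have hf : Ideal.inertiaDeg' m 𝔮 = 1 := Nat.eq_one_of_mul_eq_one_left hef
  rw [Ideal.inertiaDeg'_algebraMap] at hf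
  let w : HeightOneSpectrum B := ⟨𝔮, inferInstance, hbot 𝔓 h𝔓⟩
  have h𝔓w : 𝔓 = (w.valuation K).valuationSubring :=
    eq_valuationSubring_of_center (hB 𝔓 h𝔓) w rfl
  have hnon : ∀ y : K, y ∈ 𝔓.nonunits ↔ w.valuation K y < 1 := by
    intro y
    by_cases hy : y = 0
    · simp [hy]
    rw [mem_nonunits_iff_mem_and hy, h𝔓w, Valuation.mem_valuationSubring_iff, map_inv₀, not_le,
      one_lt_inv₀ (by simpa [zero_lt_iff] using hy)]
  have hmap : Ideal.map (algebraMap A B) m ≤ 𝔮 := by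
    rw [Ideal.map_le_iff_le_comap]
    exact (Ideal.over_def 𝔮 m).le
  set πB := algebraMap A B π
  have hπmem : πB ∈ 𝔮 :=
    hmap (Ideal.mem_map_of_mem _ (by rw [hπ]; exact Ideal.mem_span_singleton_self π))
  have hπnot : πB ∉ 𝔮 ^ 2 := by
    intro hmem2
    refine (Ideal.ramificationIdx'_ne_one_iff hmap).mpr ?_ he
    rw [hπ, Ideal.map_span, Set.image_singleton, Ideal.span_singleton_le_iff_mem]
    exact hmem2
  have hwπ : w.valuation K (algebraMap B K πB) = WithZero.exp (-1 : ℤ) := by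
    rw [w.valuation_of_algebraMap]
    have h1 : w.intValuation πB ≤ WithZero.exp (-((1 : ℕ) : ℤ)) := by
      rw [w.intValuation_le_pow_iff_mem, pow_one]; exact hπmem
    have h2 : ¬ w.intValuation πB ≤ WithZero.exp (-((2 : ℕ) : ℤ)) := by
      rw [w.intValuation_le_pow_iff_mem]; exact hπnot
    have h3 : w.intValuation πB ≠ 0 := by
      intro h0
      rw [h0] at h2
      exact h2 zero_le
    rw [← WithZero.exp_log h3] at h1 h2 ⊢
    rw [WithZero.exp_le_exp] at h1 h2
    rw [WithZero.exp_inj]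
    push_cast at h1 h2
    omega
  have hπk : algebraMap B K πB = algebraMap k K (algebraMap A k π) := by
    rw [← IsScalarTower.algebraMap_apply, ← IsScalarTower.algebraMap_apply]
  have hres : ∀ y : K, w.valuation K y ≤ 1 → ∃ c : k, w.valuation K (y - algebraMap k K c) < 1 := by
    intro y hy
    obtain ⟨b, hb⟩ := w.exists_valuation_sub_lt_of_integer hy 1
    have hsurj : Function.Surjective (algebraMap (A ⧸ m) (B ⧸ 𝔮)) := by
      let _ : Field (A ⧸ m) := Ideal.Quotient.field m
      intro z
      obtain ⟨c, hc⟩ := (finrank_eq_one_iff_of_nonzero' (1 : B ⧸ 𝔮) one_ne_zero).mp hf z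
      exact ⟨c, by rw [Algebra.algebraMap_eq_smul_one]; exact hc⟩
    obtain ⟨z, hz⟩ := hsurj (Ideal.Quotient.mk 𝔮 b)
    obtain ⟨a, rfl⟩ := Ideal.Quotient.mk_surjective z
    have h1 : b - algebraMap A B a ∈ 𝔮 := by
      rw [← Ideal.Quotient.eq, ← hz]; rfl
    refine ⟨algebraMap A k a, ?_⟩
    have h2 : y - algebraMap k K (algebraMap A k a) =
        -(algebraMap B K b - y) + algebraMap B K (b - algebraMap A B a) := by
      rw [map_sub, ← IsScalarTower.algebraMap_apply, ← IsScalarTower.algebraMap_apply]; ring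
    rw [h2]
    refine Valuation.map_add_lt _ (by rw [Valuation.map_neg]; exact hb) ?_
    rw [w.valuation_lt_one_iff_mem]
    exact h1
  -- Induction on the pole order r: multiply y by a power of the uniformizer of k, take the residue
  -- in k, and divide back. The pole order drops by one because e = 1.
  have key : ∀ (r : ℕ) (y : K), w.valuation K y ≤ WithZero.exp (r : ℤ) →
      ∃ c : k, w.valuation K (y - algebraMap k K c) < 1 := by
    intro r
    induction r with
    | zero => intro y hy; exact hres y (by simpa using hy)
    | succ r ih =>
      intro y hy
      have hπK0 : algebraMap B K πB ≠ 0 := by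
        intro h0; rw [h0, map_zero] at hwπ; exact WithZero.exp_ne_zero hwπ.symm
      obtain ⟨c, hc⟩ := hres (y * algebraMap B K πB ^ (r + 1)) (by
        rw [map_mul, map_pow, hwπ]
        calc _ ≤ WithZero.exp ((r + 1 : ℕ) : ℤ) * WithZero.exp (-1 : ℤ) ^ (r + 1) :=
              mul_le_mul_left hy _
          _ = 1 := by rw [← WithZero.exp_nsmul, ← WithZero.exp_add]; simp)
      obtain ⟨c', hc'⟩ := ih (y - algebraMap k K (c / (algebraMap A k π) ^ (r + 1))) (by
        have h1 : y - algebraMap k K (c / (algebraMap A k π) ^ (r + 1)) =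
            (y * algebraMap B K πB ^ (r + 1) - algebraMap k K c) *
              (algebraMap B K πB ^ (r + 1))⁻¹ := by
          rw [_root_.map_div₀, map_pow, ← hπk]; field_simp
        rw [h1, map_mul, map_inv₀, map_pow, hwπ]
        have h2 : w.valuation K (y * algebraMap B K πB ^ (r + 1) - algebraMap k K c) ≤
            WithZero.exp (-1 : ℤ) := by
          generalize w.valuation K (y * algebraMap B K πB ^ (r + 1) - algebraMap k K c) = z at hc
          by_cases hz : z = 0
          · rw [hz]; exact zero_le
          rw [← WithZero.exp_log hz, ← WithZero.exp_zero, WithZero.exp_lt_exp] at hc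
          rw [← WithZero.exp_log hz, WithZero.exp_le_exp]
          omega
        calc _ ≤ WithZero.exp (-1 : ℤ) * (WithZero.exp (-1 : ℤ) ^ (r + 1))⁻¹ :=
              mul_le_mul_left h2 _
          _ = WithZero.exp (r : ℤ) := by
            rw [← WithZero.exp_nsmul, ← WithZero.exp_neg, ← WithZero.exp_add]; simp)
      exact ⟨c / (algebraMap A k π) ^ (r + 1) + c', by rw [map_add, ← sub_sub]; exact hc'⟩
  by_cases hx : w.valuation K x = 0
  · obtain ⟨c, hc⟩ := hres x (by rw [hx]; exact zero_le)
    exact ⟨c, (hnon _).mpr hc⟩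
  · obtain ⟨c, hc⟩ := key (WithZero.log (w.valuation K x)).natAbs x (by
      nth_rewrite 1 [← WithZero.exp_log hx]
      rw [WithZero.exp_le_exp]
      omega)
    exact ⟨c, (hnon _).mpr hc⟩

end Integers

/-- At a fully decomposed place every element of `K` can be approximated by elements of `k`. -/
lemma exists_sub_mem_nonunits_of_isFullyDecomposed [Algebra.IsSeparable k K]
    [FiniteDimensional k K] {𝔭 : ValuationSubring k} {v : AddValuation k (WithTop ℤ)}
    (hv : IsValOf v 𝔭) (hπ : ∃ π, v π = (1 : ℤ)) (hdec : IsFullyDecomposed K 𝔭)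
    {𝔓 : ValuationSubring K} (h𝔓 : 𝔓 ∈ placesAbove K 𝔭) (x : K) :
    ∃ c : k, x - algebraMap k K c ∈ 𝔓.nonunits := by
  have : IsDiscreteValuationRing 𝔭 := isDiscreteValuationRing_of_isValOf hv hπ
  let _ : Algebra 𝔭 K := ((algebraMap k K).comp (algebraMap 𝔭 k)).toAlgebra
  have : IsScalarTower 𝔭 k K := IsScalarTower.of_algebraMap_eq fun _ => rfl
  have : IsDedekindDomain (integralClosure 𝔭 K) := integralClosure.isDedekindDomain 𝔭 k K
  have : IsFractionRing (integralClosure 𝔭 K) K :=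
    integralClosure.isFractionRing_of_finite_extension k K
  have : Module.Finite 𝔭 (integralClosure 𝔭 K) := IsIntegralClosure.finite 𝔭 k K _
  obtain ⟨ϖ, hϖ⟩ := IsDiscreteValuationRing.exists_irreducible 𝔭
  exact exists_sub_mem_nonunits_of_integers (A := 𝔭) (B := integralClosure 𝔭 K) (𝔭 := 𝔭)
    (fun x => ⟨fun hx => ⟨⟨x, hx⟩, rfl⟩, fun ⟨a, ha⟩ => ha ▸ a.2⟩) hϖ.ne_zero
    hϖ.maximalIdeal_eq hdec h𝔓 x

end FullyDecomposed

/-! ### Comparison of two extensions at each kind of place -/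

section LocalComparison

variable {k Ω : Type*} [Field k] [Field Ω] [Algebra k Ω]

lemma comap_mem_placesAbove {𝔭 : ValuationSubring k} {𝒪 : ValuationSubring Ω}
    (h : 𝒪 ∈ placesAbove Ω 𝔭) (K : IntermediateField k Ω) :
    𝒪.comap (algebraMap K Ω) ∈ placesAbove K 𝔭 := h

lemma mem_nonunits_comap {K L : Type*} [Field K] [Field L] {A : ValuationSubring L} {f : K →+* L}
    {x : K} : x ∈ (A.comap f).nonunits ↔ f x ∈ A.nonunits := by
  rw [ValuationSubring.mem_nonunits_iff_or, ValuationSubring.mem_nonunits_iff_or,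
    ValuationSubring.mem_comap, map_inv₀, map_eq_zero]

variable {v : AddValuation k (WithTop ℤ)} {p : ℕ} [Fact p.Prime] [CharP Ω p]
  {𝔭 : ValuationSubring k} {𝒪 : ValuationSubring Ω} {K' K K₀ : IntermediateField k Ω}

omit [Fact p.Prime] in
lemma charP_intermediateField (K : IntermediateField k Ω) : CharP K p :=
  (algebraMap K Ω).charP (algebraMap K Ω).injective p

/-- At an unramified place, an Artin-Schreier generator can be made integral. -/
lemma exists_sub_mem_of_unramified [Algebra.IsAlgebraic k K] (hv : IsValOf v 𝔭) {π : k}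
    (hπ : v π = (1 : ℤ)) {m : ℕ} (hm : 1 ≤ m) (hfin : ∀ a, 0 ≤ v a → 0 < v (a ^ p ^ m - a))
    (h𝒪 : 𝒪 ∈ placesAbove Ω 𝔭) (hunr : ¬ IsRamified K 𝔭) {z : Ω} (hz : z ∈ K)
    (hzK' : artinSchreier p z ∈ K') :
    ∃ x ∈ K', x ∈ K ∧ z - x ∈ 𝒪 := by
  have := charP_intermediateField (p := p) K
  set 𝔓 := 𝒪.comap (algebraMap K Ω)
  have h𝔓 : 𝔓 ∈ placesAbove K 𝔭 := comap_mem_placesAbove h𝒪 K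
  have he : ramificationIndex k 𝔓 = 1 := by
    by_contra h
    exact hunr ⟨𝔓, h𝔓, h⟩
  obtain ⟨w, hw, hext, -⟩ := exists_normalized_val hv ⟨π, hπ⟩ h𝔓 (by rw [he]; exact one_ne_zero)
  rw [he] at hext
  -- The reduction takes place over K' ∩ K so that x lies in K'. A uniformizer of k serves for it,
  -- as K is unramified. A reduced pole of ℘(z - x) is then impossible, since its order would be
  -- divisible by p.
  let E : Subfield K := K'.toSubfield.comap (algebraMap K Ω)
  have hmap : algebraMap K Ω (artinSchreier p ⟨z, hz⟩) = artinSchreier p z :=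
    map_artinSchreier p (algebraMap K Ω) _
  obtain ⟨x, hxE, -, hx⟩ := exists_reduced (p := p) (w := w) E one_pos
    (π := algebraMap k K π) (by
      change algebraMap K Ω (algebraMap k K π) ∈ K'
      rw [← IsScalarTower.algebraMap_apply]
      exact K'.algebraMap_mem π)
    (by rw [hext π 1 hπ]; norm_num)
    (fun x _ hx => by
      obtain ⟨r, hr⟩ := exists_val_eq w hx
      exact ⟨r, by rw [hr, one_mul]⟩)
    (fun u hu => exists_pow_sub_self_pos one_ne_zero hext hw hm hfin hu.ge)
    (c := artinSchreier p ⟨z, hz⟩) (by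
      change algebraMap K Ω (artinSchreier p ⟨z, hz⟩) ∈ K'
      rw [hmap]; exact hzK')
  refine ⟨x, hxE, x.2, ?_⟩
  suffices h : 0 ≤ w (⟨z, hz⟩ - x) from (hw _).mpr h
  rw [← artinSchreier_sub] at hx
  rcases hx with hx | ⟨t, ht, htp, hx⟩
  · by_cases h0 : (⟨z, hz⟩ : K) - x = 0
    · rw [h0]; simp
    obtain ⟨r, hr⟩ := exists_val_eq w h0
    by_contra hneg
    have hr0 : r < 0 := by
      rw [hr] at hneg
      exact_mod_cast not_le.mp hneg
    rw [val_artinSchreier_of_neg hr hr0] at hx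
    have h1 : (0 : ℤ) ≤ p * r := by exact_mod_cast hx
    have h2 : (0 : ℤ) < p := by exact_mod_cast (Fact.out : p.Prime).pos
    nlinarith
  · obtain ⟨r, -, hr, -⟩ := val_of_artinSchreier_neg hx (by omega)
    exact absurd ⟨-r, by linarith⟩ htp

/-- Making z and z₀ integral by elements of K' makes a integral modulo ℘(K). As K is unramified, a
pole of order prime to p over k keeps its order in K and cannot be removed there, so a is already
integral modulo ℘(k). -/
lemma exists_sub_artinSchreier_mem_of_unramified [Algebra.IsAlgebraic k K]
    [Algebra.IsAlgebraic k K₀] (hv : IsValOf v 𝔭) {π : k}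
    (hπ : v π = (1 : ℤ)) {m : ℕ} (hm : 1 ≤ m) (hfin : ∀ a, 0 ≤ v a → 0 < v (a ^ p ^ m - a))
    (hKK' : K' ≤ K) (hunr : ¬ IsRamified K 𝔭) (hunr₀ : ¬ IsRamified K₀ 𝔭) {z z₀ : Ω} (hz : z ∈ K)
    (hz₀ : z₀ ∈ K₀) (hzK' : artinSchreier p z ∈ K') (hz₀K' : artinSchreier p z₀ ∈ K')
    {a : k} (ha : algebraMap k Ω a = artinSchreier p (z - z₀)) :
    ∃ x, a - artinSchreier p x ∈ 𝔭 := by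
  have := charP_intermediateField (p := p) K
  have : CharP k p := (algebraMap k Ω).charP (algebraMap k Ω).injective p
  obtain ⟨𝒪, h𝒪⟩ := exists_mem_placesAbove Ω 𝔭
  obtain ⟨x, hxK', -, hx⟩ := exists_sub_mem_of_unramified hv hπ hm hfin h𝒪 hunr hz hzK'
  obtain ⟨x₀, hx₀K', -, hx₀⟩ := exists_sub_mem_of_unramified hv hπ hm hfin h𝒪 hunr₀ hz₀ hz₀K'
  set 𝔓 := 𝒪.comap (algebraMap K Ω)
  have h𝔓 : 𝔓 ∈ placesAbove K 𝔭 := comap_mem_placesAbove h𝒪 K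
  have he : ramificationIndex k 𝔓 = 1 := by
    by_contra h
    exact hunr ⟨𝔓, h𝔓, h⟩
  obtain ⟨w, hw, hext, -⟩ := exists_normalized_val hv ⟨π, hπ⟩ h𝔓 (by rw [he]; exact one_ne_zero)
  rw [he] at hext
  let X : K := ⟨x - x₀, sub_mem (hKK' hxK') (hKK' hx₀K')⟩
  have hX : 0 ≤ w (algebraMap k K a - artinSchreier p X) := by
    rw [← hw]
    change algebraMap K Ω _ ∈ 𝒪
    rw [map_sub, ← IsScalarTower.algebraMap_apply, ha, map_artinSchreier,
      ← artinSchreier_sub]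
    have h1 : z - z₀ - algebraMap K Ω X = (z - x) - (z₀ - x₀) := by
      change z - z₀ - (x - x₀) = _
      ring
    rw [h1]
    exact sub_mem (pow_mem (sub_mem hx hx₀) p) (sub_mem hx hx₀)
  obtain ⟨x₁, -, -, hx₁⟩ := exists_reduced (p := p) (w := v) (⊤ : Subfield k)
    one_pos (Subfield.mem_top _) hπ
    (fun x _ hx => by
      obtain ⟨r, hr⟩ := exists_val_eq v hx
      exact ⟨r, by rw [hr, one_mul]⟩)
    (fun u hu => ⟨m, hm, hfin u hu.ge⟩) (c := a) (Subfield.mem_top _)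
  refine ⟨x₁, (hv _).mpr ?_⟩
  rcases hx₁ with hx₁ | ⟨t, ht, htp, hx₁⟩
  · exact hx₁
  · exfalso
    have h1 := hext _ _ hx₁
    have h2 : w (artinSchreier p (X - algebraMap k K x₁)) = (((1 : ℕ) : ℤ) * -(1 * t) : ℤ) := by
      have h3 : artinSchreier p (X - algebraMap k K x₁) = algebraMap k K (a - artinSchreier p x₁) -
          (algebraMap k K a - artinSchreier p X) := by
        rw [map_sub, map_artinSchreier, artinSchreier_sub]; ring
      rw [h3]
      refine val_sub_eq h1 (lt_of_lt_of_le ?_ hX)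
      exact_mod_cast (by push_cast; omega : ((1 : ℕ) : ℤ) * -(1 * t) < 0)
    obtain ⟨r, -, hr, -⟩ := val_of_artinSchreier_neg h2 (by push_cast; omega)
    exact htp ⟨-r, by push_cast at hr; linarith⟩

/-- The reduced pole of `a` in a totally ramified extension `K` of `K'`, seen in `K'`. -/
lemma exists_reduced_of_totallyRamified {n : ℕ} (hn : 1 ≤ n) [IsGalois k K]
    (hv : IsValOf v 𝔭) (hv1 : ∃ π, v π = (1 : ℤ)) {m : ℕ} (hm : 1 ≤ m)
    (hfin : ∀ a, 0 ≤ v a → 0 < v (a ^ p ^ m - a)) (h𝒪 : 𝒪 ∈ placesAbove Ω 𝔭)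
    (hN : Module.finrank k K = p ^ n) {σ : K ≃ₐ[k] K} (hσ : ∀ g, g ∈ Subgroup.zpowers σ)
    (hKK' : K' ≤ K) (hfix : ∀ x : K, (σ ^ p ^ (n - 1)) x = x ↔ (x : Ω) ∈ K')
    (hram : IsFullyRamified K 𝔭) {α : ℕ} (hα : conductor K 𝔭 ≤ α) {a : k} {lam : ℤ}
    (hlam : ¬ (p : ℤ) ∣ lam) (hle : (α : ℤ) ≤ lam) (ha : v a = (-lam : ℤ)) {z : Ω} (hz : z ∈ K)
    (hzK' : artinSchreier p z ∈ K') :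
    ∃ w' : AddValuation K' (WithTop ℤ), (∀ x, 0 ≤ w' x ↔ (x : Ω) ∈ 𝒪) ∧ ExtendsVal v w' (p ^ n) ∧
      (∀ x ≠ 0, ∃ r : ℤ, w' x = (p * r : ℤ)) ∧ ∃ (x y f : K') (L : ℤ),
        (f : Ω) = artinSchreier p z - artinSchreier p (y : Ω) ∧ ¬ (p : ℤ) ∣ L ∧ 0 < L ∧
        w' (algebraMap k K' a - artinSchreier p x) = (-(p * L) : ℤ) ∧
        ((-(p * L) : ℤ) : WithTop ℤ) < w' f := by
  have := charP_intermediateField (p := p) K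
  have := charP_intermediateField (p := p) K'
  have hp : p.Prime := Fact.out
  set 𝔓 := 𝒪.comap (algebraMap K Ω)
  have h𝔓 : 𝔓 ∈ placesAbove K 𝔭 := comap_mem_placesAbove h𝒪 K
  have hN0 : p ^ n ≠ 0 := pow_ne_zero _ hp.ne_zero
  have he : ramificationIndex k 𝔓 = p ^ n := by rw [hram 𝔓 h𝔓, hN]
  obtain ⟨w, hw, hext, hw1⟩ := exists_normalized_val hv hv1 h𝔓 (by rwa [he])
  rw [he] at hext
  have hcyc := isTotallyRamifiedCyclic_of_generator hv hv1 hm hfin h𝔓 hw hext hw1 hN hσ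
  let Z : K := ⟨z, hz⟩
  have hmapZ : algebraMap K Ω (artinSchreier p Z) = artinSchreier p z :=
    map_artinSchreier p (algebraMap K Ω) _
  obtain ⟨x, y, L, hx, hy, hL, hL0, hxL, hyL⟩ := exists_reduced_of_conductor_le hn hv hv1 hm hfin
    h𝔓 hw hext hw1 hN hσ hram hα hlam hle ha (z := Z)
    ((hfix _).mpr (by rw [show ((artinSchreier p Z : K) : Ω) = _ from hmapZ]; exact hzK'))
  rw [hfix] at hx hy
  let ι : K' →ₐ[k] K := IntermediateField.inclusion hKK'
  have hι : ∀ x : K', ((ι x : K) : Ω) = x := fun x => rfl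
  have hf : artinSchreier p z - artinSchreier p (y : Ω) ∈ K' :=
    sub_mem hzK' (sub_mem (pow_mem hy p) hy)
  have hιx : ι ⟨x, hx⟩ = x := rfl
  refine ⟨w.comap (ι : K' →+* K), fun x => ?_, fun b r hb => ?_, fun x hx => ?_, ⟨x, hx⟩, ⟨y, hy⟩,
    ⟨_, hf⟩, L, rfl, hL, hL0, ?_, ?_⟩
  · exact (hw (ι x)).symm
  · change w (ι (algebraMap k K' b)) = _
    rw [ι.commutes]; exact hext b r hb
  · change ∃ r : ℤ, w (ι x) = (p * r : ℤ)
    obtain ⟨r, hr⟩ := hcyc.dvd_val_fixed (j := n - 1) (Nat.sub_le n 1) (x := ι x) (by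
      rw [toRingAut_pow_apply, hfix]; exact x.2) (by simpa using hx)
    refine ⟨r, ?_⟩
    rw [hr, show n - (n - 1) = 1 by omega, pow_one]
  · change w (ι _) = _
    rw [map_sub, ι.commutes, map_artinSchreier, hιx]; exact hxL
  · change _ < w (ι _)
    have : ι ⟨_, hf⟩ = artinSchreier p Z - artinSchreier p y := by
      apply (algebraMap K Ω).injective
      rw [map_sub, hmapZ, map_artinSchreier]
      rfl
    rw [this]; exact hyL

/-- A reduced pole cannot be removed by elements with smaller poles. -/
lemma not_reduced_of_eq_add {K : Type*} [Field K] {w : AddValuation K (WithTop ℤ)}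
    (hdvd : ∀ x ≠ 0, ∃ r : ℤ, w x = (p * r : ℤ)) {c f f₀ X : K} {L : ℤ} (hL : ¬ (p : ℤ) ∣ L)
    (hL0 : 0 < L) (hc : w c = (-(p * L) : ℤ)) (hf : ((-(p * L) : ℤ) : WithTop ℤ) < w f)
    (hf₀ : ((-(p * L) : ℤ) : WithTop ℤ) < w f₀) (h : c = f - f₀ + artinSchreier p X) : False := by
  -- ℘(X) carries the whole pole p L, so w(X) = -L; but all values of w on this field are divisible
  -- by p, whereas L is not.
  have hp : (0 : ℤ) < p := by exact_mod_cast (Fact.out : p.Prime).pos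
  have h1 : w (artinSchreier p X) = (-(p * L) : ℤ) := by
    have : artinSchreier p X = c - (f - f₀) := by rw [h]; ring
    rw [this]
    refine val_sub_eq hc ?_
    rw [sub_eq_add_neg]
    exact AddValuation.map_lt_add w hf (by rwa [AddValuation.map_neg])
  obtain ⟨r, hr0, hr, hX⟩ := val_of_artinSchreier_neg h1 (by have := mul_pos hp hL0; omega)
  obtain ⟨s, hs⟩ := hdvd X (ne_zero_of_val hX)
  rw [hX] at hs
  have hs' : r = p * s := by exact_mod_cast hs
  refine hL ⟨-s, ?_⟩
  have h2 : (p : ℤ) * (L + r) = 0 := by linarith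
  have h3 : L + r = 0 := (mul_eq_zero.mp h2).resolve_left hp.ne'
  linarith

/-- The reduced pole order at a totally ramified place is bounded by the conductor. -/
lemma pole_lt_of_totallyRamified {n : ℕ} (hn : 1 ≤ n) [IsGalois k K] [IsGalois k K₀]
    (hv : IsValOf v 𝔭) (hv1 : ∃ π, v π = (1 : ℤ)) {m : ℕ} (hm : 1 ≤ m)
    (hfin : ∀ a, 0 ≤ v a → 0 < v (a ^ p ^ m - a))
    (hN : Module.finrank k K = p ^ n) {σ : K ≃ₐ[k] K} (hσ : ∀ g, g ∈ Subgroup.zpowers σ)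
    (hN₀ : Module.finrank k K₀ = p ^ n) {σ₀ : K₀ ≃ₐ[k] K₀}
    (hσ₀ : ∀ g, g ∈ Subgroup.zpowers σ₀) (hKK' : K' ≤ K) (hKK'₀ : K' ≤ K₀)
    (hfix : ∀ x : K, (σ ^ p ^ (n - 1)) x = x ↔ (x : Ω) ∈ K')
    (hfix₀ : ∀ x : K₀, (σ₀ ^ p ^ (n - 1)) x = x ↔ (x : Ω) ∈ K')
    (hram : IsFullyRamified K 𝔭) (hram₀ : IsFullyRamified K₀ 𝔭) {α : ℕ} (hα : conductor K 𝔭 ≤ α)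
    (hα₀ : conductor K₀ 𝔭 ≤ α) {z z₀ : Ω} (hz : z ∈ K)
    (hz₀ : z₀ ∈ K₀) (hzK' : artinSchreier p z ∈ K') (hz₀K' : artinSchreier p z₀ ∈ K')
    {a : k} (ha : algebraMap k Ω a = artinSchreier p (z - z₀)) {x : k} {t : ℤ}
    (htp : ¬ (p : ℤ) ∣ t) (hx : v (a - artinSchreier p x) = (-t : ℤ)) : t < α := by
  by_contra! hle
  have := charP_intermediateField (p := p) K'
  have hp : (0 : ℤ) < p := by exact_mod_cast (Fact.out : p.Prime).pos
  obtain ⟨𝒪, h𝒪⟩ := exists_mem_placesAbove Ω 𝔭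
  obtain ⟨w, hw, hext, hdvd, x₁, y₁, f, L, hf, hL, hL0, hxL, hyL⟩ :=
    exists_reduced_of_totallyRamified hn hv hv1 hm hfin h𝒪 hN hσ hKK' hfix hram hα htp hle hx
      hz hzK'
  obtain ⟨w₀, hw₀, hext₀, -, x₂, y₂, f₀, L₀, hf₀, hL₀, hL₀0, hxL₀, hyL₀⟩ :=
    exists_reduced_of_totallyRamified hn hv hv1 hm hfin h𝒪 hN₀ hσ₀ hKK'₀ hfix₀ hram₀ hα₀ htp hle hx
      hz₀ hz₀K'
  -- K and K₀ are treated separately, with valuations restricted to K' from the same place of Ω;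
  -- these coincide, so pole orders in K' can be compared.
  have hww : ∀ x, w₀ x = w x := ExtendsVal.val_eq_of_nonneg_imp
    (pow_ne_zero n (Fact.out : p.Prime).ne_zero) hv1 hext hext₀
    (fun x hx => (hw₀ x).mpr ((hw x).mp hx))
  rw [hww] at hxL₀ hyL₀
  have key : algebraMap k K' (a - artinSchreier p x) =
      f - f₀ + artinSchreier p (y₁ - y₂ - algebraMap k K' x) := by
    apply (algebraMap K' Ω).injective
    rw [← IsScalarTower.algebraMap_apply, map_sub, map_add, map_sub, ha, map_artinSchreier,
      map_artinSchreier, map_sub, map_sub, ← IsScalarTower.algebraMap_apply,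
      show algebraMap K' Ω f = _ from hf, show algebraMap K' Ω f₀ = _ from hf₀]
    simp only [artinSchreier_sub]
    change _ = _ - artinSchreier p (algebraMap K' Ω y₁) -
      (_ - artinSchreier p (algebraMap K' Ω y₂)) + _
    ring
  -- Whichever of L and L₀ is larger dominates the poles of both f and f₀, and that reduction of a
  -- yields the contradiction; L = L₀ need not be proved.
  rcases le_total L₀ L with h | h
  · refine not_reduced_of_eq_add hdvd hL hL0 hxL hyL (f₀ := f₀)
      (X := y₁ - y₂ - algebraMap k K' x - x₁) (lt_of_le_of_lt ?_ hyL₀) ?_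
    · exact WithTop.coe_le_coe.mpr (by nlinarith)
    · rw [key, artinSchreier_sub p _ x₁]; ring
  · refine not_reduced_of_eq_add hdvd hL₀ hL₀0 hxL₀ (f := f) (f₀ := f₀)
      (X := y₁ - y₂ - algebraMap k K' x - x₂) (lt_of_le_of_lt ?_ hyL) hyL₀ ?_
    · exact WithTop.coe_le_coe.mpr (by nlinarith)
    · rw [key, artinSchreier_sub p _ x₂]; ring

/-- At a fully decomposed place, `a` becomes small modulo `x ↦ x ^ p - x`. -/
lemma exists_sub_artinSchreier_mem_nonunits [IsGalois k K] [IsGalois k K₀] [FiniteDimensional k K]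
    [FiniteDimensional k K₀] (hv : IsValOf v 𝔭) (hv1 : ∃ π, v π = (1 : ℤ))
    (hdec : IsFullyDecomposed K 𝔭) (hdec₀ : IsFullyDecomposed K₀ 𝔭) {z z₀ : Ω} (hz : z ∈ K)
    (hz₀ : z₀ ∈ K₀) {a : k} (ha : algebraMap k Ω a = artinSchreier p (z - z₀)) :
    ∃ x, a - artinSchreier p x ∈ 𝔭.nonunits := by
  obtain ⟨𝒪, h𝒪⟩ := exists_mem_placesAbove Ω 𝔭
  obtain ⟨c, hc⟩ := exists_sub_mem_nonunits_of_isFullyDecomposed hv hv1 hdec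
    (comap_mem_placesAbove h𝒪 K) ⟨z, hz⟩
  obtain ⟨c₀, hc₀⟩ := exists_sub_mem_nonunits_of_isFullyDecomposed hv hv1 hdec₀
    (comap_mem_placesAbove h𝒪 K₀) ⟨z₀, hz₀⟩
  rw [mem_nonunits_comap, map_sub, ← IsScalarTower.algebraMap_apply] at hc hc₀
  refine ⟨c - c₀, ?_⟩
  rw [← show 𝒪.comap (algebraMap k Ω) = 𝔭 from h𝒪, mem_nonunits_comap, map_sub, map_artinSchreier,
    ha, ← artinSchreier_sub]
  apply artinSchreier_mem_nonunits
  have h1 : z - z₀ - algebraMap k Ω (c - c₀) =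
      (z - algebraMap k Ω c) - (z₀ - algebraMap k Ω c₀) := by
    rw [map_sub]; ring
  rw [h1]
  rw [ValuationSubring.mem_nonunits_iff] at hc hc₀ ⊢
  exact Valuation.map_sub_lt _ hc hc₀

end LocalComparison

/-! ### Cyclic extensions over a common subfield of index p -/

section CyclicTower

variable {k : Type*} [Field k] {p n : ℕ} [Fact p.Prime]

/-- The subfield of index `p` of a cyclic extension of degree `p ^ n`. -/
lemma pow_apply_eq_self_iff_mem {K : Type*} [Field K] [Algebra k K] [FiniteDimensional k K]
    [IsGalois k K] (hn : 1 ≤ n)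
    (hN : Module.finrank k K = p ^ n) {σ : K ≃ₐ[k] K} (hσ : ∀ g, g ∈ Subgroup.zpowers σ)
    {L : IntermediateField k K} (hL : Module.finrank k L = p ^ (n - 1)) (x : K) :
    (σ ^ p ^ (n - 1)) x = x ↔ x ∈ L := by
  have hp : p.Prime := Fact.out
  have hpn : p ^ n = p ^ (n - 1) * p := by rw [← pow_succ, Nat.sub_add_cancel hn]
  have hpos : 0 < p ^ (n - 1) := pow_pos hp.pos _
  have hord : orderOf σ = p ^ n := by
    rw [orderOf_eq_card_of_forall_mem_zpowers hσ, IsGalois.card_aut_eq_finrank, hN]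
  have hcard : Nat.card L.fixingSubgroup = p := by
    rw [IsGalois.card_fixingSubgroup_eq_finrank]
    have h1 := Module.finrank_mul_finrank k L K
    rw [hL, hN, hpn] at h1
    exact Nat.eq_of_mul_eq_mul_left hpos h1
  have hle : L.fixingSubgroup ≤ Subgroup.zpowers (σ ^ p ^ (n - 1)) := by
    intro h hh
    obtain ⟨i, rfl⟩ := mem_powers_iff_mem_zpowers.mpr (hσ h)
    have h1 : (σ ^ i) ^ p = 1 := by
      have h2 := pow_card_eq_one' (x := (⟨σ ^ i, hh⟩ : L.fixingSubgroup))
      rw [hcard] at h2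
      exact congrArg Subtype.val h2
    rw [← pow_mul, ← orderOf_dvd_iff_pow_eq_one, hord, hpn] at h1
    obtain ⟨j, rfl⟩ := Nat.dvd_of_mul_dvd_mul_right hp.pos h1
    exact ⟨j, by simp [pow_mul]⟩
  have heq : L.fixingSubgroup = Subgroup.zpowers (σ ^ p ^ (n - 1)) := by
    refine Subgroup.eq_of_le_of_card_ge hle ?_
    rw [hcard, Nat.card_zpowers, orderOf_pow_of_dvd hpos.ne'
      (by rw [hord, hpn]; exact dvd_mul_right _ _),
      hord, hpn, Nat.mul_div_cancel_left _ hpos]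
  constructor
  · intro hx
    rw [← IsGalois.fixedField_fixingSubgroup L, IntermediateField.mem_fixedField_iff, heq]
    have hst : Subgroup.zpowers (σ ^ p ^ (n - 1)) ≤ MulAction.stabilizer (K ≃ₐ[k] K) x :=
      Subgroup.zpowers_le.mpr hx
    exact fun f hf => hst hf
  · intro hx
    have h1 : σ ^ p ^ (n - 1) ∈ L.fixingSubgroup := by
      rw [heq]; exact Subgroup.mem_zpowers _
    exact (IntermediateField.mem_fixingSubgroup_iff _ _).mp h1 x hx

variable {Ω : Type*} [Field Ω] [Algebra k Ω] {K' K K₀ : IntermediateField k Ω}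

lemma coe_restrictNormal_pow [Normal k K] (φ : Ω ≃ₐ[k] Ω) (i : ℕ) (x : K) :
    (((φ.restrictNormal K) ^ i) x : Ω) = (toRingAut φ ^ i) x := by
  rw [toRingAut_pow_apply]
  have h : (φ.restrictNormal K) ^ i = (φ ^ i).restrictNormal K :=
    (map_pow (AlgEquiv.restrictNormalHom K) φ i).symm
  rw [h]
  exact AlgEquiv.restrictNormal_commutes (φ ^ i) K x

lemma pow_apply_eq_self_iff_coe_mem [FiniteDimensional k K] [IsGalois k K] (hn : 1 ≤ n)
    (hN : Module.finrank k K = p ^ n) {σ : K ≃ₐ[k] K} (hσ : ∀ g, g ∈ Subgroup.zpowers σ)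
    (hKK' : K' ≤ K) (hK' : Module.finrank k K' = p ^ (n - 1)) (x : K) :
    (σ ^ p ^ (n - 1)) x = x ↔ (x : Ω) ∈ K' := by
  rw [← IntermediateField.mem_restrict hKK']
  refine pow_apply_eq_self_iff_mem hn hN hσ ?_ x
  rw [← hK']
  exact (IntermediateField.restrictAlgEquiv hKK').toLinearEquiv.finrank_eq.symm

/-- An automorphism generating the Galois group of `K₀` generates that of any other cyclic `K` of
the same degree sharing with `K₀` a subfield of index `p`. -/
lemma restrictNormal_generates [FiniteDimensional k K] [IsGalois k K] [FiniteDimensional k K₀]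
    [IsGalois k K₀] [IsCyclic (K ≃ₐ[k] K)] (hn : 2 ≤ n) (hN : Module.finrank k K = p ^ n)
    (hN₀ : Module.finrank k K₀ = p ^ n) (hKK' : K' ≤ K) (hKK'₀ : K' ≤ K₀)
    (hK' : Module.finrank k K' = p ^ (n - 1)) {φ : Ω ≃ₐ[k] Ω}
    (hφ : ∀ g, g ∈ Subgroup.zpowers (φ.restrictNormal K₀)) :
    ∀ g, g ∈ Subgroup.zpowers (φ.restrictNormal K) := by
  have hp : p.Prime := Fact.out
  obtain ⟨g, hg⟩ := IsCyclic.exists_generator (α := K ≃ₐ[k] K)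
  obtain ⟨i, hi⟩ := mem_powers_iff_mem_zpowers.mpr (hg (φ.restrictNormal K))
  have hi : g ^ i = φ.restrictNormal K := hi
  have hord : orderOf g = p ^ n := by
    rw [orderOf_eq_card_of_forall_mem_zpowers hg, IsGalois.card_aut_eq_finrank, hN]
  by_cases hpi : p ∣ i
  · exfalso
    obtain ⟨j, rfl⟩ := hpi
    -- If φ were a p-th power on K, then φ ^ p ^ (n - 2) would be trivial on K'. Seen in K₀, it
    -- would lie in a group of order p, so φ ^ p ^ (n - 1) would be trivial on K₀, against the order
    -- p ^ n.
    have hpow : ∀ x ∈ K', (toRingAut φ ^ p ^ (n - 2)) x = x := by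
      intro x hx
      rw [← coe_restrictNormal_pow φ (p ^ (n - 2)) (⟨x, hKK' hx⟩ : K), ← hi, ← pow_mul]
      have h1 : p * j * p ^ (n - 2) = p ^ (n - 1) * j := by
        have : p ^ (n - 1) = p ^ (n - 2) * p := by rw [← pow_succ]; congr 1; omega
        rw [this]; ring
      have h2 : g ^ p ^ (n - 1) ∈ MulAction.stabilizer (K ≃ₐ[k] K) (⟨x, hKK' hx⟩ : K) :=
        (pow_apply_eq_self_iff_coe_mem (by omega) hN hg hKK' hK' ⟨x, hKK' hx⟩).mpr hx
      rw [h1, pow_mul]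
      exact congrArg Subtype.val (pow_mem h2 j)
    set σ₀ := φ.restrictNormal K₀
    have hord₀ : orderOf σ₀ = p ^ n := by
      rw [orderOf_eq_card_of_forall_mem_zpowers hφ, IsGalois.card_aut_eq_finrank, hN₀]
    let L := IntermediateField.restrict hKK'₀
    have hmem : σ₀ ^ p ^ (n - 2) ∈ L.fixingSubgroup := by
      rw [IntermediateField.mem_fixingSubgroup_iff]
      intro x hx
      apply Subtype.ext
      rw [coe_restrictNormal_pow]
      exact hpow _ ((IntermediateField.mem_restrict hKK'₀ x).mp hx)
    have hcard : Nat.card L.fixingSubgroup = p := by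
      rw [IsGalois.card_fixingSubgroup_eq_finrank]
      have h1 := Module.finrank_mul_finrank k L K₀
      have h2 : Module.finrank k L = p ^ (n - 1) := by
        rw [← hK']
        exact (IntermediateField.restrictAlgEquiv hKK'₀).toLinearEquiv.finrank_eq.symm
      have hpn : p ^ n = p ^ (n - 1) * p := by rw [← pow_succ, Nat.sub_add_cancel (by omega)]
      rw [h2, hN₀, hpn] at h1
      exact Nat.eq_of_mul_eq_mul_left (pow_pos hp.pos _) h1
    have h3 : (σ₀ ^ p ^ (n - 2)) ^ p = 1 := by
      have h2 := pow_card_eq_one' (x := (⟨_, hmem⟩ : L.fixingSubgroup))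
      rw [hcard] at h2
      exact congrArg Subtype.val h2
    rw [← pow_mul, ← pow_succ, ← orderOf_dvd_iff_pow_eq_one, hord₀,
      Nat.pow_dvd_pow_iff_le_right hp.one_lt] at h3
    omega
  · have hgmem : g ∈ Subgroup.zpowers (φ.restrictNormal K) := by
      rw [← hi, mem_zpowers_pow_iff, hord]
      exact Nat.Coprime.pow_right n ((Nat.Prime.coprime_iff_not_dvd hp).mpr hpi).symm
    exact fun h => Subgroup.zpowers_le.mpr hgmem (hg h)

/-! ### Artin–Schreier generators attached to one automorphism -/

section Generators

variable [CharP Ω p] [FiniteDimensional k K] [IsGalois k K] {φ : Ω ≃ₐ[k] Ω}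

omit [Fact p.Prime] [CharP Ω p] [FiniteDimensional k K] in
lemma apply_mem_of_normal (i : ℕ) {x : Ω} (hx : x ∈ K) : (toRingAut φ ^ i) x ∈ K := by
  rw [← coe_restrictNormal_pow φ i (⟨x, hx⟩ : K)]
  exact Subtype.mem _

omit [Fact p.Prime] [CharP Ω p] in
lemma exists_algebraMap_eq_of_fixed (hφ : ∀ g, g ∈ Subgroup.zpowers (φ.restrictNormal K)) {x : Ω}
    (hx : x ∈ K) (hfix : toRingAut φ x = x) : ∃ a : k, algebraMap k Ω a = x := by
  have h1 : (⟨x, hx⟩ : K) ∈ (⊥ : IntermediateField k K) := by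
    rw [IsGalois.mem_bot_iff_fixed]
    have hst : φ.restrictNormal K ∈ MulAction.stabilizer (K ≃ₐ[k] K) (⟨x, hx⟩ : K) := by
      refine Subtype.ext ?_
      have := coe_restrictNormal_pow φ 1 (⟨x, hx⟩ : K)
      rw [pow_one, pow_one] at this
      exact this.trans hfix
    exact fun f => Subgroup.zpowers_le.mpr hst (hφ f)
  obtain ⟨a, ha⟩ := IntermediateField.mem_bot.mp h1
  exact ⟨a, congrArg Subtype.val ha⟩

omit [CharP Ω p] in
lemma toRingAut_pow_apply_eq_self_iff (hn : 1 ≤ n) (hN : Module.finrank k K = p ^ n)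
    (hφ : ∀ g, g ∈ Subgroup.zpowers (φ.restrictNormal K)) (hKK' : K' ≤ K)
    (hK' : Module.finrank k K' = p ^ (n - 1)) {x : Ω} (hx : x ∈ K) :
    (toRingAut φ ^ p ^ (n - 1)) x = x ↔ x ∈ K' := by
  have h := pow_apply_eq_self_iff_coe_mem hn hN hφ hKK' hK' ⟨x, hx⟩
  rw [← h, ← coe_restrictNormal_pow φ _ (⟨x, hx⟩ : K)]
  exact ⟨fun h => Subtype.ext h, fun h => congrArg Subtype.val h⟩

lemma exists_mem_map_eq_add_one (hN : Module.finrank k K = p ^ n)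
    (hφ : ∀ g, g ∈ Subgroup.zpowers (φ.restrictNormal K)) {j : ℕ} (hj : j < n) :
    ∃ z ∈ K, (toRingAut φ ^ p ^ j) z = z + 1 := by
  have hp : p.Prime := Fact.out
  have := charP_intermediateField (p := p) K
  set σ := φ.restrictNormal K with hσ
  have hord : orderOf σ = p ^ n := by
    rw [orderOf_eq_card_of_forall_mem_zpowers hφ, IsGalois.card_aut_eq_finrank, hN]
  obtain ⟨z, hz⟩ := exists_map_eq_add_one p (τ := toRingAut (σ ^ p ^ j)) (a := n) (by
    ext x
    rw [toRingAut_pow_apply, ← pow_mul, mul_comm, pow_mul, ← hord, pow_orderOf_eq_one, one_pow]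
    rfl) (by
    intro h
    have h1 : σ ^ p ^ j = 1 := by
      ext x
      exact congrArg Subtype.val (RingEquiv.congr_fun h x)
    rw [← orderOf_dvd_iff_pow_eq_one, hord, Nat.pow_dvd_pow_iff_le_right hp.one_lt] at h1
    omega)
  refine ⟨z, z.2, ?_⟩
  rw [← coe_restrictNormal_pow φ _ z]
  exact congrArg Subtype.val hz

lemma artinSchreier_mem_of_map_eq_add_one (hn : 1 ≤ n) (hN : Module.finrank k K = p ^ n)
    (hφ : ∀ g, g ∈ Subgroup.zpowers (φ.restrictNormal K)) (hKK' : K' ≤ K)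
    (hK' : Module.finrank k K' = p ^ (n - 1)) {z : Ω} (hz : z ∈ K)
    (hφz : (toRingAut φ ^ p ^ (n - 1)) z = z + 1) : artinSchreier p z ∈ K' := by
  have hmem : artinSchreier p z ∈ K := sub_mem (pow_mem hz p) hz
  rw [← toRingAut_pow_apply_eq_self_iff hn hN hφ hKK' hK' hmem]
  have h1 : artinSchreier p (1 : Ω) = 0 := by simpa using artinSchreier_natCast (K := Ω) p 1
  rw [map_artinSchreier, hφz, artinSchreier_add, h1, add_zero]

/-- Two extensions with the same automorphism differ by an Artin-Schreier extension of `k`. -/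
lemma exists_artinSchreier_sub_eq [FiniteDimensional k K₀] [IsGalois k K₀] (hn : 1 ≤ n)
    (hN : Module.finrank k K = p ^ n) (hN₀ : Module.finrank k K₀ = p ^ n)
    (hφ : ∀ g, g ∈ Subgroup.zpowers (φ.restrictNormal K))
    (hφ₀ : ∀ g, g ∈ Subgroup.zpowers (φ.restrictNormal K₀)) (hKK' : K' ≤ K) (hKK'₀ : K' ≤ K₀)
    (hK' : Module.finrank k K' = p ^ (n - 1)) {z₀ : Ω} (hz₀ : z₀ ∈ K₀)
    (hφz₀ : (toRingAut φ ^ p ^ (n - 1)) z₀ = z₀ + 1) :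
    ∃ z ∈ K, (toRingAut φ ^ p ^ (n - 1)) z = z + 1 ∧
      ∃ a : k, algebraMap k Ω a = artinSchreier p (z - z₀) := by
  have hp : p.Prime := Fact.out
  have hNpos : 0 < p ^ (n - 1) := pow_pos hp.pos _
  obtain ⟨z, hz, hφz⟩ := exists_mem_map_eq_add_one hN hφ (Nat.sub_lt hn one_pos)
  set τ := toRingAut φ
  have hfix : ∀ x ∈ K, (τ ^ p ^ (n - 1)) x = x ↔ x ∈ K' := fun x hx =>
    toRingAut_pow_apply_eq_self_iff hn hN hφ hKK' hK' hx
  have hfix₀ : ∀ x ∈ K₀, (τ ^ p ^ (n - 1)) x = x ↔ x ∈ K' := fun x hx =>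
    toRingAut_pow_apply_eq_self_iff hn hN₀ hφ₀ hKK'₀ hK' hx
  have hcomm : ∀ x, (τ ^ p ^ (n - 1)) (τ x) = τ ((τ ^ p ^ (n - 1)) x) := fun x => by
    change ((τ ^ p ^ (n - 1)) * τ) x = (τ * τ ^ p ^ (n - 1)) x
    rw [← pow_succ, pow_succ']
  have hτK : ∀ x ∈ K, τ x ∈ K := fun x hx => by
    have h := apply_mem_of_normal (φ := φ) 1 hx
    rwa [pow_one] at h
  have hτK₀ : ∀ x ∈ K₀, τ x ∈ K₀ := fun x hx => by
    have h := apply_mem_of_normal (φ := φ) 1 hx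
    rwa [pow_one] at h
  have hτK' : ∀ x ∈ K', τ x ∈ K' := fun x hx => by
    rw [← hfix _ (hτK _ (hKK' hx)), hcomm, (hfix x (hKK' hx)).mpr hx]
  have hsub : subOne τ z ∈ K' := by
    rw [subOne_apply, ← hfix _ (sub_mem (hτK z hz) hz), map_sub, hcomm, hφz, map_add, map_one]
    ring
  have hsub₀ : subOne τ z₀ ∈ K' := by
    rw [subOne_apply, ← hfix₀ _ (sub_mem (hτK₀ z₀ hz₀) hz₀), map_sub, hcomm, hφz₀, map_add, map_one]
    ring
  have hpow : ∀ x, (subOne τ ^ (p ^ (n - 1) - 1)) (subOne τ x) = (τ ^ p ^ (n - 1)) x - x := by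
    intro x
    rw [← end_mul_apply, ← pow_succ, Nat.sub_add_cancel hNpos, subOne_pow_char_pow]
  -- Hilbert 90 in K', where (τ - 1) ^ (N - 1) is the trace to k. The element θ = τ z₀ - z₀ has
  -- trace τ ^ N z₀ - z₀ = 1, and for z - z₀ the same computation gives trace 0. Replacing z by z -
  -- h makes z - z₀ fixed by τ.
  obtain ⟨h, hhK', hh⟩ := exists_map_sub_eq (τ := τ) (E := K'.toSubfield) (N := p ^ (n - 1)) hτK'
    hsub₀ (by rw [hpow, hφz₀]; ring) (g := subOne τ (z - z₀))
    (by rw [map_sub]; exact sub_mem hsub hsub₀)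
    (by rw [hpow, map_sub, hφz, hφz₀]; ring)
  have hhK : h ∈ K := hKK' hhK'
  have hφzh : (τ ^ p ^ (n - 1)) (z - h) = z - h + 1 := by
    rw [map_sub, hφz, (hfix h hhK).mpr hhK']; ring
  refine ⟨z - h, sub_mem hz hhK, hφzh, ?_⟩
  have hyK' : artinSchreier p (z - h - z₀) ∈ K' := by
    rw [artinSchreier_sub]
    exact sub_mem (artinSchreier_mem_of_map_eq_add_one hn hN hφ hKK' hK' (sub_mem hz hhK) hφzh)
      (artinSchreier_mem_of_map_eq_add_one hn hN₀ hφ₀ hKK'₀ hK' hz₀ hφz₀)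
  refine exists_algebraMap_eq_of_fixed hφ (hKK' hyK') ?_
  change τ _ = _
  rw [map_artinSchreier]
  congr 1
  rw [subOne_apply, map_sub] at hh
  rw [map_sub, map_sub]
  linear_combination -hh

/-- The first layer of the tower. -/
lemma exists_artinSchreier_generator_bot (hn : 2 ≤ n) (hN : Module.finrank k K = p ^ n)
    (hφ : ∀ g, g ∈ Subgroup.zpowers (φ.restrictNormal K)) (hKK' : K' ≤ K)
    (hK' : Module.finrank k K' = p ^ (n - 1)) :
    ∃ y ∈ K', (∀ a : k, algebraMap k Ω a ≠ y) ∧ ∃ a : k, algebraMap k Ω a = artinSchreier p y := by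
  obtain ⟨y, hyK, hy⟩ := exists_mem_map_eq_add_one (j := 0) hN hφ (by omega)
  rw [pow_zero, pow_one] at hy
  have hpow : ∀ i : ℕ, (toRingAut φ ^ i) y = y + i := by
    intro i
    induction i with
    | zero => simp
    | succ i ih => rw [ringAut_pow_succ_apply, ih, map_add, map_natCast, hy]; push_cast; ring
  refine ⟨y, ?_, fun a ha => ?_, ?_⟩
  · rw [← toRingAut_pow_apply_eq_self_iff (by omega) hN hφ hKK' hK' hyK, hpow]
    -- Here n ≥ 2 is essential: the first layer lies in K' only if K' is strictly larger than k.
    have : p ∣ p ^ (n - 1) := dvd_pow_self p (by omega)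
    rw [(CharP.cast_eq_zero_iff Ω p _).mpr this, add_zero]
  · have h1 : toRingAut φ y = y := by rw [← ha]; exact φ.commutes a
    rw [hy] at h1
    exact one_ne_zero (add_eq_left.mp h1)
  · refine exists_algebraMap_eq_of_fixed hφ (sub_mem (pow_mem hyK p) hyK) ?_
    have h1 : artinSchreier p (1 : Ω) = 0 := by simpa using artinSchreier_natCast (K := Ω) p 1
    change toRingAut φ (artinSchreier p y) = artinSchreier p y
    rw [map_artinSchreier, hy, artinSchreier_add, h1, add_zero]

end Generators

/-- An extension of degree `p` is determined by a common element outside the base. -/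
lemma eq_of_mem_of_notMem (hN : Module.finrank k K = p ^ n) (hN₀ : Module.finrank k K₀ = p ^ n)
    (hn : 1 ≤ n) (hKK' : K' ≤ K) (hKK'₀ : K' ≤ K₀) (hK' : Module.finrank k K' = p ^ (n - 1)) {z : Ω}
    (hz : z ∈ K) (hz₀ : z ∈ K₀) (hzK' : z ∉ K') : K = K₀ := by
  have hp : p.Prime := Fact.out
  have hfd : FiniteDimensional k K :=
    Module.finite_of_finrank_pos (by rw [hN]; exact pow_pos hp.pos n)
  have hfd₀ : FiniteDimensional k K₀ :=
    Module.finite_of_finrank_pos (by rw [hN₀]; exact pow_pos hp.pos n)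
  -- The degree of K ∩ K₀ is a power of p between p ^ (n - 1) and p ^ n, and z shows that it is not
  -- the smaller one.
  have hMK : K ⊓ K₀ ≤ K := inf_le_left
  have hMK₀ : K ⊓ K₀ ≤ K₀ := inf_le_right
  have hfdM : FiniteDimensional k ↥(K ⊓ K₀) :=
    FiniteDimensional.of_injective (IntermediateField.inclusion hMK).toLinearMap
      (IntermediateField.inclusion hMK).injective
  have hdvd := IntermediateField.finrank_dvd_of_le_right hMK
  rw [hN, Nat.dvd_prime_pow hp] at hdvd
  obtain ⟨i, hi, hM⟩ := hdvd
  have hle : K' ≤ K ⊓ K₀ := le_inf hKK' hKK'₀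
  have hin : i = n := by
    by_contra hne
    have h1 : Module.finrank k K' = Module.finrank k ↥(K ⊓ K₀) := by
      have h2 := IntermediateField.finrank_dvd_of_le_right hle
      rw [hK', hM, Nat.pow_dvd_pow_iff_le_right hp.one_lt] at h2
      rw [hK', hM]
      congr 1
      omega
    have h3 := IntermediateField.eq_of_le_of_finrank_eq hle h1
    exact hzK' (h3 ▸ IntermediateField.mem_inf.mpr ⟨hz, hz₀⟩)
  subst hin
  exact (IntermediateField.eq_of_le_of_finrank_eq hMK (hM.trans hN.symm)).symm.trans
    (IntermediateField.eq_of_le_of_finrank_eq hMK₀ (hM.trans hN₀.symm))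

end CyclicTower

/-! ### The injection and the count -/

section Count

variable {p : ℕ} [Fact p.Prime] {F : Type*} [Field F] [Finite F] [CharP F p]
  {Ω : Type*} [Field Ω] [Algebra (RatFunc F) Ω] {P : F[X]} {hP : Irreducible P} {n α : ℕ}
  {K' K K₀ : IntermediateField (RatFunc F) Ω}

omit [Finite F] [CharP F p] in
lemma IsAdmissible.finiteDimensional {K : Type*} [Field K] [Algebra (RatFunc F) K]
    (h : IsAdmissible hP p n α K) : FiniteDimensional (RatFunc F) K :=
  Module.finite_of_finrank_pos (by rw [h.finrank_eq]; exact pow_pos (Fact.out : p.Prime).pos n)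

omit [Fact p.Prime] [Finite F] in
lemma charP_ratFunc : CharP (RatFunc F) p :=
  charP_of_injective_algebraMap (algebraMap F (RatFunc F)).injective p

/-- The constant `y ^ p - y` attached to a pair of admissible extensions can be normalized to have
its only pole at `P`, of order less than the bound on the conductor. -/
lemma IsAdmissible.exists_sub_artinSchreier_mem_polarParts (hmonic : P.Monic) (hn : 1 ≤ n)
    (h : IsAdmissible hP p n α K) (h₀ : IsAdmissible hP p n α K₀) (hKK' : K' ≤ K) (hKK'₀ : K' ≤ K₀)
    (hK' : Module.finrank (RatFunc F) K' = p ^ (n - 1)) {z z₀ : Ω} (hz : z ∈ K) (hz₀ : z₀ ∈ K₀)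
    (hzK' : artinSchreier p z ∈ K') (hz₀K' : artinSchreier p z₀ ∈ K') {a : RatFunc F}
    (ha : algebraMap (RatFunc F) Ω a = artinSchreier p (z - z₀)) :
    ∃ x, a - artinSchreier p x ∈ polarParts P (α - 1) := by
  have := charP_ratFunc (p := p) (F := F)
  have : CharP Ω p := charP_of_injective_algebraMap (algebraMap (RatFunc F) Ω).injective p
  have := h.finiteDimensional
  have := h₀.finiteDimensional
  have := h.isGalois
  have := h₀.isGalois
  have := h.isCyclic
  have := h₀.isCyclic
  obtain ⟨σ, hσ⟩ := IsCyclic.exists_generator (α := K ≃ₐ[RatFunc F] K)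
  obtain ⟨σ₀, hσ₀⟩ := IsCyclic.exists_generator (α := K₀ ≃ₐ[RatFunc F] K₀)
  refine FunctionFieldCount.exists_sub_artinSchreier_mem_polarParts p hmonic hP ?_ ?_ ?_
  · intro Q hQ hQm hne
    obtain ⟨m, hm, hfin⟩ := exists_pow_sub_self_pos_finiteVal hQ p
    have hunr : ∀ {L : IntermediateField (RatFunc F) Ω}, IsAdmissible hP p n α L →
        ¬ IsRamified L (finitePlace hQ) := fun hL hram =>
      finitePlace_ne hQ hP hmonic hQm hne ((hL.ramified_iff _ (finitePlace_ne_top hQ)).mp hram)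
    exact exists_sub_artinSchreier_mem_of_unramified (isValOf_finiteVal hQ) (finiteVal_self hQ) hm
      hfin hKK' (hunr h) (hunr h₀) hz hz₀ hzK' hz₀K' ha
  · refine exists_sub_artinSchreier_mem_nonunits (isValOf_inftyVal F) ⟨RatFunc.X⁻¹, ?_⟩
      h.fullyDecomposed h₀.fullyDecomposed hz hz₀ ha
    rw [inftyVal_eq (inv_ne_zero RatFunc.X_ne_zero), RatFunc.intDegree_inv, RatFunc.intDegree_X]
    norm_num
  · intro x t _ htp hx
    obtain ⟨m, hm, hfin⟩ := exists_pow_sub_self_pos_finiteVal hP p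
    have hcond : ∀ {L : IntermediateField (RatFunc F) Ω}, IsAdmissible hP p n α L →
        conductor L (finitePlace hP) ≤ α := fun hL => by
      simpa using hL.conductor_dvd _ (finitePlace_ne_top hP)
    exact pole_lt_of_totallyRamified hn (isValOf_finiteVal hP) ⟨_, finiteVal_self hP⟩ hm hfin
      h.finrank_eq hσ h₀.finrank_eq hσ₀ hKK' hKK'₀
      (pow_apply_eq_self_iff_coe_mem hn h.finrank_eq hσ hKK' hK')
      (pow_apply_eq_self_iff_coe_mem hn h₀.finrank_eq hσ₀ hKK'₀ hK')
      h.fullyRamified h₀.fullyRamified (hcond h) (hcond h₀) hz hz₀ hzK' hz₀K' ha htp hx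

/-- The set of admissible extensions is finite, and its size times that of the group of the
`j a₁ + u ^ p - u` is at most the number of polar parts. -/
lemma finite_and_ncard_mul_le [IsAlgClosure (RatFunc F) Ω] (hmonic : P.Monic) (hn : 2 ≤ n)
    (hK' : Module.finrank (RatFunc F) K' = p ^ (n - 1)) {s : ℕ} (hs : p * s ≤ α - 1) :
    {K : IntermediateField (RatFunc F) Ω | K' ≤ K ∧ IsAdmissible hP p n α K}.Finite ∧
      {K : IntermediateField (RatFunc F) Ω | K' ≤ K ∧ IsAdmissible hP p n α K}.ncard * p *
        Nat.card F ^ (P.natDegree * s) ≤ Nat.card F ^ (P.natDegree * (α - 1)) := by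
  set S := {K : IntermediateField (RatFunc F) Ω | K' ≤ K ∧ IsAdmissible hP p n α K} with hS
  rcases S.eq_empty_or_nonempty with hempty | ⟨K₀, hKK'₀, h₀⟩
  · rw [hempty]; simp
  have hp : p.Prime := Fact.out
  have hn1 : 1 ≤ n := by omega
  have := charP_ratFunc (p := p) (F := F)
  have : CharP Ω p := charP_of_injective_algebraMap (algebraMap (RatFunc F) Ω).injective p
  have := h₀.finiteDimensional
  have := h₀.isGalois
  have := h₀.isCyclic
  have hnormal : Normal (RatFunc F) Ω := IsAlgClosure.normal _ _
  obtain ⟨σ₀, hσ₀⟩ := IsCyclic.exists_generator (α := K₀ ≃ₐ[RatFunc F] K₀)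
  -- One automorphism of Ω provides compatible generators for all admissible extensions at once,
  -- which makes their Artin–Schreier generators comparable.
  set φ : Ω ≃ₐ[RatFunc F] Ω := σ₀.liftNormal Ω
  have hφσ₀ : φ.restrictNormal K₀ = σ₀ := σ₀.restrict_liftNormal Ω
  have hφ₀ : ∀ g, g ∈ Subgroup.zpowers (φ.restrictNormal K₀) := by rw [hφσ₀]; exact hσ₀
  obtain ⟨z₀, hz₀, hφz₀⟩ :=
    exists_mem_map_eq_add_one (p := p) h₀.finrank_eq hφ₀ (Nat.sub_lt (by omega : 0 < n) one_pos)
  have hz₀K' := artinSchreier_mem_of_map_eq_add_one hn1 h₀.finrank_eq hφ₀ hKK'₀ hK' hz₀ hφz₀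
  have hexists : ∀ K : S, ∃ y : Ω, z₀ + y ∈ (K : IntermediateField (RatFunc F) Ω) ∧ z₀ + y ∉ K' ∧
      ∃ a ∈ polarParts P (α - 1), algebraMap (RatFunc F) Ω a = artinSchreier p y := by
    rintro ⟨K, hKK', h⟩
    have := h.finiteDimensional
    have := h.isGalois
    have := h.isCyclic
    have hφ : ∀ g, g ∈ Subgroup.zpowers (φ.restrictNormal K) :=
      restrictNormal_generates hn h.finrank_eq h₀.finrank_eq hKK' hKK'₀ hK' hφ₀
    obtain ⟨z, hz, hφz, a, ha⟩ := exists_artinSchreier_sub_eq hn1 h.finrank_eq h₀.finrank_eq hφ hφ₀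
      hKK' hKK'₀ hK' hz₀ hφz₀
    obtain ⟨x, hx⟩ := h.exists_sub_artinSchreier_mem_polarParts hmonic hn1 h₀ hKK' hKK'₀ hK' hz hz₀
      (artinSchreier_mem_of_map_eq_add_one hn1 h.finrank_eq hφ hKK' hK' hz hφz) hz₀K' ha
    have hzK' : z ∉ K' := by
      rw [← toRingAut_pow_apply_eq_self_iff hn1 h.finrank_eq hφ hKK' hK' hz, hφz]
      simp
    have heq : z₀ + (z - z₀ - algebraMap (RatFunc F) Ω x) = z - algebraMap (RatFunc F) Ω x := by
      ring
    refine ⟨z - z₀ - algebraMap (RatFunc F) Ω x, ?_, ?_, _, hx, ?_⟩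
    · rw [heq]; exact sub_mem hz (K.algebraMap_mem x)
    · rw [heq]
      intro hmem
      exact hzK' (by simpa using add_mem hmem (K'.algebraMap_mem x))
    · rw [map_sub, ha, map_artinSchreier, ← artinSchreier_sub]
  choose y hyK hyK' a haP hay using hexists
  obtain ⟨y₁, a₁, hy₁K', hy₁, ha₁P, ha₁⟩ : ∃ (y₁ : Ω) (a₁ : RatFunc F), y₁ ∈ K' ∧
      (∀ c : RatFunc F, algebraMap (RatFunc F) Ω c ≠ y₁) ∧ a₁ ∈ polarParts P (α - 1) ∧
      algebraMap (RatFunc F) Ω a₁ = artinSchreier p y₁ := by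
    obtain ⟨y₁, hy₁K', hy₁, a₁, ha₁⟩ :=
      exists_artinSchreier_generator_bot hn h₀.finrank_eq hφ₀ hKK'₀ hK'
    have hy₁AS : artinSchreier p y₁ ∈ K' := sub_mem (pow_mem hy₁K' p) hy₁K'
    -- The first-layer constant is normalized by comparing K₀ with itself, through the generators z₀
    -- + y₁ and z₀.
    obtain ⟨x, hx⟩ := h₀.exists_sub_artinSchreier_mem_polarParts hmonic hn1 h₀ hKK'₀ hKK'₀ hK'
      (add_mem hz₀ (hKK'₀ hy₁K')) hz₀ (by rw [artinSchreier_add]; exact add_mem hz₀K' hy₁AS) hz₀K'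
      (a := a₁) (by rw [ha₁]; congr 1; ring)
    refine ⟨y₁ - algebraMap (RatFunc F) Ω x, a₁ - artinSchreier p x,
      sub_mem hy₁K' (K'.algebraMap_mem x), fun c hc => hy₁ (c + x) ?_, hx, ?_⟩
    · rw [map_add, hc]; ring
    · rw [map_sub, ha₁, map_artinSchreier, ← artinSchreier_sub]
  -- Adding j a₁ or ℘(u) to a_K changes the generator z₀ + y_K only by j y₁ or by u, both in K', and
  -- hence does not change K. Counting these values with K accounts for the factors p and q ^ (d s).
  let f : S × Fin p × polarParts P s → polarParts P (α - 1) := fun t =>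
    ⟨a t.1 + (t.2.1 : ℕ) * a₁ + artinSchreier p (t.2.2 : RatFunc F),
      add_mem (add_mem (haP t.1) (by rw [← nsmul_eq_mul]; exact nsmul_mem ha₁P _))
        (artinSchreier_mem_polarParts p hmonic hP hs t.2.2.2)⟩
  have hf : Function.Injective f := by
    rintro ⟨K, j, u⟩ ⟨L, i, t⟩ heq
    have h1 : a K + (j : ℕ) * a₁ + artinSchreier p (u : RatFunc F) =
        a L + (i : ℕ) * a₁ + artinSchreier p (t : RatFunc F) := congrArg Subtype.val heq
    have h2 := congrArg (algebraMap (RatFunc F) Ω) h1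
    simp only [map_add, map_mul, map_natCast, hay, ha₁, map_artinSchreier,
      ← artinSchreier_natCast_mul, ← artinSchreier_add] at h2
    rw [← sub_eq_zero, ← artinSchreier_sub] at h2
    -- Equal images determine the Artin–Schreier roots up to the prime field, so z₀ + y_K lies in L
    -- up to elements of K'.
    obtain ⟨c, hc⟩ := exists_natCast_of_artinSchreier_eq_zero p h2
    have hKL : K = L := by
      have h3 : z₀ + y K = (z₀ + y L) + ((i : ℕ) * y₁ - (j : ℕ) * y₁ +
          algebraMap (RatFunc F) Ω (c + t - u)) := by
        rw [map_sub, map_add, map_natCast]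
        linear_combination hc
      have h4 : (i : ℕ) * y₁ - (j : ℕ) * y₁ + algebraMap (RatFunc F) Ω (c + t - u) ∈ K' :=
        add_mem (sub_mem (mul_mem (natCast_mem K' _) hy₁K') (mul_mem (natCast_mem K' _) hy₁K'))
          (K'.algebraMap_mem _)
      have h5 : z₀ + y K ∈ (L : IntermediateField (RatFunc F) Ω) := by
        rw [h3]; exact add_mem (hyK L) (L.2.1 h4)
      exact Subtype.ext (eq_of_mem_of_notMem K.2.2.finrank_eq L.2.2.finrank_eq hn1 K.2.1 L.2.1 hK'
        (hyK K) h5 (hyK' K))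
    subst hKL
    have hij : j = i := by
      by_contra hne
      have hne' : ((j : ℕ) : RatFunc F) - ((i : ℕ) : RatFunc F) ≠ 0 := by
        rw [sub_ne_zero]
        intro h3
        rw [CharP.cast_eq_iff_mod_eq (RatFunc F) p, Nat.mod_eq_of_lt j.2,
          Nat.mod_eq_of_lt i.2] at h3
        exact hne (Fin.ext h3)
      -- If j ≠ i, the relation could be solved for y₁, which would then lie in k.
      refine hy₁ ((c + t - u) / ((j : ℕ) - (i : ℕ))) ?_
      have hne'' := (map_ne_zero (algebraMap (RatFunc F) Ω)).mpr hne'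
      rw [_root_.map_div₀, div_eq_iff hne'']
      simp only [map_sub, map_add, map_natCast]
      linear_combination -hc
    subst hij
    have hut : (u : RatFunc F) - t = c := by
      apply (algebraMap (RatFunc F) Ω).injective
      rw [map_sub, map_natCast]
      linear_combination hc
    have hmem : (u : RatFunc F) - t ∈ (infinitePlace F).nonunits :=
      polarParts_mem_nonunits hP.ne_zero (sub_mem u.2 t.2)
    rw [hut] at hmem
    have hc0 := natCast_eq_zero_of_mem_nonunits p hmem
    rw [hc0, sub_eq_zero] at hut
    rw [Subtype.ext hut]
  have hfin := finite_polarParts (F := F) hP.ne_zero (α - 1)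
  have hfin' := finite_polarParts (F := F) hP.ne_zero s
  have hSfin : Finite S := Finite.of_injective (fun K => f (K, ⟨0, hp.pos⟩, 0))
    fun K L hKL => congrArg Prod.fst (hf hKL)
  refine ⟨S.toFinite, ?_⟩
  have hcard := Nat.card_le_card_of_injective f hf
  rwa [Nat.card_prod, Nat.card_prod, Nat.card_fin, natCard_polarParts hP.ne_zero,
    natCard_polarParts hP.ne_zero, Nat.card_coe_set_eq, ← mul_assoc] at hcard

end Count

end FunctionFieldCount

end

theorem lemma4p5 (p : ℕ) [Fact p.Prime] (F : Type*) [Field F] [Finite F] [CharP F p]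
    (Ω : Type*) [Field Ω] [Algebra (RatFunc F) Ω] [IsAlgClosure (RatFunc F) Ω]
    (P : F[X]) (hmonic : P.Monic) (hP : Irreducible P) (n α : ℕ) (hn : 2 ≤ n)
    (K' : IntermediateField (RatFunc F) Ω)
    (hK' : Module.finrank (RatFunc F) K' = p ^ (n - 1)) :
    {K : IntermediateField (RatFunc F) Ω |
        K' ≤ K ∧ FunctionFieldCount.IsAdmissible hP p n α K}.Finite ∧
      ({K : IntermediateField (RatFunc F) Ω |
          K' ≤ K ∧ FunctionFieldCount.IsAdmissible hP p n α K}.ncard : ℚ) ≤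
        (1 + FunctionFieldCount.wSum P p α) / p ∧
      (1 + FunctionFieldCount.wSum P p α : ℚ) / p =
        1 / p * (Nat.card F : ℚ) ^ (P.natDegree * (α - ⌈(α : ℚ) / p⌉₊)) := by
  have hp : 0 < p := (Fact.out : p.Prime).pos
  have hq : 0 < Nat.card F := Nat.card_pos
  have hw := FunctionFieldCount.one_add_wSum p hP α
  -- ⌊(α - 1) / p⌋ is the largest s for which ℘ maps polar parts of order at most s to ones of order
  -- at most α - 1; it gives the sharpest bound.
  have hdiv : p * ((α - 1) / p) ≤ α - 1 := Nat.mul_div_le _ _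
  obtain ⟨hfin, hcard⟩ :=
    FunctionFieldCount.finite_and_ncard_mul_le (hP := hP) (Ω := Ω) hmonic hn hK' hdiv
  refine ⟨hfin, ?_, ?_⟩
  · rw [le_div_iff₀ (by exact_mod_cast hp)]
    have hsplit : P.natDegree * (α - 1) =
        P.natDegree * (α - 1 - (α - 1) / p) + P.natDegree * ((α - 1) / p) := by
      rw [← mul_add, Nat.sub_add_cancel (Nat.div_le_self _ _)]
    rw [hsplit, pow_add, ← hw] at hcard
    exact_mod_cast Nat.le_of_mul_le_mul_right hcard (pow_pos hq _)
  · rw [FunctionFieldCount.sub_ceil_div p hp α, one_div, div_eq_inv_mul]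
    congr 1
    exact_mod_cast hw
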